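/- Fix $d\in\mathbb Z\setminus\{0\}$ and $\kappa\in\mathbb R$ with $\kappa^2\ge 2d^2$. Let $H=\{w:\int_0^\infty (w'^2+w^2)\,r\,dr<\infty\}$, $X=\{u\in H:\int_0^\infty u^2 r^{-2}\,r\,dr<\infty\}$ (weak derivatives on $(0,\infty)$, Hilbert norms $\|w\|_H^2=\int_0^\infty (w'^2+w^2)\,r\,dr$ and $\|u\|_X^2=\int_0^\infty (u'^2+u^2+u^2/r^2)\,r\,dr$), $Y_0=X\times X\times H$. For $g\in\mathbb R$ put $$\mathcal E_{\kappa,g}(f,S,m)=\frac12\int_0^\infty\Big\{f'^2+\Big[\frac{S'}{r}\Big]^2+m'^2+\kappa^2 g\,m^2+\frac{(d-S)^2f^2}{r^2}+\frac{\kappa^2}{2}(1-f^2-m^2)^2\Big\}\,r\,dr .$$ Let $(\tilde f_\kappa,\tilde S_\kappa)$ be a normal core solution: $C^2$ functions on $(0,\infty)$ with $$-f''-\tfrac1r f'+\tfrac{(d-S)^2}{r^2}f=\kappa^2(1-f^2)f,\qquad -S''+\tfrac1rS'=(d-S)f^2,$$ $\mathcal E_{\kappa,g}(\tilde f_\kappa,\tilde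 S_\kappa,0)<\infty$, $\tilde f_\kappa\ge0$ and $\tilde S_\kappa(r)\to0$ as $r\to0^+$. Let $Y=\{(\tilde f_\kappa+u,\tilde S_\kappa+rv,w):(u,v,w)\in Y_0\}$, and define $$-g_\kappa^*=\inf_{w\in H\setminus\{0\}}\frac{\int_0^\infty[\kappa^{-2}w'^2-(1-\tilde f_\kappa^2)w^2]\,r\,dr}{\int_0^\infty w^2\,r\,dr}.$$ Then: 1. $\mathcal E_{\kappa,g}$ is finite on $Y$ and is a $C^\infty$ function of $((u,v,w),g)\in Y_0\times\mathbb R$. Let $\mathcal F:Y\times\mathbb R\to Y_0^*$, $\mathcal F(f,S,m,g)=\mathcal E_{\kappa,g}'(f,S,m)$ (the derivative with respect to $(u,v,w)$), and let $\mathcal F'(f,S,m,g)\in L(Y_0,Y_0^*)$ be its linearization with respect to $(f,S,m)$. Then $\mathcal F(\tilde f_\kappa,\tilde S_\kappa,0,g)=0$ for every $g\in\mathbb R$. 2. $g_\kappa^*>0$, the infimum is attained, and $-\kappa^2g_\kappa^*$ is the lowest eigenvalue of $-\Delta_r-\kappa^2(1-\tilde f_\kappa^2)$ (defined by its quadratic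 form on $H$); it is simple, with an eigenfunction $w_\kappa\in H$ that is positive almost everywhere. 3. $\ker\mathcal F'(\tilde f_\kappa,\tilde S_\kappa,0,g_\kappa^*)$ is one-dimensional and spanned by $(0,0,w_\kappa)$, the range of $\mathcal F'(\tilde f_\kappa,\tilde S_\kappa,0,g_\kappa^*)$ has codimension one in $Y_0^*$, and $\frac{\partial}{\partial g}\mathcal F'(\tilde f_\kappa,\tilde S_\kappa,0,g)\big|_{g=g_\kappa^*}[0,0,w_\kappa]$ does not belong to this range. 4. $g^*_\kappa$ is a bifurcation point. For every closed complement $Z$ of $\ker\mathcal F'(\tilde f_\kappa,\tilde S_\kappa,0,g_\kappa^*)$ in $Y_0$ there are an open neighbourhood $U$ of $(0,g_\kappa^*)$ in $Y_0\times\mathbb R$, a number $a>0$ and $C^1$ maps $\gamma:(-a,a)\to\mathbb R$, $\psi:(-a,a)\to Z$ with $\gamma(0)=g_\kappa^*$, $\psi(0)=0$, such that the set of nontrivial zeros in $U$, that is of all $((u,v,w),g)\in U$ with $(u,v,w)\ne0$ and $\mathcal F(\tilde f_\kappa+u,\tilde S_\kappa+rv,w,g)=0$, is exactly the curve $$\big\{\big(s\,[(0,0,w_\kappa)+\psi(s)],\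 \gamma(s)\big):\ 0<|s|<a\big\}.$$ All points of this curve have a nonvanishing third component $m=w$ (antiferromagnetic core). -/

import Mathlib

open MeasureTheory Set Filter Topology
open scoped ContDiff

namespace SO5Vortex

noncomputable section

/-- The measure `r dr` on the half line `(0, ∞)`. -/
def radialMeasure : Measure ℝ :=
  (volume.restrict (Ioi (0 : ℝ))).withDensity fun r => ENNReal.ofReal r

/-- The space `L²_r` of square integrable functions with respect to `r dr`. -/
abbrev RadialL2 : Type := Lp ℝ 2 radialMeasure

/-- `p` is the weak derivative of `u` on `(0, ∞)`. -/
def HasWeakDeriv (u p : ℝ → ℝ) : Prop :=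
  ∀ φ : ℝ → ℝ, ContDiff ℝ ∞ φ → HasCompactSupport φ → tsupport φ ⊆ Ioi 0 →
    ∫ r in Ioi (0 : ℝ), u r * deriv φ r = -∫ r in Ioi (0 : ℝ), p r * φ r

theorem ae_of_ae_radial {P : ℝ → Prop} (h : ∀ᵐ r ∂radialMeasure, P r) :
    ∀ᵐ r ∂(volume.restrict (Ioi (0 : ℝ))), P r := by
  rw [radialMeasure, ae_withDensity_iff (by fun_prop)] at h
  filter_upwards [h, ae_restrict_mem measurableSet_Ioi] with r hr h0
  exact hr (by simpa using h0)

theorem integrableOn_mul_test (u : RadialL2) (φ : ℝ → ℝ) (hφ : Continuous φ)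
    (hc : HasCompactSupport φ) (hs : tsupport φ ⊆ Ioi 0) :
    IntegrableOn (fun r => u r * φ r) (Ioi (0 : ℝ)) := by
  have hcont : Continuous fun r : ℝ => φ r / r := by
    refine continuous_iff_continuousAt.2 fun x => ?_
    by_cases hx : x = 0
    · have h0 : x ∉ tsupport φ := fun h => by
        have := hs h
        simp [hx] at this
      have he : (fun r : ℝ => φ r / r) =ᶠ[𝓝 x] fun _ => 0 := by
        filter_upwards [(isClosed_tsupport φ).isOpen_compl.mem_nhds h0] with y hy
        simp [image_eq_zero_of_notMem_tsupport hy]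
      exact (continuousAt_const).congr he.symm
    · exact hφ.continuousAt.div continuousAt_id hx
  have hcs : HasCompactSupport fun r : ℝ => φ r / r := by
    have h := hc.mul_right (f' := fun r : ℝ => r⁻¹)
    have he : (φ * fun r : ℝ => r⁻¹) = fun r : ℝ => φ r / r := by
      ext r
      simp [div_eq_mul_inv]
    rwa [he] at h
  have hfin : IsFiniteMeasureOnCompacts radialMeasure := by
    refine ⟨fun K hK => ?_⟩
    obtain ⟨C, hC⟩ := hK.isBounded.exists_norm_le
    rw [radialMeasure, withDensity_apply' _ K]
    calc ∫⁻ r in K, ENNReal.ofReal r ∂(volume.restrict (Ioi 0))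
        ≤ ∫⁻ _ in K, ENNReal.ofReal C ∂(volume.restrict (Ioi 0)) := by
          refine setLIntegral_mono' hK.measurableSet fun r hr => ?_
          exact ENNReal.ofReal_le_ofReal ((le_abs_self r).trans (hC r hr))
      _ < ⊤ := by
          rw [setLIntegral_const]
          refine ENNReal.mul_lt_top ENNReal.ofReal_lt_top ?_
          exact (Measure.restrict_apply_le _ _).trans_lt hK.measure_lt_top
  have hL : MemLp (fun r : ℝ => φ r / r) 2 radialMeasure :=
    hcont.memLp_of_hasCompactSupport hcs
  have hint : Integrable (fun r => u r * (φ r / r)) radialMeasure :=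
    (Lp.memLp u).integrable_mul hL
  have hint2 := (integrable_withDensity_iff_integrable_smul₀'
    (μ := volume.restrict (Ioi (0 : ℝ))) (f := fun r : ℝ => ENNReal.ofReal r)
    (by fun_prop) (by simp)).1 hint
  refine hint2.congr ?_
  filter_upwards [ae_restrict_mem measurableSet_Ioi] with r hr
  have hr' : (0 : ℝ) < r := hr
  simp only [ENNReal.toReal_ofReal hr'.le, smul_eq_mul]
  field_simp

theorem HasWeakDeriv.zero : HasWeakDeriv (0 : RadialL2) (0 : RadialL2) := by
  intro φ _ _ _
  have h := ae_of_ae_radial (Lp.coeFn_zero ℝ 2 radialMeasure)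
  have h1 : ∫ r in Ioi (0 : ℝ), (0 : RadialL2) r * deriv φ r = 0 :=
    integral_eq_zero_of_ae (by filter_upwards [h] with r hr; rw [hr]; simp)
  have h2 : ∫ r in Ioi (0 : ℝ), (0 : RadialL2) r * φ r = 0 :=
    integral_eq_zero_of_ae (by filter_upwards [h] with r hr; rw [hr]; simp)
  rw [h1, h2, neg_zero]

theorem HasWeakDeriv.add {u p v q : RadialL2} (h : HasWeakDeriv u p) (k : HasWeakDeriv v q) :
    HasWeakDeriv (u + v : RadialL2) (p + q : RadialL2) := by
  intro φ hφ hc hs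
  have hd : Continuous (deriv φ) := hφ.continuous_deriv (by simp)
  have hdc := hc.deriv
  have hds : tsupport (deriv φ) ⊆ Ioi 0 := tsupport_deriv_subset.trans hs
  have e1 : ∫ r in Ioi (0 : ℝ), (u + v : RadialL2) r * deriv φ r
      = ∫ r in Ioi (0 : ℝ), (u r * deriv φ r + v r * deriv φ r) := by
    refine integral_congr_ae ?_
    filter_upwards [ae_of_ae_radial (Lp.coeFn_add u v)] with r hr
    rw [hr, Pi.add_apply, add_mul]
  have e2 : ∫ r in Ioi (0 : ℝ), (p + q : RadialL2) r * φ r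
      = ∫ r in Ioi (0 : ℝ), (p r * φ r + q r * φ r) := by
    refine integral_congr_ae ?_
    filter_upwards [ae_of_ae_radial (Lp.coeFn_add p q)] with r hr
    rw [hr, Pi.add_apply, add_mul]
  rw [e1, e2, integral_add (integrableOn_mul_test u _ hd hdc hds)
    (integrableOn_mul_test v _ hd hdc hds),
    integral_add (integrableOn_mul_test p _ hφ.continuous hc hs)
    (integrableOn_mul_test q _ hφ.continuous hc hs), h φ hφ hc hs, k φ hφ hc hs]
  ring

theorem HasWeakDeriv.smul (c : ℝ) {u p : RadialL2} (h : HasWeakDeriv u p) :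
    HasWeakDeriv (c • u : RadialL2) (c • p : RadialL2) := by
  intro φ hφ hc hs
  have e1 : ∫ r in Ioi (0 : ℝ), (c • u : RadialL2) r * deriv φ r
      = ∫ r in Ioi (0 : ℝ), c * (u r * deriv φ r) := by
    refine integral_congr_ae ?_
    filter_upwards [ae_of_ae_radial (Lp.coeFn_smul c u)] with r hr
    rw [hr, Pi.smul_apply, smul_eq_mul, mul_assoc]
  have e2 : ∫ r in Ioi (0 : ℝ), (c • p : RadialL2) r * φ r
      = ∫ r in Ioi (0 : ℝ), c * (p r * φ r) := by
    refine integral_congr_ae ?_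
    filter_upwards [ae_of_ae_radial (Lp.coeFn_smul c p)] with r hr
    rw [hr, Pi.smul_apply, smul_eq_mul, mul_assoc]
  rw [e1, e2, integral_const_mul, integral_const_mul, h φ hφ hc hs]
  ring

/-- The Hilbert space `H = H¹_r`: pairs `(w, w')` in `L²_r` with `w'` the weak derivative of `w`,
with `‖w‖² = ∫ (w'² + w²) r dr`. -/
def SpaceH : Submodule ℝ (PiLp 2 fun _ : Fin 2 => RadialL2) where
  carrier := {w | HasWeakDeriv (w 0) (w 1)}
  zero_mem' := HasWeakDeriv.zero
  add_mem' h k := HasWeakDeriv.add h k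
  smul_mem' c _ h := HasWeakDeriv.smul c h

/-- The Hilbert space `X`: triples `(u, u', u / r)` in `L²_r` with `u'` the weak derivative of `u`,
with `‖u‖² = ∫ (u'² + u² + u² / r²) r dr`. -/
def SpaceX : Submodule ℝ (PiLp 2 fun _ : Fin 3 => RadialL2) where
  carrier := {u | HasWeakDeriv (u 0) (u 1) ∧ ∀ᵐ r ∂radialMeasure, u 2 r = u 0 r / r}
  zero_mem' := by
    refine ⟨HasWeakDeriv.zero, ?_⟩
    filter_upwards [Lp.coeFn_zero ℝ 2 radialMeasure] with r hr
    change (0 : RadialL2) r = (0 : RadialL2) r / r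
    rw [hr]
    simp
  add_mem' := by
    rintro a b ⟨ha, ha'⟩ ⟨hb, hb'⟩
    refine ⟨HasWeakDeriv.add ha hb, ?_⟩
    filter_upwards [ha', hb', Lp.coeFn_add (a 0) (b 0), Lp.coeFn_add (a 2) (b 2)]
      with r h1 h2 h3 h4
    change (a 2 + b 2 : RadialL2) r = (a 0 + b 0 : RadialL2) r / r
    rw [h3, h4, Pi.add_apply, Pi.add_apply, h1, h2, add_div]
  smul_mem' := by
    rintro c a ⟨ha, ha'⟩
    refine ⟨HasWeakDeriv.smul c ha, ?_⟩
    filter_upwards [ha', Lp.coeFn_smul c (a 0), Lp.coeFn_smul c (a 2)] with r h1 h2 h3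
    change (c • a 2 : RadialL2) r = (c • a 0 : RadialL2) r / r
    rw [h2, h3, Pi.smul_apply, Pi.smul_apply, h1, smul_eq_mul, smul_eq_mul, mul_div_assoc]

/-- The function underlying an element of `H`. -/
def Hfn (w : SpaceH) : ℝ → ℝ := w.1 0

/-- The weak derivative of an element of `H`. -/
def Hder (w : SpaceH) : ℝ → ℝ := w.1 1

/-- The function underlying an element of `X`. -/
def Xfn (u : SpaceX) : ℝ → ℝ := u.1 0

/-- The weak derivative of an element of `X`. -/
def Xder (u : SpaceX) : ℝ → ℝ := u.1 1

/-- `Y₀ = X × X × H`. -/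
abbrev SpaceY₀ : Type := SpaceX × SpaceX × SpaceH

/-- The density, with respect to `r dr`, of the reduced free energy of degree `d`, at radius `r`,
as a function of the values `f, S, m` and of their derivatives `f', S', m'`. -/
def energyDensity (d : ℤ) (κ g : ℝ) (f f' S S' m m' r : ℝ) : ℝ :=
  1 / 2 * (f' ^ 2 + (S' / r) ^ 2 + m' ^ 2 + κ ^ 2 * g * m ^ 2
    + (d - S) ^ 2 * f ^ 2 / r ^ 2 + κ ^ 2 / 2 * (1 - f ^ 2 - m ^ 2) ^ 2)

/-- The system `(GL)_{κ,g}`, satisfied in the classical sense on `(0, ∞)`. -/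
structure SolvesGL (d : ℤ) (κ g : ℝ) (f S m : ℝ → ℝ) : Prop where
  contDiff_f : ContDiffOn ℝ 2 f (Ioi 0)
  contDiff_S : ContDiffOn ℝ 2 S (Ioi 0)
  contDiff_m : ContDiffOn ℝ 2 m (Ioi 0)
  eq_f : ∀ r, 0 < r → -deriv (deriv f) r - 1 / r * deriv f r + (d - S r) ^ 2 / r ^ 2 * f r
    = κ ^ 2 * (1 - f r ^ 2 - m r ^ 2) * f r
  eq_S : ∀ r, 0 < r → -deriv (deriv S) r + 1 / r * deriv S r = (d - S r) * f r ^ 2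
  eq_m : ∀ r, 0 < r → -deriv (deriv m) r - 1 / r * deriv m r + κ ^ 2 * g * m r
    = κ ^ 2 * (1 - f r ^ 2 - m r ^ 2) * m r

/-- Admissible solutions of `(GL)_{κ,g}`; the condition `S(0) = 0` is a limit at `0`, so that
the values of `f` and `S` outside `(0, ∞)` play no role. -/
structure IsAdmissible (d : ℤ) (κ g : ℝ) (f S m : ℝ → ℝ) : Prop where
  solves : SolvesGL d κ g f S m
  finite_energy : Integrable
    (fun r => energyDensity d κ g (f r) (deriv f r) (S r) (deriv S r) (m r) (deriv m r) r)
    radialMeasure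
  f_nonneg : ∀ r, 0 < r → 0 ≤ f r
  m_nonneg : ∀ r, 0 < r → 0 ≤ m r
  S_zero : Tendsto S (𝓝[>] 0) (𝓝 0)
  m_deriv_zero : HasDerivWithinAt m 0 (Ici 0) 0

/-- Normal core solutions: admissible solutions with `m = 0` (no condition depends on `g` then). -/
def IsNormalCore (d : ℤ) (κ : ℝ) (f S : ℝ → ℝ) : Prop :=
  ∀ g : ℝ, IsAdmissible d κ g f S 0

/-- The energy density of the point `(f + u, S + r v, w)` of the affine space
`Y = (f, S, 0) + Y₀`, as a function of `r`; the derivative of `S + r v` is `S' + v + r v'`. -/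
def densityAt (d : ℤ) (κ : ℝ) (f S : ℝ → ℝ) (y : SpaceY₀) (g : ℝ) (r : ℝ) : ℝ :=
  energyDensity d κ g
    (f r + Xfn y.1 r) (deriv f r + Xder y.1 r)
    (S r + r * Xfn y.2.1 r) (deriv S r + Xfn y.2.1 r + r * Xder y.2.1 r)
    (Hfn y.2.2 r) (Hder y.2.2 r) r

/-- The energy `𝓔_{κ,g}(f + u, S + r v, w)` for `y = (u, v, w)`. -/
def energy (d : ℤ) (κ : ℝ) (f S : ℝ → ℝ) (y : SpaceY₀) (g : ℝ) : ℝ :=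
  ∫ r, densityAt d κ f S y g r ∂radialMeasure

/-- The map `𝓕 : Y × ℝ → Y₀*`, `𝓕(y, g) = 𝓔_{κ,g}'(y)`, in the coordinates `Y = (f, S, 0) + Y₀`. -/
def mapF (d : ℤ) (κ : ℝ) (f S : ℝ → ℝ) (y : SpaceY₀) (g : ℝ) : SpaceY₀ →L[ℝ] ℝ :=
  fderiv ℝ (fun z : SpaceY₀ => energy d κ f S z g) y

/-- The linearization `𝓕'(f, S, 0, g)` of `𝓕` with respect to `Y` at the base point. -/
def linF (d : ℤ) (κ : ℝ) (f S : ℝ → ℝ) (g : ℝ) : SpaceY₀ →L[ℝ] (SpaceY₀ →L[ℝ] ℝ) :=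
  fderiv ℝ (fun y : SpaceY₀ => mapF d κ f S y g) 0

/-- The values on `H ∖ {0}` of the Rayleigh quotient of `-(1/κ²) Δ_r - (1 - f²)`. -/
def rayleighSet (κ : ℝ) (f : ℝ → ℝ) : Set ℝ :=
  {q | ∃ w : SpaceH, w ≠ 0 ∧
    q = (∫ r, (1 / κ ^ 2 * Hder w r ^ 2 - (1 - f r ^ 2) * Hfn w r ^ 2) ∂radialMeasure)
      / ∫ r, Hfn w r ^ 2 ∂radialMeasure}

/-- `g*_κ`: minus the ground state energy of `-(1/κ²) Δ_r - (1 - f²)`. -/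
def gStar (κ : ℝ) (f : ℝ → ℝ) : ℝ := -sInf (rayleighSet κ f)

/-- `w` is an eigenfunction, with eigenvalue `lam`, of `-Δ_r - V` (defined by its form on `H`). -/
def IsEigenfunction (V : ℝ → ℝ) (lam : ℝ) (w : SpaceH) : Prop :=
  w ≠ 0 ∧ ∀ φ : SpaceH,
    ∫ r, (Hder w r * Hder φ r - V r * Hfn w r * Hfn φ r) ∂radialMeasure
      = lam * ∫ r, Hfn w r * Hfn φ r ∂radialMeasure

end

end SO5Vortex

open SO5Vortex

/-! The energy is a sum of squares. For y = (u, v, w), the five quantities f' + u', S'/r + v/r + v',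
w', (d - S - rv)(f + u)/r and 1 - (f + u)² - w² are quadratic polynomials in y with values in L²_r.
Hence 𝓔 is a polynomial of degree four in y and affine in g. Continuity of these polynomials rests
on three facts: X embeds in L^∞ (`Xrep_sq_le`), H embeds in L⁴_r (`Hrep_pow_four`), and the core
satisfies 0 ≤ f ≤ 1 and |d - S| ≤ |d| (`CoreODE.f_le_one`, `CoreODE.sq_T_le`). The core equations
cancel the constant term of the derivative, so that 𝓕(y, g) = L₀ y + g L₁ y + R₂ y + R₃ y with R₂,
R₃ homogeneous of degrees two and three (`CoreODE.mapF_eq`).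

The energy is even in w, so the Hessian at the core splits into a form in (u, v) and a form in w.
Put T = d - S. Completing the square (`uvDensity_eq`) writes the first one as the Jacobi form of u,
that is ∫ [u'² + T²u²/r² - κ²(1 - f²)u²] r dr, plus squares, plus (2κ² - 4T²) f²u². The Jacobi form
is nonnegative because f > 0 is a null solution of its operator (`CoreODE.jacobi_nonneg`), and 2κ² ≥
4d² ≥ 4T² by hypothesis. So the (u, v) form is positive definite (`CoreODE.uvForm_pos`).

The w form is that of -Δ_r - κ²(1 - f²) + κ²g. In dimension two an attractive potential always
binds: exp(-r^ε) has Dirichlet energy ε/4, while its potential energy stays away from 0, which gives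
g* > 0 (`CoreODE.gStar_pos`). Since 1 - f² tends to 0 at infinity, for g > 0 the form is coercive up
to finitely many point evaluations (`exists_finite_functionals`), and a positive definite form with
this property is coercive (`coercive_of_posDef`). This takes the place of compact embeddings and
produces a minimizer. A ground state with a zero could be cut off there and remain a ground state,
against uniqueness for the ODE; so ground states have no zeros, and the lowest eigenvalue is simple.

At g* the Hessian L is therefore symmetric and nonnegative, with kernel spanned by w₀ = (0, 0, w).
Adding the square of y ↦ ⟨w, y₃⟩ makes it coercive, and Lax-Milgram yields Y₀* = ℝ L₁w₀ + range L
(`CoreODE.exists_eq_smul_add`). Symmetry gives L₁w₀ ∉ range L, because (L₁w₀)(w₀) = κ²‖w‖² > 0.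
These are the hypotheses of bifurcation from a simple eigenvalue, proved in
`exists_bifurcation_curve` by writing y = s(w₀ + z), dividing by s and applying the implicit
function theorem. -/

namespace SO5Vortex

/-! ### Locally absolutely continuous functions on (0, ∞) -/

/-- `p` is integrable on every compact subinterval of `(0, ∞)`. -/
def LocInt (p : ℝ → ℝ) : Prop := ∀ a b, 0 < a → 0 < b → IntervalIntegrable p volume a b

/-- `U` is a locally absolutely continuous function on `(0, ∞)` with derivative `p`. -/
structure HasPrim (U p : ℝ → ℝ) : Prop where
  locInt : LocInt p
  sub_eq : ∀ a b, 0 < a → 0 < b → U b - U a = ∫ x in a..b, p x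

theorem uIcc_subset_Ioi {a b : ℝ} (ha : 0 < a) (hb : 0 < b) : uIcc a b ⊆ Ioi 0 :=
  (convex_Ioi (0 : ℝ)).ordConnected.uIcc_subset ha hb

theorem LocInt.locallyIntegrableOn {p : ℝ → ℝ} (h : LocInt p) :
    LocallyIntegrableOn p (Ioi 0) := by
  intro x hx
  have hx' : (0 : ℝ) < x := hx
  refine ⟨Ioc (x / 2) (2 * x), mem_nhdsWithin_of_mem_nhds (Ioc_mem_nhds (by linarith) (by linarith)),
    ?_⟩
  exact (intervalIntegrable_iff_integrableOn_Ioc_of_le (by linarith)).1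
    (h (x / 2) (2 * x) (by linarith) (by linarith))

theorem LocInt.congr {p q : ℝ → ℝ} (h : LocInt p) (e : ∀ᵐ x, 0 < x → p x = q x) : LocInt q := by
  intro a b ha hb
  refine (h a b ha hb).congr_ae ?_
  filter_upwards [ae_restrict_of_ae e, ae_restrict_mem measurableSet_uIoc] with x hx hm
  exact hx (uIcc_subset_Ioi ha hb (uIoc_subset_uIcc hm))

theorem LocInt.of_continuousOn {p : ℝ → ℝ} (h : ContinuousOn p (Ioi 0)) : LocInt p :=
  fun _ _ ha hb => (h.mono (uIcc_subset_Ioi ha hb)).intervalIntegrable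

theorem LocInt.continuousOn_mul {p q : ℝ → ℝ} (h : ContinuousOn p (Ioi 0)) (k : LocInt q) :
    LocInt fun x => p x * q x :=
  fun a b ha hb => (k a b ha hb).continuousOn_mul (h.mono (uIcc_subset_Ioi ha hb))

theorem LocInt.of_integrableOn {p : ℝ → ℝ} (h : IntegrableOn p (Ioi 0)) : LocInt p :=
  fun _ _ ha hb => (h.mono_set (uIcc_subset_Ioi ha hb)).intervalIntegrable

theorem HasPrim.continuousOn {U p : ℝ → ℝ} (h : HasPrim U p) : ContinuousOn U (Ioi 0) := by
  intro x hx
  have hx' : (0 : ℝ) < x := hx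
  have h1 := intervalIntegral.continuousOn_primitive_interval' (μ := volume) (a := x / 2)
    (h.locInt (x / 2) (2 * x) (by linarith) (by linarith)) (by simp)
  have h2 : ContinuousAt (fun y => U (x / 2) + ∫ t in (x / 2)..y, p t) x := by
    refine continuousAt_const.add (h1.continuousAt ?_)
    rw [uIcc_of_le (by linarith)]
    exact Icc_mem_nhds (by linarith) (by linarith)
  refine (h2.congr ?_).continuousWithinAt
  filter_upwards [Ioi_mem_nhds hx'] with y hy
  rw [← h.sub_eq (x / 2) y (by linarith) hy]
  ring

theorem HasPrim.ae_hasDerivAt {U p : ℝ → ℝ} (h : HasPrim U p) :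
    ∀ᵐ x, 0 < x → HasDerivAt U (p x) x := by
  -- The intervals [1/(n+1), n+1] exhaust (0, ∞) and all contain 1, so a countable union of null
  -- sets suffices and 1 can serve as common base point.
  have key : ∀ n : ℕ, ∀ᵐ x, x ∈ uIcc (1 / (n + 1 : ℝ)) (n + 1) →
      ∀ c ∈ uIcc (1 / (n + 1 : ℝ)) (n + 1), HasDerivAt (fun y => ∫ t in c..y, p t) (p x) x :=
    fun n => (h.locInt _ _ (by positivity) (by positivity)).ae_hasDerivAt_integral
  filter_upwards [ae_all_iff.2 key] with x hx hx0
  obtain ⟨n, hn⟩ := exists_nat_gt (max x (1 / x))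
  have hn1 : x < n := (le_max_left _ _).trans_lt hn
  have hn2 : 1 / x < n := (le_max_right _ _).trans_lt hn
  have hle : 1 / (n + 1 : ℝ) ≤ 1 := by
    rw [div_le_one (by positivity)]; linarith [n.cast_nonneg (α := ℝ)]
  have hle2 : (1 : ℝ) ≤ n + 1 := by linarith [n.cast_nonneg (α := ℝ)]
  have hxm : x ∈ uIcc (1 / (n + 1 : ℝ)) (n + 1) := by
    rw [uIcc_of_le (hle.trans hle2)]
    refine ⟨?_, by linarith⟩
    rw [div_le_iff₀ (by positivity)]
    rw [div_lt_iff₀ hx0] at hn2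
    nlinarith
  have h1m : (1 : ℝ) ∈ uIcc (1 / (n + 1 : ℝ)) (n + 1) := by
    rw [uIcc_of_le (hle.trans hle2)]
    exact ⟨hle, hle2⟩
  have h2 := (hx n hxm 1 h1m).const_add (U 1)
  refine h2.congr_of_eventuallyEq ?_
  filter_upwards [Ioi_mem_nhds hx0] with y hy
  rw [← h.sub_eq 1 y one_pos hy]
  ring

theorem HasPrim.absolutelyContinuous {U p : ℝ → ℝ} (h : HasPrim U p) {a b : ℝ} (ha : 0 < a)
    (hb : 0 < b) : AbsolutelyContinuousOnInterval U a b := by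
  have h1 := (h.locInt a b ha hb).absolutelyContinuousOnInterval_intervalIntegral
    (c := a) (by simp)
  rw [absolutelyContinuousOnInterval_iff] at h1 ⊢
  intro ε hε
  obtain ⟨δ, hδ, hE⟩ := h1 ε hε
  refine ⟨δ, hδ, fun E hEm hEs => ?_⟩
  refine lt_of_eq_of_lt (Finset.sum_congr rfl fun i hi => ?_) (hE E hEm hEs)
  have hi1 := uIcc_subset_Ioi ha hb (hEm.1 i hi).1
  have hi2 := uIcc_subset_Ioi ha hb (hEm.1 i hi).2
  rw [← h.sub_eq a _ ha hi1, ← h.sub_eq a _ ha hi2, dist_sub_right]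

/-- The integrations by parts of the file apply this product rule to a suitable product and then
discard its boundary terms. -/
theorem HasPrim.mul {U p V q : ℝ → ℝ} (h : HasPrim U p) (k : HasPrim V q) :
    HasPrim (fun x => U x * V x) (fun x => p x * V x + U x * q x) := by
  refine ⟨fun a b ha hb => ?_, fun a b ha hb => ?_⟩
  · exact ((h.locInt a b ha hb).mul_continuousOn
      (k.continuousOn.mono (uIcc_subset_Ioi ha hb))).add
      ((k.locInt a b ha hb).continuousOn_mul (h.continuousOn.mono (uIcc_subset_Ioi ha hb)))
  · rw [← (h.absolutelyContinuous ha hb).integral_deriv_mul_eq_sub (k.absolutelyContinuous ha hb)]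
    refine intervalIntegral.integral_congr_ae ?_
    filter_upwards [h.ae_hasDerivAt, k.ae_hasDerivAt] with x hx kx hm
    have hx0 : 0 < x := uIcc_subset_Ioi ha hb (uIoc_subset_uIcc hm)
    rw [(hx hx0).deriv, (kx hx0).deriv]

theorem HasPrim.of_hasDerivAt {U p : ℝ → ℝ} (h : ∀ x, 0 < x → HasDerivAt U (p x) x)
    (hp : ContinuousOn p (Ioi 0)) : HasPrim U p := by
  refine ⟨LocInt.of_continuousOn hp, fun a b ha hb => ?_⟩
  rw [intervalIntegral.integral_eq_sub_of_hasDerivAt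
    (fun x hx => h x (uIcc_subset_Ioi ha hb hx)) (LocInt.of_continuousOn hp a b ha hb)]

theorem HasPrim.congr {U V p q : ℝ → ℝ} (h : HasPrim U p) (e : ∀ x, 0 < x → U x = V x)
    (e' : ∀ᵐ x, 0 < x → p x = q x) : HasPrim V q := by
  refine ⟨h.locInt.congr e', fun a b ha hb => ?_⟩
  rw [← e a ha, ← e b hb, h.sub_eq a b ha hb]
  refine intervalIntegral.integral_congr_ae ?_
  filter_upwards [e'] with x hx hm
  exact hx (uIcc_subset_Ioi ha hb (uIoc_subset_uIcc hm))

theorem HasPrim.add {U p V q : ℝ → ℝ} (h : HasPrim U p) (k : HasPrim V q) :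
    HasPrim (fun x => U x + V x) (fun x => p x + q x) := by
  refine ⟨fun a b ha hb => (h.locInt a b ha hb).add (k.locInt a b ha hb), fun a b ha hb => ?_⟩
  rw [intervalIntegral.integral_add (h.locInt a b ha hb) (k.locInt a b ha hb),
    ← h.sub_eq a b ha hb, ← k.sub_eq a b ha hb]
  ring

theorem HasPrim.const_mul {U p : ℝ → ℝ} (c : ℝ) (h : HasPrim U p) :
    HasPrim (fun x => c * U x) (fun x => c * p x) := by
  refine ⟨fun a b ha hb => (h.locInt a b ha hb).const_mul c, fun a b ha hb => ?_⟩
  rw [intervalIntegral.integral_const_mul, ← h.sub_eq a b ha hb]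
  ring

theorem LocInt.hasPrim {p : ℝ → ℝ} (h : LocInt p) : HasPrim (fun x => ∫ t in (1 : ℝ)..x, p t) p :=
  ⟨h, fun a b ha hb =>
    intervalIntegral.integral_interval_sub_left (h 1 b one_pos hb) (h 1 a one_pos ha)⟩

/-- The regularity step: once the a.e. derivative has a continuous representative, weak solutions
become classical ones. -/
theorem HasPrim.hasDerivAt_of_continuousOn {U p : ℝ → ℝ} (h : HasPrim U p)
    (hp : ContinuousOn p (Ioi 0)) {x : ℝ} (hx : 0 < x) : HasDerivAt U (p x) x := by
  have hc : ContinuousAt p x := hp.continuousAt (Ioi_mem_nhds hx)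
  have h1 : HasDerivAt (fun y => ∫ t in x..y, p t) (p x) x :=
    intervalIntegral.integral_hasDerivAt_right (h.locInt x x hx hx)
      (hp.stronglyMeasurableAtFilter isOpen_Ioi x hx) hc
  refine (h1.const_add (U x)).congr_of_eventuallyEq ?_
  filter_upwards [Ioi_mem_nhds hx] with y hy
  rw [← h.sub_eq x y hx hy]
  ring

/-! ### Weak derivatives and continuous representatives -/

theorem tsupport_subset_Ioo {φ : ℝ → ℝ} (hc : HasCompactSupport φ) (hs : tsupport φ ⊆ Ioi 0) :
    ∃ a b, 0 < a ∧ a < b ∧ tsupport φ ⊆ Ioo a b := by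
  have hK : IsCompact (tsupport φ) := hc
  rcases (tsupport φ).eq_empty_or_nonempty with h | h
  · exact ⟨1, 2, by norm_num, by norm_num, by simp [h]⟩
  · obtain ⟨x, hx, hxm⟩ := hK.exists_isLeast h
    obtain ⟨y, hy, hym⟩ := hK.exists_isGreatest h
    have hx0 : 0 < x := hs hx
    have := hxm hy
    exact ⟨x / 2, y + 1, by linarith, by linarith, fun z hz =>
      ⟨by linarith [hxm hz], by linarith [hym hz]⟩⟩

theorem setIntegral_Ioi_mul_eq {φ : ℝ → ℝ} {a b : ℝ} (ha : 0 < a) (hab : a < b)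
    (hs : Function.support φ ⊆ Ioo a b) (u : ℝ → ℝ) :
    ∫ r in Ioi (0 : ℝ), u r * φ r = ∫ r in a..b, u r * φ r := by
  rw [intervalIntegral.integral_of_le hab.le]
  refine setIntegral_eq_of_subset_of_forall_sdiff_eq_zero measurableSet_Ioi
    (fun x hx => ha.trans hx.1) fun x hx => ?_
  have : φ x = 0 := by
    by_contra h
    exact hx.2 (Ioo_subset_Ioc_self (hs h))
  rw [this, mul_zero]

theorem HasPrim.hasWeakDeriv {U p : ℝ → ℝ} (h : HasPrim U p) : HasWeakDeriv U p := by
  intro φ hφ hc hs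
  obtain ⟨a, b, ha, hab, hsub⟩ := tsupport_subset_Ioo hc hs
  have hb := ha.trans hab
  have hd : HasPrim φ (deriv φ) := HasPrim.of_hasDerivAt
    (fun x _ => (hφ.differentiable (by simp) x).hasDerivAt)
    (hφ.continuous_deriv (by simp)).continuousOn
  rw [setIntegral_Ioi_mul_eq ha hab ((subset_tsupport _).trans (tsupport_deriv_subset.trans hsub)),
    setIntegral_Ioi_mul_eq ha hab ((subset_tsupport _).trans hsub)]
  have h1 := (h.mul hd).sub_eq a b ha hb
  have ha0 : φ a = 0 := image_eq_zero_of_notMem_tsupport fun hm => lt_irrefl _ (hsub hm).1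
  have hb0 : φ b = 0 := image_eq_zero_of_notMem_tsupport fun hm => lt_irrefl _ (hsub hm).2
  rw [intervalIntegral.integral_add
    ((h.locInt a b ha hb).mul_continuousOn hφ.continuous.continuousOn)
    ((hd.locInt a b ha hb).continuousOn_mul (h.continuousOn.mono (uIcc_subset_Ioi ha hb)))] at h1
  simp only [ha0, hb0, mul_zero, sub_zero] at h1
  linarith

theorem LocInt.mul_test {u φ : ℝ → ℝ} (h : LocInt u) (hφ : Continuous φ)
    (hc : HasCompactSupport φ) (hs : tsupport φ ⊆ Ioi 0) :
    IntegrableOn (fun r => u r * φ r) (Ioi 0) := by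
  obtain ⟨a, b, ha, hab, hsub⟩ := tsupport_subset_Ioo hc hs
  have h1 := (h a b ha (ha.trans hab)).mul_continuousOn (hφ.continuousOn (s := uIcc a b))
  rw [intervalIntegrable_iff_integrableOn_Ioc_of_le hab.le] at h1
  refine h1.of_forall_sdiff_eq_zero measurableSet_Ioi fun x hx => ?_
  have : φ x = 0 := image_eq_zero_of_notMem_tsupport fun hm =>
    hx.2 (Ioo_subset_Ioc_self (hsub hm))
  simp [this]

/-- The du Bois-Reymond lemma on the half line. -/
theorem HasWeakDeriv.exists_hasPrim {u p : ℝ → ℝ} (h : HasWeakDeriv u p) (hu : LocInt u)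
    (hp : LocInt p) : ∃ U, HasPrim U p ∧ ∀ᵐ x, 0 < x → u x = U x := by
  set P : ℝ → ℝ := fun x => ∫ t in (1 : ℝ)..x, p t with hP
  have hPp : HasPrim P p := hp.hasPrim
  have hPl : LocInt P := LocInt.of_continuousOn hPp.continuousOn
  -- Subtracting a primitive of p leaves a function with zero weak derivative; it remains to see
  -- that it is constant.
  set k : ℝ → ℝ := fun x => u x - P x with hk
  have hkl : LocInt k := fun a b ha hb => (hu a b ha hb).sub (hPl a b ha hb)
  have hkw : ∀ φ : ℝ → ℝ, ContDiff ℝ ∞ φ → HasCompactSupport φ → tsupport φ ⊆ Ioi 0 →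
      ∫ r in Ioi (0 : ℝ), k r * deriv φ r = 0 := by
    intro φ hφ hc hs
    have e : ∀ r, k r * deriv φ r = u r * deriv φ r - P r * deriv φ r := fun r => by
      simp only [hk]; ring
    simp_rw [e]
    have hdc : Continuous (deriv φ) := hφ.continuous_deriv (by simp)
    rw [integral_sub (hu.mul_test hdc hc.deriv (tsupport_deriv_subset.trans hs))
      (hPl.mul_test hdc hc.deriv (tsupport_deriv_subset.trans hs)), h φ hφ hc hs,
      hPp.hasWeakDeriv φ hφ hc hs, sub_self]
  obtain ⟨ρ₀, hρs, hρc, hρ, hρ01, hρ1⟩ := exists_contDiff_tsupport_subset (n := ⊤) (E := ℝ)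
    (s := Ioi 0) (x := 1) (Ioi_mem_nhds one_pos)
  have hρc' : HasCompactSupport ρ₀ := hρc
  have hρpos : 0 < ∫ x, ρ₀ x := by
    refine hρ.continuous.integral_pos_of_hasCompactSupport_nonneg_nonzero hρc'
      (fun x => (hρ01 (mem_range_self x)).1) (x := 1) (by rw [hρ1]; norm_num)
  set I := ∫ x, ρ₀ x with hI
  -- The constant is found by testing k against a bump of nonzero integral.
  set c : ℝ := (∫ r in Ioi (0 : ℝ), k r * ρ₀ r) / I with hcdef
  have main : ∀ η : ℝ → ℝ, ContDiff ℝ ∞ η → HasCompactSupport η → tsupport η ⊆ Ioi 0 →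
      ∫ r in Ioi (0 : ℝ), k r * η r = c * ∫ x, η x := by
    intro η hη hηc hηs
    set J := ∫ x, η x with hJ
    -- Removing this multiple of the bump makes the integral zero, so the primitive of ψ has compact
    -- support and is an admissible test function.
    set ψ : ℝ → ℝ := fun x => η x - (J / I) * ρ₀ x with hψ
    have hψs : ContDiff ℝ ∞ ψ := hη.sub (contDiff_const.mul hρ)
    have hψcont : Continuous ψ := hψs.continuous
    obtain ⟨a, b, ha, hab, hsub⟩ := tsupport_subset_Ioo hηc hηs
    obtain ⟨a', b', ha', hab', hsub'⟩ := tsupport_subset_Ioo hρc' hρs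
    have hz : ∀ x, x ≤ min a a' ∨ max b b' ≤ x → ψ x = 0 := by
      intro x hx
      have h1 : η x = 0 := image_eq_zero_of_notMem_tsupport fun hm => by
        have := hsub hm
        rcases hx with hx | hx
        · exact absurd (hx.trans (min_le_left _ _)) (not_le.2 this.1)
        · exact absurd ((le_max_left _ _).trans hx) (not_le.2 this.2)
      have h2 : ρ₀ x = 0 := image_eq_zero_of_notMem_tsupport fun hm => by
        have := hsub' hm
        rcases hx with hx | hx
        · exact absurd (hx.trans (min_le_right _ _)) (not_le.2 this.1)
        · exact absurd ((le_max_right _ _).trans hx) (not_le.2 this.2)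
      simp [hψ, h1, h2]
    set A := min a a' with hA
    set B := max b b' with hB
    have hA0 : 0 < A := lt_min ha ha'
    have hAB : A ≤ B := (min_le_left _ _).trans (hab.le.trans (le_max_left _ _))
    have hψint : ∫ x, ψ x = 0 := by
      rw [hψ, integral_sub (hη.continuous.integrable_of_hasCompactSupport hηc)
        ((hρ.continuous.integrable_of_hasCompactSupport hρc').const_mul _), integral_const_mul,
        ← hJ, ← hI]
      field_simp
      ring
    set φ : ℝ → ℝ := fun x => ∫ t in A..x, ψ t with hφ
    have hφd : ∀ x, HasDerivAt φ (ψ x) x := fun x =>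
      intervalIntegral.integral_hasDerivAt_right (hψcont.intervalIntegrable _ _)
        (hψcont.stronglyMeasurableAtFilter _ _) hψcont.continuousAt
    have hφderiv : deriv φ = ψ := funext fun x => (hφd x).deriv
    have hφs : ContDiff ℝ ∞ φ := contDiff_infty_iff_deriv.2
      ⟨fun x => (hφd x).differentiableAt, by rwa [hφderiv]⟩
    have hφA : ∀ x, x ≤ A → φ x = 0 := fun x hx => by
      refine intervalIntegral.integral_zero_ae (ae_of_all _ fun t ht => hz t (Or.inl ?_))
      rw [uIoc_of_ge hx] at ht
      exact ht.2
    have hφB : ∀ x, B ≤ x → φ x = 0 := fun x hx => by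
      have e : φ x = ∫ t, ψ t := by
        rw [hφ]
        simp only
        rw [intervalIntegral.integral_of_le (hAB.trans hx)]
        refine setIntegral_eq_integral_of_forall_compl_eq_zero fun t ht => ?_
        rw [mem_Ioc, not_and_or, not_lt, not_le] at ht
        exact hz t (ht.imp id fun h => hx.trans h.le)
      rw [e, hψint]
    have hts : tsupport φ ⊆ Icc A B := by
      refine closure_minimal (fun x hx => ?_) isClosed_Icc
      by_contra hcon
      rw [mem_Icc, not_and_or, not_le, not_le] at hcon
      exact hx (hcon.elim (fun h => hφA x h.le) fun h => hφB x h.le)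
    have hφc : HasCompactSupport φ := HasCompactSupport.of_support_subset_isCompact isCompact_Icc
      ((subset_tsupport _).trans hts)
    have h0 := hkw φ hφs hφc (hts.trans fun x hx => hA0.trans_le hx.1)
    rw [hφderiv] at h0
    have e : ∀ r, k r * ψ r = k r * η r - J / I * (k r * ρ₀ r) := fun r => by
      simp only [hψ]; ring
    simp_rw [e] at h0
    rw [integral_sub (hkl.mul_test hη.continuous hηc hηs)
      ((hkl.mul_test hρ.continuous hρc' hρs).const_mul _), integral_const_mul] at h0
    rw [hcdef]
    have hI0 : I ≠ 0 := hρpos.ne'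
    field_simp at h0 ⊢
    linarith
  refine ⟨fun x => P x + c, ?_, ?_⟩
  · exact ⟨hp, fun a b ha hb => by rw [← hPp.sub_eq a b ha hb]; ring⟩
  · have := isOpen_Ioi.ae_eq_zero_of_integral_contDiff_smul_eq_zero (U := Ioi (0 : ℝ))
      (f := fun x => k x - c) (μ := volume) ?_ ?_
    · filter_upwards [this] with x hx h0
      have := hx h0
      simp only [hk] at this
      linarith
    · exact LocInt.locallyIntegrableOn fun a b ha hb =>
        (hkl a b ha hb).sub intervalIntegrable_const
    · intro g hg hgc hgs
      have e1 : ∫ x, g x • (k x - c) = ∫ x in Ioi (0 : ℝ), (k x * g x - c * g x) := by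
        rw [setIntegral_eq_integral_of_forall_compl_eq_zero]
        · refine integral_congr_ae (ae_of_all _ fun x => ?_)
          simp only [smul_eq_mul]; ring
        · intro x hx
          have : g x = 0 := image_eq_zero_of_notMem_tsupport fun hm => hx (hgs hm)
          simp [this]
      have hgi := hg.continuous.integrable_of_hasCompactSupport hgc (μ := volume)
      rw [e1, integral_sub (hkl.mul_test hg.continuous hgc hgs)
        (hgi.integrableOn.const_mul c), integral_const_mul, main g hg hgc hgs]
      rw [setIntegral_eq_integral_of_forall_compl_eq_zero (f := g)]
      · ring
      · intro x hx
        exact image_eq_zero_of_notMem_tsupport fun hm => hx (hgs hm)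

theorem HasPrim.eq_of_ae_eq {U p V q : ℝ → ℝ} (h : HasPrim U p) (k : HasPrim V q)
    (e : ∀ᵐ x, 0 < x → U x = V x) : ∀ x, 0 < x → U x = V x := by
  have h1 : U =ᵐ[volume.restrict (Ioi (0 : ℝ))] V := by
    filter_upwards [ae_restrict_of_ae e, ae_restrict_mem measurableSet_Ioi] with x hx h0 using hx h0
  exact fun x hx => Measure.eqOn_open_of_ae_eq h1 isOpen_Ioi h.continuousOn k.continuousOn hx

/-! ### Boundary terms at 0 and at infinity -/

theorem not_integrableOn_Ioc_zero_inv {c : ℝ} (hc : 0 < c) :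
    ¬ IntegrableOn (fun x : ℝ => x⁻¹) (Ioc 0 c) := by
  rw [← intervalIntegrable_iff_integrableOn_Ioc_of_le hc.le]
  simp [hc.ne, hc.le]

theorem not_integrableOn_of_inv_le {h : ℝ → ℝ} {s : Set ℝ} (hs : MeasurableSet s) {c : ℝ}
    (hc : 0 < c) (hle : ∀ x ∈ s, c * |x⁻¹| ≤ |h x|)
    (hn : ¬ IntegrableOn (fun x : ℝ => x⁻¹) s) : ¬ IntegrableOn h s := by
  intro hi
  refine hn ((hi.norm.const_mul c⁻¹).mono' (by fun_prop) ?_)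
  filter_upwards [ae_restrict_mem hs] with x hx
  have := hle x hx
  rw [Real.norm_eq_abs, Real.norm_eq_abs, inv_mul_eq_div, le_div_iff₀ hc]
  linarith

/-- Integrability of p gives a limit. A nonzero limit would make |G/x| comparable with 1/x, which is
not integrable at infinity. -/
theorem HasPrim.tendsto_atTop {G p : ℝ → ℝ} (h : HasPrim G p) {c : ℝ} (hc : 0 < c)
    (hp : IntegrableOn p (Ioi c)) (hG : IntegrableOn (fun x => G x / x) (Ioi c)) :
    Tendsto G atTop (𝓝 0) := by
  have h1 : Tendsto (fun x => G c + ∫ t in c..x, p t) atTop (𝓝 (G c + ∫ t in Ioi c, p t)) :=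
    tendsto_const_nhds.add (intervalIntegral_tendsto_integral_Ioi c hp tendsto_id)
  have h2 : Tendsto G atTop (𝓝 (G c + ∫ t in Ioi c, p t)) := by
    refine h1.congr' ?_
    filter_upwards [eventually_gt_atTop 0] with x hx
    rw [← h.sub_eq c x hc hx]; ring
  set l := G c + ∫ t in Ioi c, p t
  by_cases hl : l = 0
  · rwa [hl] at h2
  exfalso
  have h3 : ∀ᶠ x in atTop, |l| / 2 < |G x| :=
    h2.abs.eventually_const_lt (by linarith [abs_pos.2 hl])
  obtain ⟨N, hN⟩ := (h3.and (eventually_gt_atTop c)).exists_forall_of_atTop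
  have hNc := (hN N le_rfl).2
  refine not_integrableOn_of_inv_le (c := |l| / 2) measurableSet_Ioi (by positivity) ?_
    (not_integrableOn_Ioi_inv (a := N)) (hG.mono_set (Ioi_subset_Ioi hNc.le))
  intro x hx
  rw [div_eq_mul_inv (G _), abs_mul]
  exact mul_le_mul_of_nonneg_right (hN x (le_of_lt hx)).1.le (abs_nonneg _)

theorem HasPrim.integral_Ioi {G p : ℝ → ℝ} (h : HasPrim G p) {c : ℝ} (hc : 0 < c)
    (hp : IntegrableOn p (Ioi c)) (hG : IntegrableOn (fun x => G x / x) (Ioi c)) :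
    ∫ t in Ioi c, p t = -G c := by
  have h1 : Tendsto (fun x => ∫ t in c..x, p t) atTop (𝓝 (∫ t in Ioi c, p t)) :=
    intervalIntegral_tendsto_integral_Ioi c hp tendsto_id
  have h2 : Tendsto (fun x => G x - G c) atTop (𝓝 (0 - G c)) :=
    (h.tendsto_atTop hc hp hG).sub_const _
  rw [zero_sub] at h2
  refine tendsto_nhds_unique h1 (h2.congr' ?_)
  filter_upwards [eventually_gt_atTop 0] with x hx
  rw [← h.sub_eq c x hc hx]

theorem HasPrim.tendsto_nhdsGT_zero {G p : ℝ → ℝ} (h : HasPrim G p) {c : ℝ} (hc : 0 < c)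
    (hp : IntegrableOn p (Ioc 0 c)) (hG : IntegrableOn (fun x => G x / x) (Ioc 0 c)) :
    Tendsto G (𝓝[>] 0) (𝓝 0) ∧ ∫ t in Ioc 0 c, p t = G c := by
  have hpi : IntervalIntegrable p volume 0 c :=
    (intervalIntegrable_iff_integrableOn_Ioc_of_le hc.le).2 hp
  have h1 : Tendsto (fun x => ∫ t in x..c, p t) (𝓝[>] 0) (𝓝 (∫ t in (0 : ℝ)..c, p t)) := by
    have h0 := intervalIntegral.continuousOn_primitive_interval' hpi.symm (a := c) (by simp)
    have h0' : ContinuousWithinAt (fun x => ∫ t in c..x, p t) (uIcc c 0) 0 := h0 0 (by simp)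
    rw [uIcc_of_ge hc.le] at h0'
    have h0'' := (h0'.mono_of_mem_nhdsWithin (Icc_mem_nhdsGT_of_mem ⟨le_rfl, hc⟩)).neg.tendsto
    simp only [intervalIntegral.integral_symm c]
    exact h0''
  have h2 : Tendsto G (𝓝[>] 0) (𝓝 (G c - ∫ t in (0 : ℝ)..c, p t)) := by
    refine (h1.const_sub (G c)).congr' ?_
    filter_upwards [self_mem_nhdsWithin] with x hx
    rw [← h.sub_eq x c hx hc]; ring
  rw [intervalIntegral.integral_of_le hc.le] at h2
  set l := G c - ∫ t in Ioc 0 c, p t with hldef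
  have hl : l = 0 := by
    by_contra hl
    have h3 : ∀ᶠ x in 𝓝[>] (0 : ℝ), |l| / 2 < |G x| :=
      h2.abs.eventually_const_lt (by linarith [abs_pos.2 hl])
    obtain ⟨δ, hδ, hδs⟩ := mem_nhdsGT_iff_exists_Ioc_subset.1
      (h3.and (Ioc_mem_nhdsGT hc))
    have hδ0 : (0 : ℝ) < δ := hδ
    refine not_integrableOn_of_inv_le (c := |l| / 2) measurableSet_Ioc (by positivity) ?_
      (not_integrableOn_Ioc_zero_inv hδ0)
      (hG.mono_set (Ioc_subset_Ioc_right (hδs ⟨hδ0, le_rfl⟩).2.2))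
    intro x hx
    rw [div_eq_mul_inv (G _), abs_mul]
    exact mul_le_mul_of_nonneg_right (hδs hx).1.le (abs_nonneg _)
  rw [hl] at h2
  exact ⟨h2, by linarith [hldef]⟩

/-- Integrability of G/x removes the boundary terms at both ends at once, since 1/x diverges both at
0 and at infinity. No cut-off functions are needed. -/
theorem HasPrim.integral_eq_zero {G p : ℝ → ℝ} (h : HasPrim G p)
    (hp : IntegrableOn p (Ioi 0)) (hG : IntegrableOn (fun x => G x / x) (Ioi 0)) :
    ∫ t in Ioi 0, p t = 0 := by
  have hI : Ioi (1 : ℝ) ⊆ Ioi 0 := Ioi_subset_Ioi zero_le_one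
  have hJ : Ioc (0 : ℝ) 1 ⊆ Ioi 0 := Ioc_subset_Ioi_self
  have h1 := h.integral_Ioi one_pos (hp.mono_set hI) (hG.mono_set hI)
  have h2 := (h.tendsto_nhdsGT_zero one_pos (hp.mono_set hJ) (hG.mono_set hJ)).2
  rw [← Ioc_union_Ioi_eq_Ioi (zero_le_one (α := ℝ)), setIntegral_union Ioc_disjoint_Ioi_same
    measurableSet_Ioi (hp.mono_set hJ) (hp.mono_set hI), h1, h2, add_neg_cancel]

/-- If G(x) < 0, then G stays below G(x) on (0, x]; if G(x) > 0, then G stays above it on (x, ∞).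
Either way G/x dominates a multiple of 1/x at one end. -/
theorem eq_zero_of_monotoneOn_of_integrableOn {G : ℝ → ℝ} (h : MonotoneOn G (Ioi 0))
    (hG : IntegrableOn (fun x => G x / x) (Ioi 0)) {x : ℝ} (hx : 0 < x) : G x = 0 := by
  rcases lt_trichotomy (G x) 0 with h0 | h0 | h0
  · exfalso
    refine not_integrableOn_of_inv_le (c := |G x|) measurableSet_Ioc (abs_pos.2 h0.ne) ?_
      (not_integrableOn_Ioc_zero_inv hx) (hG.mono_set Ioc_subset_Ioi_self)
    intro y hy
    rw [div_eq_mul_inv (G _), abs_mul]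
    refine mul_le_mul_of_nonneg_right ?_ (abs_nonneg _)
    have := h hy.1 hx hy.2
    rw [abs_of_neg h0, abs_of_neg (this.trans_lt h0)]
    linarith
  · exact h0
  · exfalso
    refine not_integrableOn_of_inv_le (c := |G x|) measurableSet_Ioi (abs_pos.2 h0.ne') ?_
      (not_integrableOn_Ioi_inv (a := x)) (hG.mono_set (Ioi_subset_Ioi hx.le))
    intro y hy
    rw [div_eq_mul_inv (G _), abs_mul]
    refine mul_le_mul_of_nonneg_right ?_ (abs_nonneg _)
    have := h hx (hx.trans hy) (le_of_lt hy)
    rw [abs_of_pos h0, abs_of_pos (h0.trans_le this)]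
    exact this

/-! ### The measure `r dr` -/

theorem integrable_radial_iff {h : ℝ → ℝ} :
    Integrable h radialMeasure ↔ IntegrableOn (fun r => h r * r) (Ioi 0) := by
  rw [radialMeasure, integrable_withDensity_iff_integrable_smul₀'
    (μ := volume.restrict (Ioi (0 : ℝ))) (f := fun r : ℝ => ENNReal.ofReal r)
    (by fun_prop) (by simp)]
  refine integrable_congr ?_
  filter_upwards [ae_restrict_mem measurableSet_Ioi] with r hr
  have hr' : (0 : ℝ) < r := hr
  simp only [ENNReal.toReal_ofReal hr'.le, smul_eq_mul, mul_comm]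

theorem integral_radial (h : ℝ → ℝ) :
    ∫ r, h r ∂radialMeasure = ∫ r in Ioi 0, h r * r := by
  rw [radialMeasure, integral_withDensity_eq_integral_toReal_smul₀ (by fun_prop) (by simp)]
  refine integral_congr_ae ?_
  filter_upwards [ae_restrict_mem measurableSet_Ioi] with r hr
  have hr' : (0 : ℝ) < r := hr
  simp only [ENNReal.toReal_ofReal hr'.le, smul_eq_mul, mul_comm]

theorem ae_radial_iff {P : ℝ → Prop} :
    (∀ᵐ r ∂radialMeasure, P r) ↔ ∀ᵐ r, 0 < r → P r := by
  rw [radialMeasure, ae_withDensity_iff (by fun_prop), ae_restrict_iff' measurableSet_Ioi]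
  refine eventually_congr (Eventually.of_forall fun r => ?_)
  simp only [mem_Ioi, ne_eq, ENNReal.ofReal_eq_zero, not_le]
  tauto

theorem ae_radial_pos : ∀ᵐ r ∂radialMeasure, 0 < r :=
  ae_radial_iff.2 (Eventually.of_forall fun _ h => h)

theorem aestronglyMeasurable_radial {h : ℝ → ℝ} (hc : ContinuousOn h (Ioi 0)) :
    AEStronglyMeasurable h radialMeasure :=
  (hc.aestronglyMeasurable measurableSet_Ioi).mono_ac (withDensity_absolutelyContinuous _ _)

theorem integrable_sq (u : RadialL2) : Integrable (fun r => u r ^ 2) radialMeasure :=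
  (Lp.memLp u).integrable_sq

theorem integrable_mul (u v : RadialL2) : Integrable (fun r => u r * v r) radialMeasure :=
  (Lp.memLp u).integrable_mul (Lp.memLp v)

theorem inner_eq_integral (u v : RadialL2) : inner ℝ u v = ∫ r, u r * v r ∂radialMeasure := by
  rw [L2.inner_def]
  refine integral_congr_ae (Eventually.of_forall fun r => ?_)
  simp [mul_comm]

theorem norm_sq_eq_integral (u : RadialL2) : ‖u‖ ^ 2 = ∫ r, u r ^ 2 ∂radialMeasure := by
  rw [← real_inner_self_eq_norm_sq, inner_eq_integral]
  simp only [sq]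

/-- On a compact subinterval the weight r is bounded below, and |u| ≤ u² + 1. -/
theorem locInt_radialL2 (u : RadialL2) : LocInt u := by
  intro a b ha hb
  have h1 : IntegrableOn (fun r => (u r ^ 2 + 1) * r) (uIcc a b) := by
    have h2 : IntegrableOn (fun r => u r ^ 2 * r) (uIcc a b) :=
      (integrable_radial_iff.1 (integrable_sq u)).mono_set (uIcc_subset_Ioi ha hb)
    have h3 : IntegrableOn (fun r : ℝ => r) (uIcc a b) :=
      continuousOn_id.integrableOn_compact isCompact_uIcc
    exact (h2.add h3).congr (Eventually.of_forall fun r => by simp; ring)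
  have hm : 0 < min a b := lt_min ha hb
  have hmeas : AEStronglyMeasurable u (volume.restrict (Ioi 0)) := by
    refine (Lp.aestronglyMeasurable u).mono_ac (Measure.AbsolutelyContinuous.mk fun s hs h0 => ?_)
    have := ae_of_ae_radial (P := fun r => r ∉ s) (measure_eq_zero_iff_ae_notMem.1 h0)
    exact measure_eq_zero_iff_ae_notMem.2 this
  refine IntegrableOn.intervalIntegrable ((h1.const_mul (min a b)⁻¹).mono'
    (hmeas.mono_measure (Measure.restrict_mono (uIcc_subset_Ioi ha hb) le_rfl)) ?_)
  filter_upwards [ae_restrict_mem measurableSet_uIcc] with r hr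
  have hr' : min a b ≤ r := hr.1
  rw [Real.norm_eq_abs, inv_mul_eq_div, le_div_iff₀ hm]
  have h4 : |u r| ≤ u r ^ 2 + 1 := by
    rw [← sq_abs]; nlinarith [sq_nonneg (|u r| - 1), abs_nonneg (u r)]
  exact mul_le_mul h4 hr' hm.le (by positivity)

noncomputable section

theorem integrableOn_Ioi_of_bounded {h : ℝ → ℝ} (hl : LocInt h) (h0 : ∀ x, 0 < x → 0 ≤ h x) (I : ℝ)
    (hI : ∀ a b, 0 < a → a ≤ b → ∫ x in a..b, h x ≤ I) :
    IntegrableOn h (Ioi 0) ∧ ∫ x in Ioi 0, h x ≤ I := by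
  have hφ : AECover (volume.restrict (Ioi (0 : ℝ))) atTop
      (fun n : ℕ => Ioc (1 / (n + 1 : ℝ)) (n + 1)) := by
    refine ⟨?_, fun _ => measurableSet_Ioc⟩
    filter_upwards [ae_restrict_mem measurableSet_Ioi] with x hx
    have h1 : ∀ᶠ n : ℕ in atTop, 1 / (n + 1 : ℝ) < x :=
      tendsto_one_div_add_atTop_nhds_zero_nat.eventually_lt_const hx
    filter_upwards [h1, eventually_ge_atTop ⌈x⌉₊] with n hn hn2
    exact ⟨hn, (Nat.ceil_le.1 hn2).trans (by linarith)⟩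
  have hle : ∀ n : ℕ, 1 / (n + 1 : ℝ) ≤ n + 1 := fun n => by
    rw [div_le_iff₀ (by positivity)]; nlinarith [n.cast_nonneg (α := ℝ)]
  have hsub : ∀ n : ℕ, Ioc (1 / (n + 1 : ℝ)) (n + 1) ⊆ Ioi 0 := fun n x hx =>
    lt_trans (by positivity) hx.1
  have hint : ∀ n : ℕ, IntegrableOn h (Ioc (1 / (n + 1 : ℝ)) (n + 1)) := fun n =>
    (intervalIntegrable_iff_integrableOn_Ioc_of_le (hle n)).1
      (hl _ _ (by positivity) (by positivity))
  have hb : ∀ n : ℕ, ∫ x in Ioc (1 / (n + 1 : ℝ)) (n + 1), h x ∂(volume.restrict (Ioi 0)) ≤ I :=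
    fun n => by
      rw [Measure.restrict_restrict measurableSet_Ioc, inter_eq_self_of_subset_left (hsub n),
        ← intervalIntegral.integral_of_le (hle n)]
      exact hI _ _ (by positivity) (hle n)
  have h1 : Integrable h (volume.restrict (Ioi 0)) :=
    hφ.integrable_of_integral_bounded_of_nonneg_ae I
      (fun n => (hint n).mono_measure Measure.restrict_le_self)
      (by filter_upwards [ae_restrict_mem measurableSet_Ioi] with x hx using h0 x hx)
      (Eventually.of_forall hb)
  exact ⟨h1, le_of_tendsto (hφ.integral_tendsto_of_countably_generated h1)
    (Eventually.of_forall hb)⟩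

theorem IntegrableOn.of_mul_self {h : ℝ → ℝ} (hi : IntegrableOn (fun r => h r * r) (Ioi 0))
    {c : ℝ} (hc : 0 < c) : IntegrableOn h (Ioi c) := by
  have h1 := hi.mono_set (Ioi_subset_Ioi hc.le)
  have h2 : IntegrableOn (fun r => r⁻¹ * (h r * r)) (Ioi c) := by
    refine h1.bdd_mul (c := c⁻¹) (by fun_prop) ?_
    filter_upwards [ae_restrict_mem measurableSet_Ioi] with r hr
    have hr' : c < r := hr
    rw [norm_inv, Real.norm_of_nonneg (hc.trans hr').le]
    exact inv_anti₀ hc hr'.le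
  refine h2.congr_fun (fun r hr => ?_) measurableSet_Ioi
  have hr' : c < r := hr
  have : r ≠ 0 := (hc.trans hr').ne'
  field_simp

/-! ### Coordinates of `H` and `X` -/

/-- The function component of `H`. -/
def Hval : SpaceH →L[ℝ] RadialL2 :=
  (PiLp.proj 2 (fun _ : Fin 2 => RadialL2) 0 : _ →L[ℝ] RadialL2) ∘L SpaceH.subtypeL

/-- The derivative component of `H`. -/
def Hdiff : SpaceH →L[ℝ] RadialL2 :=
  (PiLp.proj 2 (fun _ : Fin 2 => RadialL2) 1 : _ →L[ℝ] RadialL2) ∘L SpaceH.subtypeL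

/-- The function component of `X`. -/
def Xval : SpaceX →L[ℝ] RadialL2 :=
  (PiLp.proj 2 (fun _ : Fin 3 => RadialL2) 0 : _ →L[ℝ] RadialL2) ∘L SpaceX.subtypeL

/-- The derivative component of `X`. -/
def Xdiff : SpaceX →L[ℝ] RadialL2 :=
  (PiLp.proj 2 (fun _ : Fin 3 => RadialL2) 1 : _ →L[ℝ] RadialL2) ∘L SpaceX.subtypeL

/-- The component `u / r` of `X`. -/
def Xquot : SpaceX →L[ℝ] RadialL2 :=
  (PiLp.proj 2 (fun _ : Fin 3 => RadialL2) 2 : _ →L[ℝ] RadialL2) ∘L SpaceX.subtypeL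

theorem Hval_eq (w : SpaceH) : (Hval w : ℝ → ℝ) = Hfn w := rfl
theorem Hdiff_eq (w : SpaceH) : (Hdiff w : ℝ → ℝ) = Hder w := rfl
theorem Xval_eq (u : SpaceX) : (Xval u : ℝ → ℝ) = Xfn u := rfl
theorem Xdiff_eq (u : SpaceX) : (Xdiff u : ℝ → ℝ) = Xder u := rfl

theorem norm_sq_H (w : SpaceH) : ‖w‖ ^ 2 = ‖Hval w‖ ^ 2 + ‖Hdiff w‖ ^ 2 := by
  rw [Submodule.coe_norm, PiLp.norm_sq_eq_of_L2, Fin.sum_univ_two]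
  rfl

theorem norm_sq_X (u : SpaceX) : ‖u‖ ^ 2 = ‖Xval u‖ ^ 2 + ‖Xdiff u‖ ^ 2 + ‖Xquot u‖ ^ 2 := by
  rw [Submodule.coe_norm, PiLp.norm_sq_eq_of_L2, Fin.sum_univ_three]
  rfl

theorem hasWeakDeriv_H (w : SpaceH) : HasWeakDeriv (Hval w) (Hdiff w) := w.2

theorem hasWeakDeriv_X (u : SpaceX) : HasWeakDeriv (Xval u) (Xdiff u) := u.2.1

theorem Xquot_ae (u : SpaceX) : ∀ᵐ r ∂radialMeasure, Xquot u r = Xval u r / r := u.2.2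

/-- An element of `H` from its function and its weak derivative. -/
def mkH (a b : RadialL2) (h : HasWeakDeriv a b) : SpaceH := ⟨WithLp.toLp 2 ![a, b], h⟩

theorem Hval_mkH (a b : RadialL2) (h : HasWeakDeriv a b) : Hval (mkH a b h) = a := rfl
theorem Hdiff_mkH (a b : RadialL2) (h : HasWeakDeriv a b) : Hdiff (mkH a b h) = b := rfl

theorem H_ext {w z : SpaceH} (h : Hval w = Hval z) (h' : Hdiff w = Hdiff z) : w = z := by
  refine Subtype.ext (PiLp.ext fun i => ?_)
  fin_cases i
  · exact h
  · exact h'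

theorem X_ext {w z : SpaceX} (h : Xval w = Xval z) (h' : Xdiff w = Xdiff z)
    (h'' : Xquot w = Xquot z) : w = z := by
  refine Subtype.ext (PiLp.ext fun i => ?_)
  fin_cases i
  · exact h
  · exact h'
  · exact h''

/-- The inclusion of `X` into `H`. -/
def XtoH : SpaceX →L[ℝ] SpaceH :=
  LinearMap.mkContinuous
    { toFun := fun u => mkH (Xval u) (Xdiff u) (hasWeakDeriv_X u)
      map_add' := fun u v => H_ext (by simp [Hval_mkH]) (by simp [Hdiff_mkH])
      map_smul' := fun c u => H_ext (by simp [Hval_mkH]) (by simp [Hdiff_mkH]) } 1 (by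
    intro u
    rw [one_mul]
    refine abs_le_of_sq_le_sq' ?_ (norm_nonneg _) |>.2
    rw [norm_sq_H, norm_sq_X]
    simp only [LinearMap.coe_mk, AddHom.coe_mk, Hval_mkH, Hdiff_mkH]
    nlinarith [sq_nonneg ‖Xquot u‖])

theorem Hval_XtoH (u : SpaceX) : Hval (XtoH u) = Xval u := rfl
theorem Hdiff_XtoH (u : SpaceX) : Hdiff (XtoH u) = Xdiff u := rfl

/-! ### Continuous representatives -/

theorem exists_rep (w : SpaceH) : ∃ W, HasPrim W (Hdiff w) ∧ ∀ᵐ x, 0 < x → Hval w x = W x :=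
  (hasWeakDeriv_H w).exists_hasPrim (locInt_radialL2 _) (locInt_radialL2 _)

/-- The locally absolutely continuous representative of an element of `H`. -/
def Hrep (w : SpaceH) : ℝ → ℝ := (exists_rep w).choose

theorem Hrep_hasPrim (w : SpaceH) : HasPrim (Hrep w) (Hdiff w) := (exists_rep w).choose_spec.1

theorem Hrep_ae (w : SpaceH) : ∀ᵐ x, 0 < x → Hval w x = Hrep w x := (exists_rep w).choose_spec.2

theorem integrableOn_mul_mul (a b : RadialL2) : IntegrableOn (fun r => a r * b r * r) (Ioi 0) :=
  integrable_radial_iff.1 (integrable_mul a b)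

theorem integrableOn_sq_mul (a : RadialL2) : IntegrableOn (fun r => a r ^ 2 * r) (Ioi 0) :=
  integrable_radial_iff.1 (integrable_sq a)

theorem Hrep_sq_hasPrim (w : SpaceH) :
    HasPrim (fun r => Hrep w r ^ 2) (fun r => 2 * (Hval w r * Hdiff w r)) := by
  refine ((Hrep_hasPrim w).mul (Hrep_hasPrim w)).congr (fun x _ => (sq _).symm) ?_
  filter_upwards [Hrep_ae w] with x hx h0
  rw [hx h0]; ring

/-- The boundary term of W² at infinity vanishes because W²/r ≤ W²/c is integrable on (c, ∞). -/
theorem Hrep_sq_eq (w : SpaceH) {c : ℝ} (hc : 0 < c) :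
    IntegrableOn (fun r => 2 * (Hval w r * Hdiff w r)) (Ioi c) ∧
    Hrep w c ^ 2 = -∫ r in Ioi c, 2 * (Hval w r * Hdiff w r) := by
  have h1 : IntegrableOn (fun r => 2 * (Hval w r * Hdiff w r)) (Ioi c) :=
    (IntegrableOn.of_mul_self (integrableOn_mul_mul _ _) hc).const_mul 2
  refine ⟨h1, ?_⟩
  have h2 : IntegrableOn (fun r => Hval w r ^ 2) (Ioi c) :=
    IntegrableOn.of_mul_self (integrableOn_sq_mul _) hc
  have h3 : IntegrableOn (fun r => Hrep w r ^ 2 / r) (Ioi c) := by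
    have h4 : IntegrableOn (fun r => r⁻¹ * Hval w r ^ 2) (Ioi c) := by
      refine h2.bdd_mul (c := c⁻¹) (by fun_prop) ?_
      filter_upwards [ae_restrict_mem measurableSet_Ioi] with r hr
      have hr' : c < r := hr
      rw [norm_inv, Real.norm_of_nonneg (hc.trans hr').le]
      exact inv_anti₀ hc hr'.le
    refine h4.congr_fun_ae ?_
    filter_upwards [ae_restrict_of_ae (Hrep_ae w), ae_restrict_mem measurableSet_Ioi] with r hr hm
    rw [hr (hc.trans hm)]; ring
  rw [(Hrep_sq_hasPrim w).integral_Ioi hc h1 h3, neg_neg]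

theorem norm_sq_H_integral (w : SpaceH) :
    ‖w‖ ^ 2 = ∫ r in Ioi 0, (Hval w r ^ 2 + Hdiff w r ^ 2) * r := by
  rw [norm_sq_H, norm_sq_eq_integral, norm_sq_eq_integral,
    ← integral_add (integrable_sq _) (integrable_sq _), integral_radial]

theorem integrableOn_normDensity_H (w : SpaceH) :
    IntegrableOn (fun r => (Hval w r ^ 2 + Hdiff w r ^ 2) * r) (Ioi 0) :=
  integrable_radial_iff.1 ((integrable_sq _).add (integrable_sq _))

/-- Integrate -2ww' from c to infinity and use c ≤ r there. This is the radial decay estimate; it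
degenerates at 0, where elements of H may be unbounded. -/
theorem mul_Hrep_sq_le (w : SpaceH) {c : ℝ} (hc : 0 < c) : c * Hrep w c ^ 2 ≤ ‖w‖ ^ 2 := by
  obtain ⟨h1, h2⟩ := Hrep_sq_eq w hc
  have h3 := integrableOn_normDensity_H w
  rw [h2, norm_sq_H_integral, ← integral_neg, ← integral_const_mul]
  calc ∫ r in Ioi c, c * -(2 * (Hval w r * Hdiff w r))
      ≤ ∫ r in Ioi c, (Hval w r ^ 2 + Hdiff w r ^ 2) * r := by
        refine setIntegral_mono_on (h1.neg.const_mul c) (h3.mono_set (Ioi_subset_Ioi hc.le))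
          measurableSet_Ioi fun r hr => ?_
        have hr' : c < r := hr
        have h4 : -(2 * (Hval w r * Hdiff w r)) ≤ Hval w r ^ 2 + Hdiff w r ^ 2 := by
          nlinarith [sq_nonneg (Hval w r + Hdiff w r)]
        have h5 : 0 ≤ Hval w r ^ 2 + Hdiff w r ^ 2 := by positivity
        nlinarith
    _ ≤ _ := by
        refine setIntegral_mono_set h3 ?_ (Ioi_subset_Ioi hc.le).eventuallyLE
        filter_upwards [ae_restrict_mem measurableSet_Ioi] with r hr
        have hr' : 0 < r := hr
        simp only [Pi.zero_apply]
        positivity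

/-- With u = r(u/r), the integrand satisfies -2uu' = -2(u/r)u' r ≤ (u'² + u²/r²) r, so the control
of u/r gives a bound that is uniform down to the origin. -/
theorem Xrep_sq_le (u : SpaceX) {c : ℝ} (hc : 0 < c) : Hrep (XtoH u) c ^ 2 ≤ ‖u‖ ^ 2 := by
  obtain ⟨h1, h2⟩ := Hrep_sq_eq (XtoH u) hc
  rw [Hval_XtoH, Hdiff_XtoH] at h1 h2
  have h3 : IntegrableOn (fun r => (Xdiff u r ^ 2 + Xquot u r ^ 2) * r) (Ioi 0) :=
    integrable_radial_iff.1 ((integrable_sq _).add (integrable_sq _))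
  have h6 : ∫ r in Ioi 0, (Xdiff u r ^ 2 + Xquot u r ^ 2) * r ≤ ‖u‖ ^ 2 := by
    rw [← integral_radial (fun r => Xdiff u r ^ 2 + Xquot u r ^ 2),
      integral_add (integrable_sq _) (integrable_sq _), ← norm_sq_eq_integral,
      ← norm_sq_eq_integral, norm_sq_X]
    nlinarith [sq_nonneg ‖Xval u‖]
  refine le_trans ?_ h6
  rw [h2, ← integral_neg]
  calc ∫ r in Ioi c, -(2 * (Xval u r * Xdiff u r))
      ≤ ∫ r in Ioi c, (Xdiff u r ^ 2 + Xquot u r ^ 2) * r := by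
        refine setIntegral_mono_on_ae h1.neg (h3.mono_set (Ioi_subset_Ioi hc.le))
          measurableSet_Ioi ?_
        filter_upwards [ae_radial_iff.1 (Xquot_ae u)] with r hq hr
        have hr' : 0 < r := hc.trans hr
        have hq' : Xval u r = Xquot u r * r := by rw [hq hr']; field_simp
        rw [hq']
        nlinarith [mul_nonneg hr'.le (sq_nonneg (Xdiff u r + Xquot u r))]
    _ ≤ _ := by
        refine setIntegral_mono_set h3 ?_ (Ioi_subset_Ioi hc.le).eventuallyLE
        filter_upwards [ae_restrict_mem measurableSet_Ioi] with r hr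
        have hr' : 0 < r := hr
        simp only [Pi.zero_apply]
        positivity

theorem abs_Xval_le (u : SpaceX) : ∀ᵐ r ∂radialMeasure, |Xval u r| ≤ ‖u‖ := by
  rw [ae_radial_iff]
  filter_upwards [Hrep_ae (XtoH u)] with r hr h0
  rw [← Hval_XtoH, hr h0]
  exact abs_le_of_sq_le_sq (Xrep_sq_le u h0) (norm_nonneg _)

theorem integral_abs_mul_le (w : SpaceH) :
    ∫ r in Ioi 0, |Hval w r * Hdiff w r * r| ≤ ‖w‖ ^ 2 / 2 := by
  rw [norm_sq_H_integral, ← integral_div]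
  refine setIntegral_mono_on (integrableOn_mul_mul _ _).abs ?_ measurableSet_Ioi fun r hr => ?_
  · exact (integrableOn_normDensity_H w).div_const 2
  · have hr' : 0 < r := hr
    rw [abs_mul, abs_of_pos hr', abs_mul, ← sq_abs (Hval w r), ← sq_abs (Hdiff w r)]
    nlinarith [mul_nonneg hr'.le (sq_nonneg (|Hval w r| - |Hdiff w r|))]

/-- A Ladyzhenskaya-type estimate. Differentiating (rW²)² gives 2rW⁴ + 4(rW²) w w' r. The boundary
values and the factor rW² are bounded by powers of ‖w‖² through `mul_Hrep_sq_le`, and ∫ 2|ww'| r dr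
≤ ‖w‖². -/
theorem Hrep_pow_four (w : SpaceH) :
    IntegrableOn (fun r => Hrep w r ^ 4 * r) (Ioi 0) ∧
    ∫ r in Ioi 0, Hrep w r ^ 4 * r ≤ 2 * ‖w‖ ^ 4 := by
  set W := Hrep w with hW
  have hid : HasPrim (fun r : ℝ => r) (fun _ => 1) :=
    HasPrim.of_hasDerivAt (fun x _ => hasDerivAt_id x) continuousOn_const
  have hG := (hid.mul (Hrep_sq_hasPrim w)).mul (hid.mul (Hrep_sq_hasPrim w))
  have hc : ContinuousOn (fun r => W r ^ 4 * r) (Ioi 0) :=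
    ((Hrep_hasPrim w).continuousOn.pow 4).mul continuousOn_id
  refine integrableOn_Ioi_of_bounded (LocInt.of_continuousOn hc)
    (fun x hx => by positivity) _ fun a b ha hab => ?_
  have hb := ha.trans_le hab
  have h1 := hG.sub_eq a b ha hb
  have hbb := mul_Hrep_sq_le w hb
  have h0b : 0 ≤ b * Hrep w b ^ 2 := by positivity
  have h0a : 0 ≤ a * Hrep w a ^ 2 := by positivity
  have hlow : (∫ r in a..b, W r ^ 4 * r) - ‖w‖ ^ 2 * ∫ r in a..b, 2 * |Hval w r * Hdiff w r * r|
      ≤ (b * Hrep w b ^ 2 * (b * Hrep w b ^ 2) - a * Hrep w a ^ 2 * (a * Hrep w a ^ 2)) / 2 := by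
    rw [h1, ← intervalIntegral.integral_const_mul, ← intervalIntegral.integral_sub
      (LocInt.of_continuousOn hc a b ha hb), ← intervalIntegral.integral_div]
    · refine intervalIntegral.integral_mono_on hab ?_ ?_ ?_
      · exact (LocInt.of_continuousOn hc a b ha hb).sub
          ((LocInt.of_integrableOn ((integrableOn_mul_mul (Hval w) (Hdiff w)).abs.const_mul 2)
            a b ha hb).const_mul _)
      · exact (hG.locInt a b ha hb).div_const 2
      · intro r hr
        have hr0 : 0 < r := ha.trans_le hr.1
        have h2 := mul_Hrep_sq_le w hr0
        have h3 : 0 ≤ r * Hrep w r ^ 2 := by positivity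
        have h4 := neg_abs_le (Hval w r * Hdiff w r * r)
        have h5 := abs_nonneg (Hval w r * Hdiff w r * r)
        nlinarith [mul_le_mul_of_nonneg_right h2 h5, mul_le_mul_of_nonneg_left h4 h3]
    · exact (LocInt.of_integrableOn ((integrableOn_mul_mul (Hval w) (Hdiff w)).abs.const_mul 2)
            a b ha hb).const_mul _
  have h6 : ∫ r in a..b, 2 * |Hval w r * Hdiff w r * r| ≤ ‖w‖ ^ 2 := by
    rw [intervalIntegral.integral_const_mul, intervalIntegral.integral_of_le hab]
    have : ∫ r in Ioc a b, |Hval w r * Hdiff w r * r| ≤ ∫ r in Ioi 0, |Hval w r * Hdiff w r * r| :=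
      setIntegral_mono_set (integrableOn_mul_mul _ _).abs
        (Eventually.of_forall fun _ => abs_nonneg _)
        (Eventually.of_forall fun x hx => ha.trans hx.1)
    linarith [integral_abs_mul_le w]
  nlinarith [mul_le_mul_of_nonneg_left h6 (sq_nonneg ‖w‖), mul_le_mul hbb hbb h0b (sq_nonneg _),
    mul_nonneg h0a h0a]

/-! ### Products -/

theorem memLp_bdd_mul {ρ : ℝ → ℝ} {C : ℝ} (hm : AEStronglyMeasurable ρ radialMeasure)
    (hb : ∀ᵐ r ∂radialMeasure, |ρ r| ≤ C) (a : RadialL2) :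
    MemLp (fun r => ρ r * a r) 2 radialMeasure := by
  refine (Lp.memLp a).of_le_mul (c := C) (hm.mul (Lp.aestronglyMeasurable a)) ?_
  filter_upwards [hb] with r hr
  rw [norm_mul]
  exact mul_le_mul_of_nonneg_right hr (norm_nonneg _)

/-- Multiplication of `L²_r` by a bounded function. -/
def mulBdd (ρ : ℝ → ℝ) (C : ℝ) (hm : AEStronglyMeasurable ρ radialMeasure)
    (hb : ∀ᵐ r ∂radialMeasure, |ρ r| ≤ C) : RadialL2 →L[ℝ] RadialL2 :=
  LinearMap.mkContinuous
    { toFun := fun a => (memLp_bdd_mul hm hb a).toLp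
      map_add' := fun a b => by
        refine Lp.ext ?_
        filter_upwards [(memLp_bdd_mul hm hb (a + b)).coeFn_toLp,
          (memLp_bdd_mul hm hb a).coeFn_toLp, (memLp_bdd_mul hm hb b).coeFn_toLp,
          Lp.coeFn_add a b, Lp.coeFn_add (memLp_bdd_mul hm hb a).toLp
            (memLp_bdd_mul hm hb b).toLp] with r h1 h2 h3 h4 h5
        rw [h1, h5, Pi.add_apply, h2, h3, h4, Pi.add_apply, mul_add]
      map_smul' := fun c a => by
        refine Lp.ext ?_
        filter_upwards [(memLp_bdd_mul hm hb (c • a)).coeFn_toLp,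
          (memLp_bdd_mul hm hb a).coeFn_toLp,
          Lp.coeFn_smul c a, Lp.coeFn_smul c (memLp_bdd_mul hm hb a).toLp] with r h1 h2 h3 h4
        rw [h1, RingHom.id_apply, h4, Pi.smul_apply, h2, h3, Pi.smul_apply, smul_eq_mul,
          smul_eq_mul]
        ring } C (fun a => by
      refine Lp.norm_le_mul_norm_of_ae_le_mul ?_
      filter_upwards [hb, (memLp_bdd_mul hm hb a).coeFn_toLp] with r h1 h2
      simp only [LinearMap.coe_mk, AddHom.coe_mk]
      rw [h2, norm_mul]
      exact mul_le_mul_of_nonneg_right h1 (norm_nonneg _))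

theorem mulBdd_ae {ρ : ℝ → ℝ} {C : ℝ} (hm : AEStronglyMeasurable ρ radialMeasure)
    (hb : ∀ᵐ r ∂radialMeasure, |ρ r| ≤ C) (a : RadialL2) :
    ∀ᵐ r ∂radialMeasure, mulBdd ρ C hm hb a r = ρ r * a r :=
  (memLp_bdd_mul hm hb a).coeFn_toLp

theorem memLp_prodX (u v : SpaceX) :
    MemLp (fun r => Xval u r * Xval v r) 2 radialMeasure :=
  memLp_bdd_mul (Lp.aestronglyMeasurable (Xval u)) (abs_Xval_le u) (Xval v)

theorem memLp_sqH (w : SpaceH) : MemLp (fun r => Hval w r ^ 2) 2 radialMeasure := by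
  rw [memLp_two_iff_integrable_sq (by exact (Lp.aestronglyMeasurable (Hval w)).pow 2),
    integrable_radial_iff]
  refine (Hrep_pow_four w).1.congr_fun_ae ?_
  filter_upwards [ae_restrict_of_ae (Hrep_ae w), ae_restrict_mem measurableSet_Ioi] with r hr h0
  rw [hr h0]; ring

theorem integral_Hval_pow_four_le (w : SpaceH) :
    ∫ r, (Hval w r ^ 2) ^ 2 ∂radialMeasure ≤ 2 * ‖w‖ ^ 4 := by
  rw [integral_radial]
  refine le_of_eq_of_le (integral_congr_ae ?_) (Hrep_pow_four w).2
  filter_upwards [ae_restrict_of_ae (Hrep_ae w), ae_restrict_mem measurableSet_Ioi] with r hr h0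
  rw [hr h0]; ring

theorem memLp_prodH (w z : SpaceH) :
    MemLp (fun r => Hval w r * Hval z r) 2 radialMeasure := by
  refine ((memLp_sqH w).add (memLp_sqH z)).mono
    ((Lp.aestronglyMeasurable (Hval w)).mul (Lp.aestronglyMeasurable (Hval z))) ?_
  filter_upwards with r
  rw [Pi.add_apply, Real.norm_eq_abs, Real.norm_eq_abs, abs_mul, abs_of_nonneg (a := _ + _)
    (by positivity), ← sq_abs (Hval w r), ← sq_abs (Hval z r)]
  nlinarith [sq_nonneg (|Hval w r| - |Hval z r|), abs_nonneg (Hval w r), abs_nonneg (Hval z r)]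

/-- Since |wz|² = w²z², Cauchy-Schwarz reduces the bilinear bound to the L⁴ bound of each factor. -/
theorem norm_toLp_prodH_le (w z : SpaceH) : ‖(memLp_prodH w z).toLp‖ ≤ 2 * ‖w‖ * ‖z‖ := by
  have hsq : ∀ w : SpaceH, ‖(memLp_sqH w).toLp‖ ^ 2 ≤ 2 * ‖w‖ ^ 4 := fun w => by
    rw [norm_sq_eq_integral]
    refine le_of_eq_of_le (integral_congr_ae ?_) (integral_Hval_pow_four_le w)
    filter_upwards [(memLp_sqH w).coeFn_toLp] with r hr
    rw [hr]
  have h1 : ‖(memLp_prodH w z).toLp‖ ^ 2 = inner ℝ (memLp_sqH w).toLp (memLp_sqH z).toLp := by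
    rw [norm_sq_eq_integral, inner_eq_integral]
    refine integral_congr_ae ?_
    filter_upwards [(memLp_sqH w).coeFn_toLp, (memLp_sqH z).coeFn_toLp,
      (memLp_prodH w z).coeFn_toLp] with r h1 h2 h3
    rw [h1, h2, h3]; ring
  have h2 := real_inner_le_norm (memLp_sqH w).toLp (memLp_sqH z).toLp
  have h3 : ∀ w : SpaceH, ‖(memLp_sqH w).toLp‖ ≤ 2 * ‖w‖ ^ 2 := fun w =>
    abs_le_of_sq_le_sq' (by nlinarith [hsq w, sq_nonneg (‖w‖ ^ 2)]) (by positivity) |>.2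
  have h4 : ‖(memLp_sqH w).toLp‖ * ‖(memLp_sqH z).toLp‖ ≤ (2 * ‖w‖ ^ 2) * (2 * ‖z‖ ^ 2) :=
    mul_le_mul (h3 w) (h3 z) (norm_nonneg _) (by positivity)
  refine abs_le_of_sq_le_sq' ?_ (by positivity) |>.2
  rw [h1]
  nlinarith

/-- The product of two elements of `X`, as an element of `L²_r`. -/
def prodX : SpaceX →L[ℝ] SpaceX →L[ℝ] RadialL2 :=
  LinearMap.mkContinuous₂ (LinearMap.mk₂ ℝ (fun u v => (memLp_prodX u v).toLp)
    (fun u u' v => by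
      refine Lp.ext ?_
      filter_upwards [(memLp_prodX (u + u') v).coeFn_toLp, (memLp_prodX u v).coeFn_toLp,
        (memLp_prodX u' v).coeFn_toLp, Lp.coeFn_add (Xval u) (Xval u'),
        Lp.coeFn_add (memLp_prodX u v).toLp (memLp_prodX u' v).toLp] with r h1 h2 h3 h4 h5
      rw [h1, h5, Pi.add_apply, h2, h3, map_add, h4, Pi.add_apply, add_mul])
    (fun c u v => by
      refine Lp.ext ?_
      filter_upwards [(memLp_prodX (c • u) v).coeFn_toLp, (memLp_prodX u v).coeFn_toLp,
        Lp.coeFn_smul c (Xval u), Lp.coeFn_smul c (memLp_prodX u v).toLp] with r h1 h2 h4 h5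
      rw [h1, h5, Pi.smul_apply, h2, map_smul, h4, Pi.smul_apply, smul_eq_mul, smul_eq_mul,
        mul_assoc])
    (fun u v v' => by
      refine Lp.ext ?_
      filter_upwards [(memLp_prodX u (v + v')).coeFn_toLp, (memLp_prodX u v).coeFn_toLp,
        (memLp_prodX u v').coeFn_toLp, Lp.coeFn_add (Xval v) (Xval v'),
        Lp.coeFn_add (memLp_prodX u v).toLp (memLp_prodX u v').toLp] with r h1 h2 h3 h4 h5
      rw [h1, h5, Pi.add_apply, h2, h3, map_add, h4, Pi.add_apply, mul_add])
    (fun c u v => by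
      refine Lp.ext ?_
      filter_upwards [(memLp_prodX u (c • v)).coeFn_toLp, (memLp_prodX u v).coeFn_toLp,
        Lp.coeFn_smul c (Xval v), Lp.coeFn_smul c (memLp_prodX u v).toLp] with r h1 h2 h4 h5
      rw [h1, h5, Pi.smul_apply, h2, map_smul, h4, Pi.smul_apply, smul_eq_mul, smul_eq_mul]
      ring)) 1 (fun u v => by
    rw [one_mul]
    have h1 : ‖Xval v‖ ≤ ‖v‖ := abs_le_of_sq_le_sq' (by
      rw [norm_sq_X]; nlinarith [sq_nonneg ‖Xdiff v‖, sq_nonneg ‖Xquot v‖]) (norm_nonneg _) |>.2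
    refine le_trans ?_ (mul_le_mul_of_nonneg_left h1 (norm_nonneg u))
    refine Lp.norm_le_mul_norm_of_ae_le_mul ?_
    filter_upwards [abs_Xval_le u, (memLp_prodX u v).coeFn_toLp] with r h1 h2
    simp only [LinearMap.mk₂_apply]
    rw [h2, norm_mul]
    exact mul_le_mul_of_nonneg_right h1 (norm_nonneg _))

theorem prodX_ae (u v : SpaceX) :
    ∀ᵐ r ∂radialMeasure, prodX u v r = Xval u r * Xval v r := (memLp_prodX u v).coeFn_toLp

/-- The product of two elements of `H`, as an element of `L²_r`. -/
def prodH : SpaceH →L[ℝ] SpaceH →L[ℝ] RadialL2 :=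
  LinearMap.mkContinuous₂ (LinearMap.mk₂ ℝ (fun u v => (memLp_prodH u v).toLp)
    (fun u u' v => by
      refine Lp.ext ?_
      filter_upwards [(memLp_prodH (u + u') v).coeFn_toLp, (memLp_prodH u v).coeFn_toLp,
        (memLp_prodH u' v).coeFn_toLp, Lp.coeFn_add (Hval u) (Hval u'),
        Lp.coeFn_add (memLp_prodH u v).toLp (memLp_prodH u' v).toLp] with r h1 h2 h3 h4 h5
      rw [h1, h5, Pi.add_apply, h2, h3, map_add, h4, Pi.add_apply, add_mul])
    (fun c u v => by
      refine Lp.ext ?_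
      filter_upwards [(memLp_prodH (c • u) v).coeFn_toLp, (memLp_prodH u v).coeFn_toLp,
        Lp.coeFn_smul c (Hval u), Lp.coeFn_smul c (memLp_prodH u v).toLp] with r h1 h2 h4 h5
      rw [h1, h5, Pi.smul_apply, h2, map_smul, h4, Pi.smul_apply, smul_eq_mul, smul_eq_mul,
        mul_assoc])
    (fun u v v' => by
      refine Lp.ext ?_
      filter_upwards [(memLp_prodH u (v + v')).coeFn_toLp, (memLp_prodH u v).coeFn_toLp,
        (memLp_prodH u v').coeFn_toLp, Lp.coeFn_add (Hval v) (Hval v'),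
        Lp.coeFn_add (memLp_prodH u v).toLp (memLp_prodH u v').toLp] with r h1 h2 h3 h4 h5
      rw [h1, h5, Pi.add_apply, h2, h3, map_add, h4, Pi.add_apply, mul_add])
    (fun c u v => by
      refine Lp.ext ?_
      filter_upwards [(memLp_prodH u (c • v)).coeFn_toLp, (memLp_prodH u v).coeFn_toLp,
        Lp.coeFn_smul c (Hval v), Lp.coeFn_smul c (memLp_prodH u v).toLp] with r h1 h2 h4 h5
      rw [h1, h5, Pi.smul_apply, h2, map_smul, h4, Pi.smul_apply, smul_eq_mul, smul_eq_mul]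
      ring)) 2 norm_toLp_prodH_le

theorem prodH_ae (u v : SpaceH) :
    ∀ᵐ r ∂radialMeasure, prodH u v r = Hval u r * Hval v r := (memLp_prodH u v).coeFn_toLp

/-! ### Completeness -/

theorem memLp_test_div {φ : ℝ → ℝ} (hφ : Continuous φ) (hc : HasCompactSupport φ)
    (hs : tsupport φ ⊆ Ioi 0) : MemLp (fun r : ℝ => φ r / r) 2 radialMeasure := by
  have hm : AEStronglyMeasurable (fun r : ℝ => φ r / r) radialMeasure :=
    aestronglyMeasurable_radial (hφ.continuousOn.div continuousOn_id fun x hx => ne_of_gt hx)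
  rw [memLp_two_iff_integrable_sq hm, integrable_radial_iff]
  have h1 : LocInt fun r : ℝ => φ r / r := LocInt.of_continuousOn
    (hφ.continuousOn.div continuousOn_id fun x hx => ne_of_gt hx)
  refine (h1.mul_test hφ hc hs).congr_fun (fun r hr => ?_) measurableSet_Ioi
  have hr' : r ≠ 0 := ne_of_gt hr
  field_simp

theorem setIntegral_mul_test_eq_inner (a : RadialL2) {φ : ℝ → ℝ} (hφ : Continuous φ)
    (hc : HasCompactSupport φ) (hs : tsupport φ ⊆ Ioi 0) :
    ∫ r in Ioi (0 : ℝ), a r * φ r = inner ℝ a (memLp_test_div hφ hc hs).toLp := by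
  rw [inner_eq_integral, integral_radial]
  refine integral_congr_ae ?_
  filter_upwards [ae_of_ae_radial (memLp_test_div hφ hc hs).coeFn_toLp,
    ae_restrict_mem measurableSet_Ioi] with r hr h0
  have hr' : r ≠ 0 := ne_of_gt h0
  rw [hr]; field_simp

/-- A test function φ vanishes near 0, so φ/r belongs to L²_r and testing against φ is a continuous
inner product. -/
theorem isClosed_hasWeakDeriv :
    IsClosed {q : RadialL2 × RadialL2 | HasWeakDeriv q.1 q.2} := by
  simp only [HasWeakDeriv, ofPred_forall]
  refine isClosed_iInter fun φ => isClosed_iInter fun hφ => isClosed_iInter fun hc =>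
    isClosed_iInter fun hs => ?_
  have hd : Continuous (deriv φ) := hφ.continuous_deriv (by simp)
  have hds := tsupport_deriv_subset.trans hs
  simp_rw [setIntegral_mul_test_eq_inner _ hd hc.deriv hds,
    setIntegral_mul_test_eq_inner _ hφ.continuous hc hs]
  exact isClosed_eq (by fun_prop) (by fun_prop)

instance : CompleteSpace SpaceH := by
  have : IsClosed (SpaceH : Set (PiLp 2 fun _ : Fin 2 => RadialL2)) :=
    isClosed_hasWeakDeriv.preimage (f := fun w : PiLp 2 fun _ : Fin 2 => RadialL2 => (w 0, w 1))
      (by fun_prop)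
  exact this.completeSpace_coe

theorem bound_one_add_inv : ∀ᵐ r ∂radialMeasure, |1 / (1 + r)| ≤ 1 := by
  filter_upwards [ae_radial_pos] with r hr
  rw [abs_of_pos (by positivity), div_le_one (by positivity)]
  linarith

theorem bound_div_one_add : ∀ᵐ r ∂radialMeasure, |r / (1 + r)| ≤ 1 := by
  filter_upwards [ae_radial_pos] with r hr
  rw [abs_of_pos (by positivity), div_le_one (by positivity)]
  linarith

theorem measurable_one_add_inv :
    AEStronglyMeasurable (fun r : ℝ => 1 / (1 + r)) radialMeasure :=
  (by fun_prop : Measurable fun r : ℝ => 1 / (1 + r)).aestronglyMeasurable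

theorem measurable_div_one_add :
    AEStronglyMeasurable (fun r : ℝ => r / (1 + r)) radialMeasure :=
  (by fun_prop : Measurable fun r : ℝ => r / (1 + r)).aestronglyMeasurable

/-- Division by r is unbounded on L²_r. Multiplied by r/(1+r), the relation b = a/r becomes an
equality between two bounded multiplication operators. -/
theorem isClosed_quot :
    IsClosed {q : RadialL2 × RadialL2 | ∀ᵐ r ∂radialMeasure, q.2 r = q.1 r / r} := by
  have e : {q : RadialL2 × RadialL2 | ∀ᵐ r ∂radialMeasure, q.2 r = q.1 r / r} =
      {q | mulBdd _ 1 measurable_div_one_add bound_div_one_add q.2 =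
        mulBdd _ 1 measurable_one_add_inv bound_one_add_inv q.1} := by
    ext q
    have h1 := mulBdd_ae measurable_div_one_add bound_div_one_add q.2
    have h2 := mulBdd_ae measurable_one_add_inv bound_one_add_inv q.1
    constructor
    · intro h
      refine Lp.ext ?_
      filter_upwards [h1, h2, h, ae_radial_pos] with r h1 h2 h h0
      rw [h1, h2, h]
      field_simp
    · intro h
      have h' : mulBdd _ 1 measurable_div_one_add bound_div_one_add q.2 =
        mulBdd _ 1 measurable_one_add_inv bound_one_add_inv q.1 := h
      change ∀ᵐ r ∂radialMeasure, q.2 r = q.1 r / r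
      filter_upwards [h1, h2, ae_radial_pos] with r h1 h2 h0
      rw [h', h2] at h1
      field_simp at h1 ⊢
      linarith
  rw [e]
  exact isClosed_eq (by fun_prop) (by fun_prop)

instance : CompleteSpace SpaceX := by
  have h1 : IsClosed {u : PiLp 2 fun _ : Fin 3 => RadialL2 | HasWeakDeriv (u 0) (u 1)} :=
    isClosed_hasWeakDeriv.preimage (f := fun w : PiLp 2 fun _ : Fin 3 => RadialL2 => (w 0, w 1))
      (by fun_prop)
  have h2 : IsClosed {u : PiLp 2 fun _ : Fin 3 => RadialL2 |
      ∀ᵐ r ∂radialMeasure, u 2 r = u 0 r / r} :=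
    isClosed_quot.preimage (f := fun w : PiLp 2 fun _ : Fin 3 => RadialL2 => (w 0, w 2))
      (by fun_prop)
  exact (h1.inter h2).completeSpace_coe

theorem H_eq_zero_of_Hrep {w : SpaceH} (h : ∀ x, 0 < x → Hrep w x = 0) : w = 0 := by
  have h1 : Hval w = 0 := by
    refine Lp.ext ?_
    filter_upwards [ae_radial_iff.2 (Hrep_ae w), ae_radial_pos,
      Lp.coeFn_zero ℝ 2 radialMeasure] with r hr h0 hz
    rw [hr, hz, h r h0, Pi.zero_apply]
  have h2 : Hdiff w = 0 := by
    refine Lp.ext ?_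
    filter_upwards [ae_radial_iff.2 (Hrep_hasPrim w).ae_hasDerivAt, ae_radial_pos,
      Lp.coeFn_zero ℝ 2 radialMeasure] with r hr h0 hz
    rw [hz, Pi.zero_apply]
    refine hr.unique ((hasDerivAt_const r (0 : ℝ)).congr_of_eventuallyEq ?_)
    filter_upwards [Ioi_mem_nhds h0] with x hx using h x hx
  exact H_ext (by rw [h1, map_zero]) (by rw [h2, map_zero])

theorem H_eq_zero_of_Hval {w : SpaceH} (h : Hval w = 0) : w = 0 := by
  refine H_eq_zero_of_Hrep ((Hrep_hasPrim w).eq_of_ae_eq (V := fun _ => 0) (q := fun _ => 0)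
    ⟨fun _ _ _ _ => intervalIntegrable_const, by simp⟩ ?_)
  filter_upwards [Hrep_ae w, ae_radial_iff.1 (Lp.coeFn_zero ℝ 2 radialMeasure)] with r hr hz h0
  rw [← hr h0, h, hz h0, Pi.zero_apply]

theorem X_eq_zero_of_Xval {u : SpaceX} (h : Xval u = 0) : u = 0 := by
  have h1 : XtoH u = 0 := H_eq_zero_of_Hval h
  have h2 : Xquot u = 0 := by
    refine Lp.ext ?_
    filter_upwards [Xquot_ae u, Lp.coeFn_zero ℝ 2 radialMeasure] with r hr hz
    rw [hr, h, hz]; simp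
  refine X_ext (by rw [h, map_zero]) ?_ (by rw [h2, map_zero])
  rw [← Hdiff_XtoH, h1, map_zero, map_zero]

end

/-! ### A priori bounds on the normal core -/

theorem not_integrable_radial_of_le {h : ℝ → ℝ} {c k : ℝ} (hc : 0 < c) (hk : 0 < k)
    (hle : ∀ x, c < x → k ≤ h x) : ¬ Integrable h radialMeasure := by
  rw [integrable_radial_iff]
  intro hi
  refine not_integrableOn_of_inv_le (c := k * c ^ 2) measurableSet_Ioi (by positivity) ?_
    (not_integrableOn_Ioi_inv (a := c)) (hi.mono_set (Ioi_subset_Ioi hc.le))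
  intro x hx
  have hx' : c < x := hx
  have hx0 := hc.trans hx'
  have h1 := hle x hx'
  rw [abs_of_pos (inv_pos.2 hx0), abs_of_pos (mul_pos (hk.trans_le h1) hx0),
    ← div_eq_mul_inv, div_le_iff₀ hx0]
  nlinarith [mul_le_mul h1 (mul_self_le_mul_self hc.le hx'.le) (by positivity) (hk.le.trans h1)]

/-- Grönwall's argument: the energy E = w² + p² satisfies |E'| ≤ M E between x₀ and x, where M
bounds |a + b|. So E e^{-My} decreases to the right of x₀, E e^{My} increases to the left, and E(x₀)
= 0. -/
theorem linear_ode_eq_zero {w p a b : ℝ → ℝ} (ha : ContinuousOn a (Ioi 0))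
    (hb : ContinuousOn b (Ioi 0)) (hw : ∀ x, 0 < x → HasDerivAt w (a x * p x) x)
    (hp : ∀ x, 0 < x → HasDerivAt p (b x * w x) x) {x₀ : ℝ} (hx₀ : 0 < x₀) (hw0 : w x₀ = 0)
    (hp0 : p x₀ = 0) {x : ℝ} (hx : 0 < x) : w x = 0 := by
  obtain ⟨M, hM⟩ := isCompact_uIcc.exists_bound_of_continuousOn
    ((ha.add hb).mono (uIcc_subset_Ioi hx₀ hx))
  have hE : ∀ y, 0 < y → HasDerivAt (fun y => w y ^ 2 + p y ^ 2)
      (2 * (a y + b y) * (w y * p y)) y := fun y hy => by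
    refine (((hw y hy).fun_pow 2).fun_add ((hp y hy).fun_pow 2)).congr_deriv ?_
    push_cast; ring
  have hbound : ∀ y ∈ uIcc x₀ x, |2 * (a y + b y) * (w y * p y)| ≤ M * (w y ^ 2 + p y ^ 2) := by
    intro y hy
    have h1 := hM y hy
    rw [Pi.add_apply, Real.norm_eq_abs] at h1
    have h2 : |2 * (w y * p y)| ≤ w y ^ 2 + p y ^ 2 := by
      rw [abs_le]; constructor <;> nlinarith [sq_nonneg (w y + p y), sq_nonneg (w y - p y)]
    calc |2 * (a y + b y) * (w y * p y)| = |a y + b y| * |2 * (w y * p y)| := by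
          rw [← abs_mul]; ring_nf
      _ ≤ _ := mul_le_mul h1 h2 (abs_nonneg _) ((abs_nonneg _).trans h1)
  have key : ∀ s : ℝ, (s = 1 ∨ s = -1) → ∀ y, 0 < y → HasDerivAt
      (fun y => (w y ^ 2 + p y ^ 2) * Real.exp (s * M * y))
      ((2 * (a y + b y) * (w y * p y) + s * M * (w y ^ 2 + p y ^ 2)) * Real.exp (s * M * y)) y := by
    intro s _ y hy
    have h1 : HasDerivAt (fun y => Real.exp (s * M * y)) (Real.exp (s * M * y) * (s * M)) y := by
      simpa using ((hasDerivAt_id y).const_mul (s * M)).exp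
    refine ((hE y hy).fun_mul h1).congr_deriv ?_
    ring
  have hfin : (w x ^ 2 + p x ^ 2) ≤ 0 := by
    rcases le_total x₀ x with hle | hle
    · have hk := key (-1) (Or.inr rfl)
      have hanti : AntitoneOn (fun y => (w y ^ 2 + p y ^ 2) * Real.exp (-1 * M * y)) (Icc x₀ x) := by
        refine antitoneOn_of_deriv_nonpos (convex_Icc _ _)
          (fun y hy => (hk y (hx₀.trans_le hy.1)).continuousAt.continuousWithinAt)
          (fun y hy => (hk y (hx₀.trans_le (interior_subset hy).1)).differentiableAt.differentiableWithinAt)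
          fun y hy => ?_
        have hy' := interior_subset hy
        rw [(hk y (hx₀.trans_le hy'.1)).deriv]
        have := (abs_le.1 (hbound y (by rwa [uIcc_of_le hle]))).2
        exact mul_nonpos_of_nonpos_of_nonneg (by linarith) (Real.exp_pos _).le
      have := hanti (left_mem_Icc.2 hle) (right_mem_Icc.2 hle) hle
      simp only [hw0, hp0] at this
      by_contra hcon
      have := mul_pos (not_le.1 hcon) (Real.exp_pos (-1 * M * x))
      linarith
    · have hk := key 1 (Or.inl rfl)
      have hmono : MonotoneOn (fun y => (w y ^ 2 + p y ^ 2) * Real.exp (1 * M * y)) (Icc x x₀) := by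
        refine monotoneOn_of_deriv_nonneg (convex_Icc _ _)
          (fun y hy => (hk y (hx.trans_le hy.1)).continuousAt.continuousWithinAt)
          (fun y hy => (hk y (hx.trans_le (interior_subset hy).1)).differentiableAt.differentiableWithinAt)
          fun y hy => ?_
        have hy' := interior_subset hy
        rw [(hk y (hx.trans_le hy'.1)).deriv]
        have := (abs_le.1 (hbound y (by rwa [uIcc_of_ge hle]))).1
        exact mul_nonneg (by linarith) (Real.exp_pos _).le
      have := hmono (left_mem_Icc.2 hle) (right_mem_Icc.2 hle) hle
      simp only [hw0, hp0] at this
      by_contra hcon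
      have := mul_pos (not_le.1 hcon) (Real.exp_pos (1 * M * x))
      linarith
  nlinarith [sq_nonneg (w x), sq_nonneg (p x)]

/-- Squaring the positive part makes it C¹, hence usable in a classical test function for the bound
f ≤ 1. -/
theorem hasDerivAt_max_sq (t : ℝ) :
    HasDerivAt (fun t : ℝ => max (t - 1) 0 ^ 2) (2 * max (t - 1) 0) t := by
  rcases lt_trichotomy t 1 with h | h | h
  · rw [max_eq_right (by linarith), mul_zero]
    refine (hasDerivAt_const t (0 : ℝ)).congr_of_eventuallyEq ?_
    filter_upwards [Iio_mem_nhds h] with x hx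
    have : x < 1 := hx
    rw [max_eq_right (by linarith)]; norm_num
  · subst h
    rw [hasDerivAt_iff_isLittleO]
    simp only [sub_self, max_self, mul_zero, smul_zero, sub_zero]
    have h1 : (fun x : ℝ => (x - 1) * (x - 1)) =o[𝓝 1] fun x : ℝ => x - 1 := by
      have : Tendsto (fun x : ℝ => x - 1) (𝓝 1) (𝓝 0) := by
        simpa using (continuous_id.fun_sub (continuous_const (y := (1 : ℝ)))).tendsto 1
      have := ((Asymptotics.isLittleO_one_iff ℝ).2 this).mul_isBigO
        (Asymptotics.isBigO_refl (fun x : ℝ => x - 1) (𝓝 1))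
      simpa using this
    refine Asymptotics.IsBigO.trans_isLittleO (Asymptotics.IsBigO.of_bound 1 ?_) h1
    filter_upwards with x
    rw [one_mul, Real.norm_eq_abs, Real.norm_eq_abs]
    rw [abs_of_nonneg (by nlinarith), abs_of_nonneg (by nlinarith)]
    rcases le_total (x - 1) 0 with h | h
    · rw [max_eq_right h]; nlinarith
    · rw [max_eq_left h]; nlinarith
  · have h1 : HasDerivAt (fun t : ℝ => (t - 1) ^ 2) (2 * (t - 1)) t := by
      simpa using ((hasDerivAt_id t).sub_const 1).fun_pow 2
    rw [max_eq_left (by linarith)]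
    refine h1.congr_of_eventuallyEq ?_
    filter_upwards [Ioi_mem_nhds h] with x hx
    have : 1 < x := hx
    rw [max_eq_left (by linarith)]

/-- The information about a normal core that is used below. -/
structure CoreODE (d : ℤ) (κ : ℝ) (f S : ℝ → ℝ) : Prop where
  hd : d ≠ 0
  hκ : 2 * (d : ℝ) ^ 2 ≤ κ ^ 2
  f_nonneg : ∀ r, 0 < r → 0 ≤ f r
  S_zero : Tendsto S (𝓝[>] 0) (𝓝 0)
  deriv_f : ∀ r, 0 < r → HasDerivAt f (deriv f r) r
  deriv_rf' : ∀ r, 0 < r → HasDerivAt (fun r => r * deriv f r)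
    (r * ((d - S r) ^ 2 / r ^ 2 - κ ^ 2 * (1 - f r ^ 2)) * f r) r
  deriv_S : ∀ r, 0 < r → HasDerivAt S (deriv S r) r
  deriv_S'r : ∀ r, 0 < r → HasDerivAt (fun r => deriv S r / r) (-((d - S r) * f r ^ 2 / r)) r
  cont_f' : ContinuousOn (deriv f) (Ioi 0)
  cont_S' : ContinuousOn (deriv S) (Ioi 0)
  int_f' : Integrable (fun r => deriv f r ^ 2) radialMeasure
  int_S' : Integrable (fun r => (deriv S r / r) ^ 2) radialMeasure
  int_T : Integrable (fun r => ((d - S r) * f r / r) ^ 2) radialMeasure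
  int_V : Integrable (fun r => (1 - f r ^ 2) ^ 2) radialMeasure

theorem IsNormalCore.coreODE {d : ℤ} (hd : d ≠ 0) {κ : ℝ} (hκ : 2 * (d : ℝ) ^ 2 ≤ κ ^ 2)
    {f S : ℝ → ℝ} (hcore : IsNormalCore d κ f S) : CoreODE d κ f S := by
  -- When m = 0 no term depends on g, so any value of g will do.
  have hadm := hcore 0
  have hs := hadm.solves
  have hκ0 : 0 < κ ^ 2 := by
    have : 0 < (d : ℝ) ^ 2 := by positivity
    linarith
  have d1 : ∀ {h : ℝ → ℝ}, ContDiffOn ℝ 2 h (Ioi 0) → ∀ r, 0 < r → HasDerivAt h (deriv h r) r :=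
    fun {h} hh r hr => ((hh.differentiableOn (by norm_num)).differentiableAt
      (Ioi_mem_nhds hr)).hasDerivAt
  have c1 : ∀ {h : ℝ → ℝ}, ContDiffOn ℝ 2 h (Ioi 0) → ContDiffOn ℝ 1 (deriv h) (Ioi 0) :=
    fun {h} hh => hh.deriv_of_isOpen isOpen_Ioi (by norm_num)
  have d2 : ∀ {h : ℝ → ℝ}, ContDiffOn ℝ 2 h (Ioi 0) → ∀ r, 0 < r →
      HasDerivAt (deriv h) (deriv (deriv h) r) r :=
    fun {h} hh r hr => (((c1 hh).differentiableOn (by norm_num)).differentiableAt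
      (Ioi_mem_nhds hr)).hasDerivAt
  have hcf := hs.contDiff_f.continuousOn
  have hcS := hs.contDiff_S.continuousOn
  have hcf' := (c1 hs.contDiff_f).continuousOn
  have hcS' := (c1 hs.contDiff_S).continuousOn
  have hid : ContinuousOn (fun r : ℝ => r) (Ioi 0) := continuousOn_id
  have hne : ∀ r ∈ Ioi (0 : ℝ), r ≠ 0 := fun r hr => ne_of_gt hr
  have hfin := hadm.finite_energy
  have dom : ∀ {h : ℝ → ℝ}, ContinuousOn h (Ioi 0) → ∀ c : ℝ, (∀ r, ‖h r‖ ≤ c *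
      energyDensity d κ 0 (f r) (deriv f r) (S r) (deriv S r) ((0 : ℝ → ℝ) r)
        (deriv (0 : ℝ → ℝ) r) r) → Integrable h radialMeasure :=
    fun {h} hc c hle => (hfin.const_mul c).mono' (aestronglyMeasurable_radial hc)
      (Eventually.of_forall hle)
  have expand : ∀ r, energyDensity d κ 0 (f r) (deriv f r) (S r) (deriv S r) ((0 : ℝ → ℝ) r)
        (deriv (0 : ℝ → ℝ) r) r = 1 / 2 * (deriv f r ^ 2 + (deriv S r / r) ^ 2 +
          ((d - S r) * f r / r) ^ 2 + κ ^ 2 / 2 * (1 - f r ^ 2) ^ 2) := fun r => by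
    have : deriv (0 : ℝ → ℝ) r = 0 := deriv_const r 0
    simp only [energyDensity, this, Pi.zero_apply]
    ring
  have hq : 0 ≤ κ ^ 2 / 2 := by positivity
  refine ⟨hd, hκ, hadm.f_nonneg, hadm.S_zero, d1 hs.contDiff_f, fun r hr => ?_, d1 hs.contDiff_S,
    fun r hr => ?_, hcf', hcS', ?_, ?_, ?_, ?_⟩
  · refine ((hasDerivAt_id' r).fun_mul (d2 hs.contDiff_f r hr)).congr_deriv ?_
    have := hs.eq_f r hr
    simp only [Pi.zero_apply] at this
    field_simp at this ⊢
    linarith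
  · refine ((d2 hs.contDiff_S r hr).fun_div (hasDerivAt_id' r) hr.ne').congr_deriv ?_
    have := hs.eq_S r hr
    field_simp at this ⊢
    linarith
  · refine dom (hcf'.pow 2) 2 fun r => ?_
    rw [expand, Real.norm_of_nonneg (sq_nonneg _)]
    nlinarith [sq_nonneg (deriv S r / r), sq_nonneg ((d - S r) * f r / r),
      mul_nonneg hq (sq_nonneg (1 - f r ^ 2))]
  · refine dom ((hcS'.div hid hne).pow 2) 2 fun r => ?_
    rw [expand, Real.norm_of_nonneg (by positivity)]
    nlinarith [sq_nonneg (deriv f r), sq_nonneg ((d - S r) * f r / r),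
      mul_nonneg hq (sq_nonneg (1 - f r ^ 2))]
  · refine dom ((((continuousOn_const.sub hcS).mul hcf).div hid hne).pow 2) 2 fun r => ?_
    rw [expand, Real.norm_of_nonneg (by positivity)]
    nlinarith [sq_nonneg (deriv f r), sq_nonneg (deriv S r / r),
      mul_nonneg hq (sq_nonneg (1 - f r ^ 2))]
  · refine dom ((continuousOn_const.sub (hcf.pow 2)).pow 2) (4 / κ ^ 2) fun r => ?_
    rw [expand, Real.norm_of_nonneg (sq_nonneg _)]
    have e : 4 / κ ^ 2 * (1 / 2 * (deriv f r ^ 2 + (deriv S r / r) ^ 2 +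
          ((d - S r) * f r / r) ^ 2 + κ ^ 2 / 2 * (1 - f r ^ 2) ^ 2)) =
        2 / κ ^ 2 * (deriv f r ^ 2 + (deriv S r / r) ^ 2 + ((d - S r) * f r / r) ^ 2)
          + (1 - f r ^ 2) ^ 2 := by
      have := hκ0.ne'
      have : κ ≠ 0 := by rintro rfl; simp at hκ0
      field_simp
      ring
    rw [e]
    have : 0 ≤ 2 / κ ^ 2 * (deriv f r ^ 2 + (deriv S r / r) ^ 2 + ((d - S r) * f r / r) ^ 2) := by
      positivity
    linarith

namespace CoreODE

variable {d : ℤ} {κ : ℝ} {f S : ℝ → ℝ}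

theorem cont_f (h : CoreODE d κ f S) : ContinuousOn f (Ioi 0) :=
  fun r hr => (h.deriv_f r hr).continuousAt.continuousWithinAt

theorem cont_S (h : CoreODE d κ f S) : ContinuousOn S (Ioi 0) :=
  fun r hr => (h.deriv_S r hr).continuousAt.continuousWithinAt

theorem d_sq_ge_one (h : CoreODE d κ f S) : 1 ≤ (d : ℝ) ^ 2 := by
  have h1 : 1 ≤ d ^ 2 := by
    have : 0 < d ^ 2 := by have := h.hd; positivity
    linarith
  exact_mod_cast h1

theorem two_le_κ_sq (h : CoreODE d κ f S) : 2 ≤ κ ^ 2 := by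
  have := h.hκ; have := h.d_sq_ge_one; linarith

/-- Write P = (d - S)² and P' = x q. The equation for S makes q nondecreasing. If q were positive
somewhere, P would grow quadratically, which finite energy forbids; so P is nonincreasing and
bounded by its limit d² at 0. -/
theorem sq_T_le (h : CoreODE d κ f S) {r : ℝ} (hr : 0 < r) : (d - S r) ^ 2 ≤ (d : ℝ) ^ 2 := by
  have hP : ∀ x, 0 < x → HasDerivAt (fun x => (d - S x) ^ 2)
      (x * (-2 * (d - S x) * (deriv S x / x))) x := fun x hx => by
    refine (((h.deriv_S x hx).const_sub (d : ℝ)).fun_pow 2).congr_deriv ?_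
    push_cast
    field_simp
  have hq : ∀ x, 0 < x → HasDerivAt (fun x => -2 * (d - S x) * (deriv S x / x))
      (2 * deriv S x ^ 2 / x + 2 * (d - S x) ^ 2 * f x ^ 2 / x) x := fun x hx => by
    refine ((((h.deriv_S x hx).const_sub (d : ℝ)).const_mul (-2)).fun_mul
      (h.deriv_S'r x hx)).congr_deriv ?_
    field_simp
  have hqm : MonotoneOn (fun x => -2 * (d - S x) * (deriv S x / x)) (Ioi 0) := by
    refine monotoneOn_of_deriv_nonneg (convex_Ioi 0)
      (fun y hy => (hq y hy).continuousAt.continuousWithinAt)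
      (fun y hy => (hq y (interior_subset hy)).differentiableAt.differentiableWithinAt)
      fun y hy => ?_
    have hy' : (0 : ℝ) < y := interior_subset hy
    rw [(hq y hy').deriv]
    positivity
  have hq0 : ∀ x, 0 < x → -2 * (d - S x) * (deriv S x / x) ≤ 0 := by
    intro x₀ hx₀
    by_contra hcon
    rw [not_le] at hcon
    set c := -2 * (d - S x₀) * (deriv S x₀ / x₀) with hc
    have hmono : MonotoneOn (fun x => (d - S x) ^ 2 - c / 2 * x ^ 2) (Ici x₀) := by
      have hD : ∀ x, 0 < x → HasDerivAt (fun x => (d - S x) ^ 2 - c / 2 * x ^ 2)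
          (x * (-2 * (d - S x) * (deriv S x / x)) - c * x) x := fun x hx => by
        refine ((hP x hx).fun_sub (((hasDerivAt_id' x).fun_pow 2).const_mul (c / 2))).congr_deriv ?_
        push_cast; ring
      refine monotoneOn_of_deriv_nonneg (convex_Ici _)
        (fun y hy => (hD y (hx₀.trans_le hy)).continuousAt.continuousWithinAt)
        (fun y hy => (hD y (hx₀.trans_le
          (interior_subset hy))).differentiableAt.differentiableWithinAt) fun y hy => ?_
      have hy' : x₀ ≤ y := interior_subset hy
      rw [(hD y (hx₀.trans_le hy')).deriv]
      have := hqm hx₀ (hx₀.trans_le hy') hy'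
      simp only [← hc] at this
      nlinarith
    -- From P(x) ≥ (c/2)(x² - x₀²), and x² - x₀² ≥ (3/4)x² once x > 2x₀.
    have hlow : ∀ x, 2 * x₀ < x → 3 * c / 8 * x ^ 2 ≤ (d - S x) ^ 2 := by
      intro x hx
      have := hmono (mem_Ici.2 le_rfl) (mem_Ici.2 (by linarith : x₀ ≤ x)) (by linarith)
      simp only at this
      have h2 : 4 * x₀ ^ 2 ≤ x ^ 2 := by nlinarith
      nlinarith [sq_nonneg (d - S x₀)]
    -- Quadratic growth makes T²f²/x² at least a multiple of f². The weight 16/(3c) turns it into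
    -- 2f², and (1 - f²)² + 2f² = 1 + f⁴ ≥ 1 is not integrable at infinity.
    refine not_integrable_radial_of_le (c := 2 * x₀) (k := 1) (by positivity) one_pos ?_
      (h.int_V.add (h.int_T.const_mul (16 / (3 * c))))
    intro x hx
    have hx0 : 0 < x := lt_trans (by positivity) hx
    have h1 := hlow x hx
    have h2 : 2 * f x ^ 2 ≤ 16 / (3 * c) * ((d - S x) * f x / x) ^ 2 := by
      have e : 16 / (3 * c) * ((d - S x) * f x / x) ^ 2
          = 16 / (3 * c) * (d - S x) ^ 2 / x ^ 2 * f x ^ 2 := by field_simp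
      rw [e]
      refine mul_le_mul_of_nonneg_right ?_ (sq_nonneg _)
      rw [le_div_iff₀ (by positivity), div_mul_eq_mul_div, le_div_iff₀ (by positivity)]
      linarith
    simp only [Pi.add_apply]
    nlinarith [sq_nonneg (f x ^ 2)]
  have hPa : AntitoneOn (fun x => (d - S x) ^ 2) (Ioi 0) := by
    refine antitoneOn_of_deriv_nonpos (convex_Ioi 0)
      (fun y hy => (hP y hy).continuousAt.continuousWithinAt)
      (fun y hy => (hP y (interior_subset hy)).differentiableAt.differentiableWithinAt)
      fun y hy => ?_
    have hy' : (0 : ℝ) < y := interior_subset hy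
    rw [(hP y hy').deriv]
    exact mul_nonpos_of_nonneg_of_nonpos hy'.le (hq0 y hy')
  have hlim : Tendsto (fun x => (d - S x) ^ 2) (𝓝[>] 0) (𝓝 ((d - 0) ^ 2)) :=
    (h.S_zero.const_sub (d : ℝ)).pow 2
  rw [sub_zero] at hlim
  refine ge_of_tendsto hlim ?_
  filter_upwards [Ioo_mem_nhdsGT hr] with y hy
  exact hPa hy.1 hr hy.2.le

theorem cont_ode (h : CoreODE d κ f S) : ContinuousOn
    (fun r => r * ((d - S r) ^ 2 / r ^ 2 - κ ^ 2 * (1 - f r ^ 2))) (Ioi 0) := by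
  have h1 := h.cont_f
  have h2 := h.cont_S
  refine continuousOn_id.mul ((((continuousOn_const.sub h2).pow 2).div
    (continuousOn_id.pow 2) fun x hx => ?_).sub
    (continuousOn_const.mul (continuousOn_const.sub (h1.pow 2))))
  have : (0 : ℝ) < x := hx
  exact pow_ne_zero 2 this.ne'

/-- A zero of f ≥ 0 is a minimum, so f' vanishes there too; ODE uniqueness forces f = 0 everywhere,
and then (1 - f²)² = 1 has infinite integral. -/
theorem f_pos (h : CoreODE d κ f S) {r : ℝ} (hr : 0 < r) : 0 < f r := by
  rcases (h.f_nonneg r hr).eq_or_lt' with h0 | h0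
  swap; · exact h0
  exfalso
  have hmin : IsLocalMin f r := by
    filter_upwards [Ioi_mem_nhds hr] with x hx
    rw [h0]; exact h.f_nonneg x hx
  have hd0 := hmin.deriv_eq_zero
  have hz : ∀ x, 0 < x → f x = 0 := fun x hx => by
    refine linear_ode_eq_zero (w := f) (p := fun r => r * deriv f r) (a := fun r => r⁻¹)
      (continuousOn_id.inv₀ fun x hx => ne_of_gt hx) h.cont_ode (fun x hx => ?_)
      (fun x hx => h.deriv_rf' x hx) hr h0 (by simp [hd0]) hx
    refine (h.deriv_f x hx).congr_deriv ?_
    field_simp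
  refine not_integrable_radial_of_le (c := 1) (k := 1) one_pos one_pos (fun x hx => ?_) h.int_V
  rw [hz x (by linarith)]; norm_num

/-- Near `0` the quantity `f / r` is controlled by the energy. -/
theorem exists_delta (h : CoreODE d κ f S) :
    ∃ δ, 0 < δ ∧ ∀ r, 0 < r → r ≤ δ → 1 / 2 ≤ (d - S r) ^ 2 := by
  have hlim : Tendsto (fun x => (d - S x) ^ 2) (𝓝[>] 0) (𝓝 ((d - 0) ^ 2)) :=
    (h.S_zero.const_sub (d : ℝ)).pow 2
  rw [sub_zero] at hlim
  have h1 := hlim.eventually_const_lt (u := 1 / 2) (by linarith [h.d_sq_ge_one])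
  obtain ⟨δ, hδ, hs⟩ := mem_nhdsGT_iff_exists_Ioc_subset.1 h1
  exact ⟨δ, hδ, fun r h0 hr => le_of_lt (hs ⟨h0, hr⟩)⟩

/-- The equation for f is tested with m²/(1 + f), where m = (f - 1)₊. The square makes the test
function C¹, and the denominator keeps it below m, hence below both f and |1 - f²|. The flux G = r
f' m²/(1 + f) is then nondecreasing with G/r integrable, so it vanishes identically, while its
derivative is positive wherever f > 1. -/
theorem f_le_one (h : CoreODE d κ f S) {r : ℝ} (hr : 0 < r) : f r ≤ 1 := by
  set m : ℝ → ℝ := fun x => max (f x - 1) 0 with hm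
  have hm0 : ∀ x, 0 ≤ m x := fun x => le_max_right _ _
  have hmf : ∀ x, 0 < x → m x ≤ f x := fun x hx => max_le (by linarith) (h.f_nonneg x hx)
  set G : ℝ → ℝ := fun x => x * deriv f x * (m x ^ 2 / (1 + f x)) with hG
  have hη : ∀ x, 0 < x → HasDerivAt (fun x => m x ^ 2 / (1 + f x))
      (m x * (2 + 2 * f x - m x) / (1 + f x) ^ 2 * deriv f x) x := fun x hx => by
    have hf1 : 1 + f x ≠ 0 := by linarith [h.f_nonneg x hx]
    have h1 : HasDerivAt (fun x => m x ^ 2) (2 * m x * deriv f x) x :=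
      (hasDerivAt_max_sq (f x)).comp x (h.deriv_f x hx)
    refine (h1.fun_div ((h.deriv_f x hx).const_add 1) hf1).congr_deriv ?_
    field_simp
  have hGd : ∀ x, 0 < x → HasDerivAt G
      (x * ((d - S x) ^ 2 / x ^ 2 - κ ^ 2 * (1 - f x ^ 2)) * f x * (m x ^ 2 / (1 + f x)) +
        x * deriv f x * (m x * (2 + 2 * f x - m x) / (1 + f x) ^ 2 * deriv f x)) x :=
    fun x hx => (h.deriv_rf' x hx).fun_mul (hη x hx)
  have hA : ∀ x, 0 < x → 0 ≤ x * ((d - S x) ^ 2 / x ^ 2 - κ ^ 2 * (1 - f x ^ 2)) * f x *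
      (m x ^ 2 / (1 + f x)) := fun x hx => by
    have hf := h.f_nonneg x hx
    rcases le_or_gt (f x) 1 with h1 | h1
    · have : m x = 0 := max_eq_right (by linarith)
      rw [this]; simp
    · have : 0 ≤ -(κ ^ 2 * (1 - f x ^ 2)) := by
        have : 0 ≤ κ ^ 2 * (f x ^ 2 - 1) := mul_nonneg (sq_nonneg κ) (by nlinarith)
        linarith
      have : 0 ≤ (d - S x) ^ 2 / x ^ 2 - κ ^ 2 * (1 - f x ^ 2) := by
        have : 0 ≤ (d - S x) ^ 2 / x ^ 2 := by positivity
        linarith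
      positivity
  have hB : ∀ x, 0 < x → 0 ≤ x * deriv f x *
      (m x * (2 + 2 * f x - m x) / (1 + f x) ^ 2 * deriv f x) := fun x hx => by
    have hf := h.f_nonneg x hx
    have h1 : 0 ≤ 2 + 2 * f x - m x := by linarith [hmf x hx]
    have e : x * deriv f x * (m x * (2 + 2 * f x - m x) / (1 + f x) ^ 2 * deriv f x)
      = x * (m x * (2 + 2 * f x - m x) / (1 + f x) ^ 2) * deriv f x ^ 2 := by ring
    rw [e]
    have := hm0 x
    positivity
  have hmono : MonotoneOn G (Ioi 0) := by
    refine monotoneOn_of_deriv_nonneg (convex_Ioi 0)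
      (fun y hy => (hGd y hy).continuousAt.continuousWithinAt)
      (fun y hy => (hGd y (interior_subset hy)).differentiableAt.differentiableWithinAt)
      fun y hy => ?_
    have hy' : (0 : ℝ) < y := interior_subset hy
    rw [(hGd y hy').deriv]
    exact add_nonneg (hA y hy') (hB y hy')
  obtain ⟨δ, hδ, hT⟩ := h.exists_delta
  -- For x ≤ δ use m ≤ f and the control of f/x by the term (d - S)f/x; for x > δ use m ≤ |1 - f²|,
  -- with the factor x/δ ≥ 1 supplying the weight.
  have hGi : IntegrableOn (fun x => G x / x) (Ioi 0) := by
    have hdom : IntegrableOn (fun r => (deriv f r ^ 2 + (2 * ((d - S r) * f r / r) ^ 2) +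
        δ⁻¹ * (deriv f r ^ 2 + (1 - f r ^ 2) ^ 2)) * r) (Ioi 0) :=
      integrable_radial_iff.1 ((h.int_f'.add (h.int_T.const_mul 2)).add
        ((h.int_f'.add h.int_V).const_mul δ⁻¹))
    have hGc0 : ContinuousOn G (Ioi 0) := fun y hy => (hGd y hy).continuousAt.continuousWithinAt
    have hGc : ContinuousOn (fun x => G x / x) (Ioi 0) :=
      hGc0.div continuousOn_id fun x hx => ne_of_gt hx
    refine hdom.mono' (hGc.aestronglyMeasurable measurableSet_Ioi) ?_
    filter_upwards [ae_restrict_mem measurableSet_Ioi] with x hx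
    have hx0 : (0 : ℝ) < x := hx
    have hf := h.f_nonneg x hx0
    have e : G x / x = deriv f x * (m x ^ 2 / (1 + f x)) := by
      simp only [hG]; field_simp
    have hη0 : 0 ≤ m x ^ 2 / (1 + f x) := by positivity
    have hη1 : m x ^ 2 / (1 + f x) ≤ m x := by
      rw [div_le_iff₀ (by positivity)]; nlinarith [hm0 x, hmf x hx0]
    have hmV : m x ^ 2 ≤ (1 - f x ^ 2) ^ 2 := by
      rcases le_or_gt (f x) 1 with h1 | h1
      · have : m x = 0 := max_eq_right (by linarith)
        rw [this, zero_pow two_ne_zero]; exact sq_nonneg _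
      · have : m x = f x - 1 := max_eq_left (by linarith)
        rw [this, ← sq_abs (1 - f x ^ 2)]
        refine pow_le_pow_left₀ (by linarith) ?_ 2
        rw [abs_of_nonpos (by nlinarith)]; nlinarith
    rw [e, Real.norm_eq_abs, abs_mul, abs_of_nonneg hη0]
    have h1 : |deriv f x| * (m x ^ 2 / (1 + f x)) ≤ |deriv f x| * m x :=
      mul_le_mul_of_nonneg_left hη1 (abs_nonneg _)
    refine h1.trans ?_
    have hsq := sq_abs (deriv f x)
    rcases le_or_gt x δ with h2 | h2
    · have hTT := hT x hx0 h2
      have h3 : f x ^ 2 / x ^ 2 ≤ 2 * ((d - S x) * f x / x) ^ 2 := by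
        have e : 2 * ((d - S x) * f x / x) ^ 2 = 2 * (d - S x) ^ 2 * (f x ^ 2 / x ^ 2) := by
          field_simp
        rw [e]
        have : 0 ≤ f x ^ 2 / x ^ 2 := by positivity
        nlinarith
      have h4 : |deriv f x| * f x ≤ (deriv f x ^ 2 + f x ^ 2 / x ^ 2) * x := by
        have e : (deriv f x ^ 2 + f x ^ 2 / x ^ 2) * x - |deriv f x| * f x =
            ((|deriv f x| - f x / x) ^ 2 + |deriv f x| * (f x / x)) * x := by
          rw [← hsq]; field_simp; ring
        have : 0 ≤ ((|deriv f x| - f x / x) ^ 2 + |deriv f x| * (f x / x)) * x := by positivity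
        linarith
      have h5 : 0 ≤ δ⁻¹ * (deriv f x ^ 2 + (1 - f x ^ 2) ^ 2) * x := by positivity
      have h6 := mul_le_mul_of_nonneg_left (hmf x hx0) (abs_nonneg (deriv f x))
      nlinarith
    · have h3 : |deriv f x| * m x ≤ deriv f x ^ 2 + (1 - f x ^ 2) ^ 2 := by
        nlinarith [sq_nonneg (|deriv f x| - m x), mul_nonneg (abs_nonneg (deriv f x)) (hm0 x)]
      have h4 : deriv f x ^ 2 + (1 - f x ^ 2) ^ 2 ≤
          δ⁻¹ * (deriv f x ^ 2 + (1 - f x ^ 2) ^ 2) * x := by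
        rw [mul_comm δ⁻¹, mul_assoc]
        refine le_mul_of_one_le_right (by positivity) ?_
        rw [inv_mul_eq_div, le_div_iff₀ hδ]; linarith
      have h5 : 0 ≤ (deriv f x ^ 2 + 2 * ((d - S x) * f x / x) ^ 2) * x := by positivity
      nlinarith
  have hG0 : ∀ x, 0 < x → G x = 0 := fun x hx =>
    eq_zero_of_monotoneOn_of_integrableOn hmono hGi hx
  by_contra hcon
  rw [not_le] at hcon
  have hder : HasDerivAt G 0 r := by
    refine (hasDerivAt_const r (0 : ℝ)).congr_of_eventuallyEq ?_
    filter_upwards [Ioi_mem_nhds hr] with x hx using hG0 x hx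
  have hsum := hder.unique (hGd r hr)
  have hmr : 0 < m r := lt_max_of_lt_left (by linarith)
  have hpos : 0 < r * ((d - S r) ^ 2 / r ^ 2 - κ ^ 2 * (1 - f r ^ 2)) * f r *
      (m r ^ 2 / (1 + f r)) := by
    have hf := h.f_pos hr
    have h1 : 0 < -(κ ^ 2 * (1 - f r ^ 2)) := by
      have : 0 < κ ^ 2 * (f r ^ 2 - 1) :=
        mul_pos (by linarith [h.two_le_κ_sq]) (by nlinarith)
      linarith
    have : 0 < (d - S r) ^ 2 / r ^ 2 - κ ^ 2 * (1 - f r ^ 2) := by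
      have : 0 ≤ (d - S r) ^ 2 / r ^ 2 := by positivity
      linarith
    positivity
  linarith [hB r hr]

theorem abs_T_le (h : CoreODE d κ f S) : ∀ᵐ r ∂radialMeasure, |d - S r| ≤ |(d : ℝ)| := by
  filter_upwards [ae_radial_pos] with r hr
  exact sq_le_sq.1 (h.sq_T_le hr)

theorem abs_f_le (h : CoreODE d κ f S) : ∀ᵐ r ∂radialMeasure, |f r| ≤ 1 := by
  filter_upwards [ae_radial_pos] with r hr
  rw [abs_of_nonneg (h.f_nonneg r hr)]
  exact h.f_le_one hr

theorem meas_T (h : CoreODE d κ f S) : AEStronglyMeasurable (fun r => d - S r) radialMeasure :=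
  aestronglyMeasurable_radial (continuousOn_const.sub h.cont_S)

theorem meas_f (h : CoreODE d κ f S) : AEStronglyMeasurable f radialMeasure :=
  aestronglyMeasurable_radial h.cont_f

/-- The derivative of (1 - f²)² is dominated by (1 - f²)² + f'², which is integrable on (1, ∞), so
`HasPrim.tendsto_atTop` applies to (1 - f²)². -/
theorem tendsto_f (h : CoreODE d κ f S) : Tendsto (fun r => 1 - f r ^ 2) atTop (𝓝 0) := by
  have hp : HasPrim (fun r => (1 - f r ^ 2) ^ 2) (fun r => -4 * (1 - f r ^ 2) * f r * deriv f r) := by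
    refine HasPrim.of_hasDerivAt (fun x hx => ?_) ?_
    · refine ((((h.deriv_f x hx).fun_pow 2).const_sub 1).fun_pow 2).congr_deriv ?_
      push_cast; ring
    · exact ((continuousOn_const.mul (continuousOn_const.sub (h.cont_f.pow 2))).mul
        h.cont_f).mul h.cont_f'
  have hdom : IntegrableOn (fun r => 2 * ((1 - f r ^ 2) ^ 2 + deriv f r ^ 2)) (Ioi 1) :=
    (IntegrableOn.of_mul_self (integrable_radial_iff.1 (h.int_V.add h.int_f')) one_pos).const_mul 2
  have h1 : IntegrableOn (fun r => -4 * (1 - f r ^ 2) * f r * deriv f r) (Ioi 1) := by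
    refine hdom.mono' ?_ ?_
    · exact (((continuousOn_const.mul (continuousOn_const.sub (h.cont_f.pow 2))).mul
        h.cont_f).mul h.cont_f' |>.mono (Ioi_subset_Ioi zero_le_one)).aestronglyMeasurable
        measurableSet_Ioi
    · filter_upwards [ae_restrict_mem measurableSet_Ioi] with x hx
      have hx0 : (0 : ℝ) < x := lt_trans one_pos hx
      have hf0 := h.f_nonneg x hx0
      have hf1 := h.f_le_one hx0
      rw [Real.norm_eq_abs, abs_mul, abs_mul, abs_mul, abs_of_nonneg hf0, abs_neg,
        abs_of_pos (four_pos (α := ℝ)), ← sq_abs (1 - f x ^ 2), ← sq_abs (deriv f x)]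
      have h2 : |1 - f x ^ 2| * f x * |deriv f x| ≤ |1 - f x ^ 2| * 1 * |deriv f x| := by gcongr
      nlinarith [sq_nonneg (|1 - f x ^ 2| - |deriv f x|)]
  have h2 : IntegrableOn (fun r => (1 - f r ^ 2) ^ 2 / r) (Ioi 1) := by
    have h3 := IntegrableOn.of_mul_self (integrable_radial_iff.1 h.int_V) one_pos
    refine h3.mono' ?_ ?_
    · refine ContinuousOn.aestronglyMeasurable (((continuousOn_const.sub (h.cont_f.pow 2)).pow 2
        |>.mono (Ioi_subset_Ioi zero_le_one)).div continuousOn_id fun x hx => ?_) measurableSet_Ioi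
      have : (1 : ℝ) < x := hx
      linarith
    · filter_upwards [ae_restrict_mem measurableSet_Ioi] with x hx
      have hx1 : (1 : ℝ) < x := hx
      rw [Real.norm_of_nonneg (by positivity)]
      exact div_le_self (sq_nonneg _) hx1.le
  have h3 := hp.tendsto_atTop one_pos h1 h2
  have h4 := h3.sqrt
  simp only [Real.sqrt_sq_eq_abs, Real.sqrt_zero] at h4
  exact (tendsto_zero_iff_abs_tendsto_zero _).2 h4

theorem V_nonneg (h : CoreODE d κ f S) {r : ℝ} (hr : 0 < r) : 0 ≤ 1 - f r ^ 2 := by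
  nlinarith [h.f_nonneg r hr, h.f_le_one hr]

/-- If f were identically 1, the term T²f²/r² would behave like 1/r² near 0, and its integral
against r dr would diverge logarithmically. -/
theorem exists_f_lt_one (h : CoreODE d κ f S) : ∃ r, 0 < r ∧ f r < 1 := by
  by_contra! hcon
  have hf : ∀ r, 0 < r → f r = 1 := fun r hr => le_antisymm (h.f_le_one hr) (hcon r hr)
  obtain ⟨δ, hδ, hT⟩ := h.exists_delta
  refine not_integrableOn_of_inv_le (c := 1 / 2) measurableSet_Ioc (by norm_num) ?_
    (not_integrableOn_Ioc_zero_inv hδ)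
    ((integrable_radial_iff.1 h.int_T).mono_set Ioc_subset_Ioi_self)
  intro x hx
  have hx0 : 0 < x := hx.1
  have h1 := hT x hx0 hx.2
  rw [hf x hx0, abs_of_pos (inv_pos.2 hx0), abs_of_nonneg (by positivity)]
  have e : ((d - S x) * 1 / x) ^ 2 * x = (d - S x) ^ 2 * x⁻¹ := by field_simp
  rw [e]
  exact mul_le_mul_of_nonneg_right h1 (by positivity)

end CoreODE

/-! ### Bifurcation from a simple eigenvalue -/

theorem hasFDerivAt_zero_of_homogeneous {E G : Type*} [NormedAddCommGroup E]
    [NormedSpace ℝ E] [NormedAddCommGroup G] [NormedSpace ℝ G] {R : E → G} (hR : ContDiff ℝ ∞ R) (n : ℕ)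
    (hn : 2 ≤ n) (hom : ∀ (s : ℝ) (y : E), R (s • y) = s ^ n • R y) :
    HasFDerivAt R (0 : E →L[ℝ] G) 0 := by
  have h1 := (hR.differentiable (by simp) 0).hasFDerivAt
  have h2 : fderiv ℝ R 0 = 0 := by
    ext y
    have h3 : HasDerivAt (fun t : ℝ => R ((0 : E) + t • y)) (fderiv ℝ R 0 y) 0 :=
      h1.hasLineDerivAt y
    have h4 : HasDerivAt (fun t : ℝ => t ^ n • R y) ((n * (0 : ℝ) ^ (n - 1)) • R y) 0 :=
      (hasDerivAt_pow n (0 : ℝ)).smul_const (R y)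
    simp only [zero_add, hom] at h3
    rw [h3.unique h4, zero_pow (by omega)]
    simp
  rwa [h2] at h1

section Bifurcation

variable {E G : Type*} [NormedAddCommGroup E] [NormedSpace ℝ E] [CompleteSpace E]
  [NormedAddCommGroup G] [NormedSpace ℝ G] [CompleteSpace G]

set_option maxHeartbeats 1000000 in
/-- Bifurcation from a simple eigenvalue for `F(y, g) = L₀ y + g L₁ y + R₂ y + R₃ y`, with `R₂`,
`R₃` homogeneous of degree two and three. -/
theorem exists_bifurcation_curve (L₀ L₁ : E →L[ℝ] G) {R₂ R₃ : E → G} (hR₂ : ContDiff ℝ ∞ R₂)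
    (hR₃ : ContDiff ℝ ∞ R₃) (hom₂ : ∀ (s : ℝ) (y : E), R₂ (s • y) = s ^ 2 • R₂ y)
    (hom₃ : ∀ (s : ℝ) (y : E), R₃ (s • y) = s ^ 3 • R₃ y) (g₀ : ℝ) {w₀ : E} (hw₀ : w₀ ≠ 0)
    (hker : (L₀ + g₀ • L₁).ker = Submodule.span ℝ {w₀})
    (htrans : L₁ w₀ ∉ (L₀ + g₀ • L₁).range)
    (hsurj : ∀ y : G, ∃ (t : ℝ) (x : E), y = t • L₁ w₀ + (L₀ + g₀ • L₁) x)
    {N : Set E} (hN : N ∈ 𝓝 0) {Z : Submodule ℝ E} (hZ : IsClosed (Z : Set E))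
    (hcompl : IsCompl (L₀ + g₀ • L₁).ker Z) :
    ∃ (U : Set (E × ℝ)) (a : ℝ) (γ : ℝ → ℝ) (ψ : ℝ → E),
      IsOpen U ∧ ((0 : E), g₀) ∈ U ∧ 0 < a ∧ ContDiffOn ℝ 1 γ (Ioo (-a) a) ∧
      ContDiffOn ℝ 1 ψ (Ioo (-a) a) ∧ γ 0 = g₀ ∧ ψ 0 = 0 ∧ (∀ s ∈ Ioo (-a) a, ψ s ∈ Z) ∧
      (∀ s ∈ Ioo (-a) a, ψ s ∈ N) ∧
      {p : E × ℝ | p ∈ U ∧ p.1 ≠ 0 ∧ L₀ p.1 + p.2 • L₁ p.1 + R₂ p.1 + R₃ p.1 = 0} =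
        (fun s : ℝ => (s • (w₀ + ψ s), γ s)) '' (Ioo (-a) a \ {0}) := by
  have : CompleteSpace Z := hZ.completeSpace_coe
  set L := L₀ + g₀ • L₁ with hL
  have hLw : L w₀ = 0 := by
    have : w₀ ∈ L.ker := by rw [hker]; exact Submodule.mem_span_singleton_self w₀
    exact this
  -- the splitting `E = ℝ w₀ ⊕ Z`
  set Φ : ℝ × Z →L[ℝ] E := (ContinuousLinearMap.toSpanSingleton ℝ w₀).coprod Z.subtypeL with hΦ
  have hΦa : ∀ s z, Φ (s, z) = s • w₀ + z := fun s z => by simp [hΦ]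
  have hΦbij : Function.Bijective Φ := by
    constructor
    · rw [injective_iff_map_eq_zero]
      rintro ⟨s, z⟩ h0
      rw [hΦa] at h0
      have hz : (z : E) ∈ L.ker := by
        rw [hker, eq_neg_of_add_eq_zero_right h0, ← neg_smul]
        exact Submodule.smul_mem _ _ (Submodule.mem_span_singleton_self w₀)
      have hz0 : (z : E) = 0 := Submodule.disjoint_def.1 hcompl.disjoint _ hz z.2
      rw [hz0, add_zero, smul_eq_zero] at h0
      exact Prod.ext (h0.resolve_right hw₀) (Subtype.ext hz0)
    · intro y
      have hy : y ∈ L.ker ⊔ Z := by rw [hcompl.sup_eq_top]; trivial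
      obtain ⟨k, hk, z, hz, rfl⟩ := Submodule.mem_sup.1 hy
      rw [hker, Submodule.mem_span_singleton] at hk
      obtain ⟨s, rfl⟩ := hk
      exact ⟨(s, ⟨z, hz⟩), hΦa _ _⟩
  set e : (ℝ × Z) ≃L[ℝ] E := ContinuousLinearEquiv.ofBijective Φ
    (LinearMap.ker_eq_bot.2 hΦbij.1) (LinearMap.range_eq_top.2 hΦbij.2) with he
  have hea : ∀ s z, e (s, z) = s • w₀ + z := fun s z => hΦa s z
  set σ : E →L[ℝ] ℝ := (ContinuousLinearMap.fst ℝ ℝ Z) ∘L (e.symm : E →L[ℝ] ℝ × Z) with hσ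
  have hσa : ∀ s (z : Z), σ (s • w₀ + z) = s := fun s z => by
    rw [← hea]; simp [hσ]
  have hdec : ∀ y, ∃ z : Z, y = σ y • w₀ + z := fun y => by
    refine ⟨(e.symm y).2, ?_⟩
    have h1 := e.apply_symm_apply y
    conv_lhs => rw [← h1]
    exact hea _ _
  -- the linearization of the reduced equation
  set T₀ : ℝ × Z →L[ℝ] G :=
    (ContinuousLinearMap.toSpanSingleton ℝ (L₁ w₀)).coprod (L ∘L Z.subtypeL) with hT₀
  have hT₀a : ∀ t z, T₀ (t, z) = t • L₁ w₀ + L z := fun t z => by simp [hT₀]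
  have hT₀bij : Function.Bijective T₀ := by
    constructor
    · rw [injective_iff_map_eq_zero]
      rintro ⟨t, z⟩ h0
      rw [hT₀a] at h0
      have ht : t = 0 := by
        by_contra ht
        refine htrans ⟨-(t⁻¹ • (z : E)), ?_⟩
        have h1 : L (z : E) = -(t • L₁ w₀) := eq_neg_of_add_eq_zero_right h0
        change L (-(t⁻¹ • (z : E))) = L₁ w₀
        rw [map_neg, map_smul, h1, smul_neg, neg_neg, smul_smul, inv_mul_cancel₀ ht, one_smul]
      rw [ht, zero_smul, zero_add] at h0
      have hz0 : (z : E) = 0 := Submodule.disjoint_def.1 hcompl.disjoint _ h0 z.2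
      exact Prod.ext ht (Subtype.ext hz0)
    · intro y
      obtain ⟨t, x, rfl⟩ := hsurj y
      obtain ⟨z, hz⟩ := hdec x
      refine ⟨(t, z), ?_⟩
      rw [hT₀a, hz, map_add, map_smul, hLw, smul_zero, zero_add]
  set T : (ℝ × Z) ≃L[ℝ] G := ContinuousLinearEquiv.ofBijective T₀
    (LinearMap.ker_eq_bot.2 hT₀bij.1) (LinearMap.range_eq_top.2 hT₀bij.2) with hT
  have hTa : ∀ t z, T (t, z) = t • L₁ w₀ + L z := fun t z => hT₀a t z
  -- the reduced equation
  set Q : ℝ × (ℝ × Z) → G := fun v => L₀ (w₀ + v.2.2) + v.2.1 • L₁ (w₀ + v.2.2) +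
    v.1 • R₂ (w₀ + v.2.2) + v.1 ^ 2 • R₃ (w₀ + v.2.2) with hQ
  have hQs : ContDiff ℝ ∞ Q := by
    have h0 : ContDiff ℝ ∞ fun v : ℝ × (ℝ × Z) => w₀ + (v.2.2 : E) :=
      contDiff_const.add (Z.subtypeL.contDiff.comp (contDiff_snd.comp contDiff_snd))
    have h21 : ContDiff ℝ ∞ fun v : ℝ × (ℝ × Z) => v.2.1 := contDiff_fst.comp contDiff_snd
    exact (((L₀.contDiff.comp h0).add (h21.smul (L₁.contDiff.comp h0))).add
      (contDiff_fst.smul (hR₂.comp h0))).add ((contDiff_fst.pow 2).smul (hR₃.comp h0))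
  -- Homogeneity lets one factor s come out of the equation explicitly, so the reduced map Q is
  -- visibly smooth across s = 0.
  have hQF : ∀ (s g : ℝ) (z : Z), L₀ (s • (w₀ + z)) + g • L₁ (s • (w₀ + z)) + R₂ (s • (w₀ + z))
      + R₃ (s • (w₀ + z)) = s • Q (s, (g, z)) := fun s g z => by
    rw [hom₂, hom₃, map_smul, map_smul]
    simp only [hQ, smul_add (M := ℝ), smul_smul]
    rw [mul_comm g s, show s ^ 3 = s * s ^ 2 by ring, sq]
  set u : ℝ × (ℝ × Z) := (0, (g₀, 0)) with hu
  have hQu : Q u = 0 := by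
    have : L₀ w₀ + g₀ • L₁ w₀ = 0 := hLw
    simp [hQ, hu, this]
  have hQat : ContDiffAt ℝ ∞ Q u := hQs.contDiffAt
  -- At s = 0 the remainders drop out. The derivative in g is L₁w₀ and the derivative in z is L
  -- restricted to Z; together they form the isomorphism T.
  have hfd : fderiv ℝ Q u ∘L ContinuousLinearMap.inr ℝ ℝ (ℝ × Z) = (T : (ℝ × Z) →L[ℝ] G) := by
    have h1 : HasFDerivAt (fun q : ℝ × Z => Q ((0 : ℝ), q))
        (fderiv ℝ Q u ∘L ContinuousLinearMap.inr ℝ ℝ (ℝ × Z)) (g₀, 0) := by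
      have h2 : HasFDerivAt (fun q : ℝ × Z => ((0 : ℝ), q))
          (ContinuousLinearMap.inr ℝ ℝ (ℝ × Z)) (g₀, 0) :=
        (ContinuousLinearMap.inr ℝ ℝ (ℝ × Z)).hasFDerivAt
      exact HasFDerivAt.comp (g := Q) (g₀, (0 : Z))
        ((hQs.differentiable (by simp) u).hasFDerivAt) h2
    have h3 : HasFDerivAt (fun q : ℝ × Z => Q ((0 : ℝ), q)) (T : (ℝ × Z) →L[ℝ] G) (g₀, 0) := by
      have e1 : (fun q : ℝ × Z => Q ((0 : ℝ), q)) =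
          fun q => L₀ (w₀ + q.2) + q.1 • L₁ (w₀ + q.2) := by
        funext q; simp [hQ]
      rw [e1]
      have hs : HasFDerivAt (fun q : ℝ × Z => w₀ + (q.2 : E))
          (Z.subtypeL ∘L ContinuousLinearMap.snd ℝ ℝ Z) (g₀, 0) :=
        (Z.subtypeL ∘L ContinuousLinearMap.snd ℝ ℝ Z).hasFDerivAt.const_add w₀
      have hfst : HasFDerivAt (fun q : ℝ × Z => q.1) (ContinuousLinearMap.fst ℝ ℝ Z) (g₀, 0) :=
        hasFDerivAt_fst
      have h4 := (L₀.hasFDerivAt.comp _ hs).add (hfst.smul (L₁.hasFDerivAt.comp _ hs))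
      refine h4.congr_fderiv ?_
      ext q
      · simp [hTa]
      · simp [hTa, hL]
    exact h1.unique h3
  have hinv : (fderiv ℝ Q u ∘L ContinuousLinearMap.inr ℝ ℝ (ℝ × Z)).IsInvertible := by
    rw [hfd]; exact ContinuousLinearMap.isInvertible_equiv
  set Ψ : ℝ → ℝ × Z := hQat.implicitFunction (by simp) hinv with hΨ
  have hΨ0 : Ψ 0 = (g₀, 0) := hQat.implicitFunction_apply_self (by simp) hinv
  have hΨs : ContDiffAt ℝ 1 Ψ 0 :=
    (hQat.contDiffAt_implicitFunction (by simp) hinv).of_le (by simp)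
  have hΨiff : ∀ᶠ v in 𝓝 u, Q v = 0 ↔ Ψ v.1 = v.2 := by
    have := hQat.eventually_apply_eq_iff_implicitFunction (by simp) hinv
    rwa [hQu] at this
  obtain ⟨ε, hε, hεs⟩ := Metric.eventually_nhds_iff.1 hΨiff
  -- bounds
  set C : ℝ := ‖(T.symm : G →L[ℝ] ℝ × Z)‖ with hC
  -- Since T(0, z) = Lz, the inverse of T bounds L from below on the complement Z.
  have hlow : ∀ z : Z, ‖(z : E)‖ ≤ C * ‖L z‖ := fun z => by
    have h1 := (T.symm : G →L[ℝ] ℝ × Z).le_opNorm (L z)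
    have h2 : (T.symm : G →L[ℝ] ℝ × Z) (L z) = (0, z) := by
      rw [ContinuousLinearEquiv.coe_coe, ContinuousLinearEquiv.symm_apply_eq, hTa]; simp
    rw [h2] at h1
    exact (norm_snd_le ((0 : ℝ), z)).trans h1
  have hC0 : 0 ≤ C := by rw [hC]; exact ContinuousLinearMap.opNorm_nonneg _
  -- θ ≤ 1/2 allows the Z-component to be absorbed below; 2θ‖w₀‖ < ε places the rescaled component
  -- in the uniqueness ball of the implicit function theorem.
  set θ : ℝ := min (1 / 2) (ε / (4 * (‖w₀‖ + 1))) with hθ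
  have hθ0 : 0 < θ := lt_min (by norm_num) (by positivity)
  have hθ1 : θ ≤ 1 / 2 := min_le_left _ _
  have hθ2 : 2 * θ * ‖w₀‖ < ε := by
    have h1 : θ ≤ ε / (4 * (‖w₀‖ + 1)) := min_le_right _ _
    rw [le_div_iff₀ (by positivity)] at h1
    linarith [mul_nonneg hθ0.le (norm_nonneg w₀)]
  -- Chosen so that C · 2η ≤ θ, one η for the remainders and one for the variation of g.
  set η : ℝ := θ / (2 * (C + 1)) with hη
  have hη0 : 0 < η := by positivity
  have hR : ∀ᶠ y in 𝓝 (0 : E), ‖R₂ y + R₃ y‖ ≤ η * ‖y‖ := by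
    have h1 := (hasFDerivAt_zero_of_homogeneous hR₂ 2 le_rfl hom₂).add
      (hasFDerivAt_zero_of_homogeneous hR₃ 3 (by norm_num) hom₃)
    have h2 := h1.isLittleO.bound hη0
    have h20 : R₂ 0 = 0 := by simpa using hom₂ 0 0
    have h30 : R₃ 0 = 0 := by simpa using hom₃ 0 0
    simpa [h20, h30] using h2
  obtain ⟨ρ, hρ, hρs⟩ := Metric.eventually_nhds_iff.1 hR
  set ρ' : ℝ := min ε (η / (‖L₁‖ + 1)) with hρ'
  have hρ'0 : 0 < ρ' := lt_min hε (by positivity)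
  -- The curve must contain every small nontrivial zero. The equation bounds the Z-component ζ of y
  -- by θ‖y‖, so zeros lie in a narrow cone around w₀. Hence σ y ≠ 0 and z = ζ/σ y is small, which
  -- is what uniqueness for Q = 0 requires.
  have hmain : ∀ (y : E) (g : ℝ), ‖y‖ < ρ → |g - g₀| < ρ' → y ≠ 0 →
      L₀ y + g • L₁ y + R₂ y + R₃ y = 0 → ∃ z : Z, σ y ≠ 0 ∧ ‖(z : E)‖ < ε ∧
        y = σ y • (w₀ + z) := by
    intro y g hy hg hy0 hF
    obtain ⟨ζ, hζ⟩ := hdec y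
    set s := σ y with hs
    have h1 : L ζ = -((g - g₀) • L₁ y + (R₂ y + R₃ y)) := by
      have h2 : L y = L ζ := by
        conv_lhs => rw [hζ]
        rw [map_add, map_smul, hLw, smul_zero, zero_add]
      have h3 : L y = L₀ y + g₀ • L₁ y := by simp [hL]
      rw [← h2, h3, eq_neg_iff_add_eq_zero, ← hF, sub_smul]
      abel
    have h2 : ‖L ζ‖ ≤ 2 * η * ‖y‖ := by
      rw [h1, norm_neg]
      refine (norm_add_le _ _).trans ?_
      have h3 := hρs (y := y) (by simpa using hy)
      have h4 : ‖(g - g₀) • L₁ y‖ ≤ η * ‖y‖ := by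
        rw [norm_smul, Real.norm_eq_abs]
        have h5 : |g - g₀| ≤ η / (‖L₁‖ + 1) := (hg.trans_le (min_le_right _ _)).le
        rw [le_div_iff₀ (by positivity)] at h5
        have h6 := L₁.le_opNorm y
        have h7 : |g - g₀| * ‖L₁ y‖ ≤ |g - g₀| * (‖L₁‖ * ‖y‖) :=
          mul_le_mul_of_nonneg_left h6 (abs_nonneg _)
        have h8 := mul_le_mul_of_nonneg_right h5 (norm_nonneg y)
        have h9 : |g - g₀| * (‖L₁‖ * ‖y‖) = |g - g₀| * (‖L₁‖ + 1) * ‖y‖ - |g - g₀| * ‖y‖ := by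
          ring
        linarith [mul_nonneg (abs_nonneg (g - g₀)) (norm_nonneg y)]
      linarith
    have h3 : ‖(ζ : E)‖ ≤ θ * ‖y‖ := by
      refine (hlow ζ).trans ((mul_le_mul_of_nonneg_left h2 hC0).trans ?_)
      have : C * (2 * η) ≤ θ := by
        have e1 : θ = 2 * (C + 1) * η := by rw [hη]; field_simp
        linarith
      linarith [mul_le_mul_of_nonneg_right this (norm_nonneg y)]
    have h4 : ‖y‖ ≤ |s| * ‖w₀‖ + ‖(ζ : E)‖ := by
      conv_lhs => rw [hζ]
      refine (norm_add_le _ _).trans ?_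
      rw [norm_smul, Real.norm_eq_abs]
    have h5 : ‖(ζ : E)‖ ≤ 2 * θ * (|s| * ‖w₀‖) := by
      have : θ * ‖y‖ ≤ θ * (|s| * ‖w₀‖) + 1 / 2 * ‖(ζ : E)‖ := by
        linarith [mul_le_mul_of_nonneg_left h4 hθ0.le,
          mul_le_mul_of_nonneg_right hθ1 (norm_nonneg (ζ : E))]
      linarith
    have hs0 : s ≠ 0 := by
      intro hs0
      rw [hs0, abs_zero, zero_mul, mul_zero] at h5
      have hζ0 : (ζ : E) = 0 := norm_le_zero_iff.1 h5
      exact hy0 (by rw [hζ, hs0, hζ0]; simp)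
    have hsp : 0 < |s| := abs_pos.2 hs0
    refine ⟨s⁻¹ • ζ, hs0, ?_, ?_⟩
    · rw [Submodule.coe_smul, norm_smul, norm_inv, Real.norm_eq_abs, inv_mul_eq_div,
        div_lt_iff₀ hsp]
      linarith [mul_lt_mul_of_pos_right hθ2 hsp]
    · rw [Submodule.coe_smul, smul_add, smul_smul, mul_inv_cancel₀ hs0, one_smul, ← hζ]
  -- the size of the curve
  have hcont : ContinuousAt Ψ 0 := hΨs.continuousAt
  have hev1 : ∀ᶠ s in 𝓝 (0 : ℝ), ContDiffAt ℝ 1 Ψ s := hΨs.eventually (by simp)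
  have hev2 : ∀ᶠ s in 𝓝 (0 : ℝ), dist (Ψ s) (g₀, 0) < ρ' := by
    have := hcont.tendsto
    rw [hΨ0] at this
    exact Metric.tendsto_nhds.1 this ρ' hρ'0
  -- The neighbourhood N lets the caller impose an open condition along the whole curve.
  have hev3 : ∀ᶠ s in 𝓝 (0 : ℝ), ((Ψ s).2 : E) ∈ N := by
    have h1 : ContinuousAt (fun s => ((Ψ s).2 : E)) 0 :=
      (Z.subtypeL.continuous.comp continuous_snd).continuousAt.comp hcont
    have h2 := h1.tendsto
    simp only [hΨ0, ZeroMemClass.coe_zero] at h2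
    exact h2 hN
  have hev4 : ∀ᶠ s in 𝓝 (0 : ℝ), ‖s • (w₀ + ((Ψ s).2 : E))‖ < ρ := by
    have h1 : ContinuousAt (fun s => ‖s • (w₀ + ((Ψ s).2 : E))‖) 0 :=
      (continuousAt_id.smul (continuousAt_const.add
        ((Z.subtypeL.continuous.comp continuous_snd).continuousAt.comp hcont))).norm
    have h2 := h1.tendsto
    simp only [zero_smul, norm_zero] at h2
    exact h2.eventually_lt_const hρ
  obtain ⟨a₀, ha₀, ha₀s⟩ := Metric.eventually_nhds_iff.1
    (hev1.and (hev2.and (hev3.and hev4)))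
  set a := min a₀ ε with ha
  have ha0 : 0 < a := lt_min ha₀ hε
  have hin : ∀ s ∈ Ioo (-a) a, |s| < a := fun s hs => abs_lt.2 hs
  have hprop : ∀ s, |s| < a → ContDiffAt ℝ 1 Ψ s ∧ dist (Ψ s) (g₀, 0) < ρ' ∧
      ((Ψ s).2 : E) ∈ N ∧ ‖s • (w₀ + ((Ψ s).2 : E))‖ < ρ := fun s hs =>
    ha₀s (by rw [Real.dist_eq, sub_zero]; exact hs.trans_le (min_le_left _ _))
  have hsolve : ∀ s, |s| < a → Q (s, Ψ s) = 0 := fun s hs => by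
    refine (hεs ?_).2 rfl
    rw [hu, Prod.dist_eq, max_lt_iff]
    refine ⟨by rw [Real.dist_eq, sub_zero]; exact hs.trans_le (min_le_right _ _), ?_⟩
    exact (hprop s hs).2.1.trans_le (min_le_left _ _)
  refine ⟨{p | |σ p.1| < a ∧ ‖p.1‖ < ρ ∧ |p.2 - g₀| < ρ'}, a, fun s => (Ψ s).1,
    fun s => ((Ψ s).2 : E), ?_, ?_, ha0, ?_, ?_, ?_, ?_, fun s _ => (Ψ s).2.2, ?_, ?_⟩
  · refine IsOpen.and ?_ (IsOpen.and ?_ ?_)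
    · exact isOpen_lt (by fun_prop) continuous_const
    · exact isOpen_lt (by fun_prop) continuous_const
    · exact isOpen_lt (by fun_prop) continuous_const
  · simp [ha0, hρ, hρ'0]
  · exact fun s hs => (hprop s (hin s hs)).1.fst.contDiffWithinAt
  · exact fun s hs => (Z.subtypeL.contDiff.contDiffAt.comp s
      (hprop s (hin s hs)).1.snd).contDiffWithinAt
  · simp [hΨ0]
  · simp [hΨ0]
  · exact fun s hs => (hprop s (hin s hs)).2.2.1
  · ext ⟨y, g⟩
    simp only [mem_ofPred_eq, mem_image, Set.mem_sdiff, mem_singleton_iff, Prod.mk.injEq]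
    constructor
    · rintro ⟨⟨h1, h2, h3⟩, h4, h5⟩
      obtain ⟨z, hs0, hz, hy⟩ := hmain y g h2 h3 h4 h5
      set s := σ y with hs
      have hQz : Q (s, (g, z)) = 0 := by
        rw [hy, hQF] at h5
        exact (smul_eq_zero.1 h5).resolve_left hs0
      have hΨz : Ψ s = (g, z) := by
        refine (hεs (y := (s, (g, z))) ?_).1 hQz
        rw [hu, Prod.dist_eq, max_lt_iff, Prod.dist_eq, max_lt_iff]
        refine ⟨by rw [Real.dist_eq, sub_zero]; exact h1.trans_le (min_le_right _ _), ?_, ?_⟩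
        · rw [Real.dist_eq]; exact h3.trans_le (min_le_left _ _)
        · rw [dist_zero_right]; exact hz
      refine ⟨s, ⟨abs_lt.1 h1, hs0⟩, ?_, ?_⟩
      · rw [hΨz]; exact hy.symm
      · rw [hΨz]
    · rintro ⟨s, ⟨hs, hs0⟩, rfl, rfl⟩
      have hsa := hin s hs
      obtain ⟨-, p2, -, p4⟩ := hprop s hsa
      have hσs : σ (s • (w₀ + ((Ψ s).2 : E))) = s := by
        rw [smul_add, ← Submodule.coe_smul, hσa]
      refine ⟨⟨by rwa [hσs], p4, ?_⟩, ?_, ?_⟩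
      · rw [Prod.dist_eq, max_lt_iff, Real.dist_eq] at p2
        exact p2.1
      · intro h0
        rw [h0, map_zero] at hσs
        exact hs0 hσs.symm
      · rw [hQF, Prod.mk.eta, hsolve s hsa, smul_zero]

end Bifurcation

noncomputable section

/-! ### Polynomial energies -/

section Poly

variable {E F : Type*} [NormedAddCommGroup E] [NormedSpace ℝ E] [NormedAddCommGroup F]
  [InnerProductSpace ℝ F]

variable (F) in
/-- The real inner product as a continuous bilinear map. -/
def innerL : F →L[ℝ] F →L[ℝ] ℝ :=
  (isBoundedBilinearMap_inner (𝕜 := ℝ) (E := F)).toContinuousLinearMap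

@[simp]
theorem innerL_apply (x y : F) : innerL F x y = inner ℝ x y := rfl

/-- The part of degree one in `y` of the derivative of `½ ‖a + A y + B y y‖²`. -/
def linPart (a : F) (A : E →L[ℝ] F) (B : E →L[ℝ] E →L[ℝ] F) : E →L[ℝ] E →L[ℝ] ℝ :=
  ((ContinuousLinearMap.compL ℝ E F ℝ).flip A) ∘L (innerL F) ∘L A +
    (ContinuousLinearMap.compL ℝ E F ℝ (innerL F a)) ∘L (B + B.flip)

theorem linPart_apply (a : F) (A : E →L[ℝ] F) (B : E →L[ℝ] E →L[ℝ] F) (y z : E) :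
    linPart a A B y z = inner ℝ (A y) (A z) + inner ℝ a (B y z + B z y) := rfl

/-- The part of degree two in `y` of the derivative of `½ ‖a + A y + B y y‖²`. -/
def quadPart (A : E →L[ℝ] F) (B : E →L[ℝ] E →L[ℝ] F) (y : E) : E →L[ℝ] ℝ :=
  (innerL F (B y y)) ∘L A + (innerL F (A y)) ∘L (B y + B.flip y)

/-- The part of degree three in `y` of the derivative of `½ ‖a + A y + B y y‖²`. -/
def cubPart (B : E →L[ℝ] E →L[ℝ] F) (y : E) : E →L[ℝ] ℝ :=
  (innerL F (B y y)) ∘L (B y + B.flip y)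

theorem contDiff_quadPart (A : E →L[ℝ] F) (B : E →L[ℝ] E →L[ℝ] F) :
    ContDiff ℝ ∞ (quadPart A B) := by
  have hB : ContDiff ℝ ∞ fun y => B y y := B.contDiff.clm_apply contDiff_id
  exact (((innerL F).contDiff.comp hB).clm_comp contDiff_const).add
    (((innerL F).contDiff.comp A.contDiff).clm_comp (B.contDiff.add B.flip.contDiff))

theorem contDiff_cubPart (B : E →L[ℝ] E →L[ℝ] F) : ContDiff ℝ ∞ (cubPart B) := by
  have hB : ContDiff ℝ ∞ fun y => B y y := B.contDiff.clm_apply contDiff_id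
  exact ((innerL F).contDiff.comp hB).clm_comp (B.contDiff.add B.flip.contDiff)

theorem quadPart_smul (A : E →L[ℝ] F) (B : E →L[ℝ] E →L[ℝ] F) (s : ℝ) (y : E) :
    quadPart A B (s • y) = s ^ 2 • quadPart A B y := by
  ext z
  simp [quadPart]
  ring

theorem cubPart_smul (B : E →L[ℝ] E →L[ℝ] F) (s : ℝ) (y : E) :
    cubPart B (s • y) = s ^ 3 • cubPart B y := by
  ext z
  simp only [cubPart, map_smul, _root_.smul_apply, _root_.add_apply,
    ContinuousLinearMap.comp_apply, innerL_apply, inner_smul_right,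
    inner_add_right, smul_eq_mul]
  ring

/-- The derivative is graded by degree in y, as the rescaling y = s(w₀ + z) of the bifurcation
argument requires. -/
theorem hasFDerivAt_halfSq (a : F) (A : E →L[ℝ] F) (B : E →L[ℝ] E →L[ℝ] F) (y : E) :
    HasFDerivAt (fun y => 1 / 2 * ‖a + A y + B y y‖ ^ 2)
      ((innerL F a) ∘L A + linPart a A B y + quadPart A B y + cubPart B y) y := by
  have hB : HasFDerivAt (fun y => B y y) (B y + B.flip y) y := by
    refine (B.hasFDerivAt.clm_apply (hasFDerivAt_id y)).congr_fderiv ?_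
    ext z
    simp
  have hN := (A.hasFDerivAt (x := y).const_add a).add hB
  refine ((hN.norm_sq).const_mul (1 / 2)).congr_fderiv ?_
  ext z
  simp [linPart_apply, quadPart, cubPart, inner_add_right]
  ring

variable {ι : Type*} [Fintype ι]

/-- A polynomial energy of degree four. -/
def polyEnergy (c : ι → ℝ) (a : ι → F) (A : ι → E →L[ℝ] F) (B : ι → E →L[ℝ] E →L[ℝ] F) (k : ℝ)
    (K : E →L[ℝ] F) (y : E) (g : ℝ) : ℝ :=
  ∑ i, c i * (1 / 2 * ‖a i + A i y + B i y y‖ ^ 2) + k * g * (1 / 2 * ‖K y‖ ^ 2)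

theorem contDiff_polyEnergy (c : ι → ℝ) (a : ι → F) (A : ι → E →L[ℝ] F)
    (B : ι → E →L[ℝ] E →L[ℝ] F) (k : ℝ) (K : E →L[ℝ] F) :
    ContDiff ℝ ∞ fun p : E × ℝ => polyEnergy c a A B k K p.1 p.2 := by
  refine ContDiff.add (ContDiff.sum fun i _ => ?_) ?_
  · refine contDiff_const.mul (contDiff_const.mul (ContDiff.norm_sq ℝ ?_))
    exact (contDiff_const.add ((A i).contDiff.comp contDiff_fst)).add
      (((B i).contDiff.comp contDiff_fst).clm_apply contDiff_fst)
  · exact (contDiff_const.mul contDiff_snd).mul (contDiff_const.mul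
      (ContDiff.norm_sq ℝ (K.contDiff.comp contDiff_fst)))

theorem fderiv_polyEnergy (c : ι → ℝ) (a : ι → F) (A : ι → E →L[ℝ] F)
    (B : ι → E →L[ℝ] E →L[ℝ] F) (k : ℝ) (K : E →L[ℝ] F) (g : ℝ) (y : E) :
    fderiv ℝ (fun z => polyEnergy c a A B k K z g) y =
      (∑ i, c i • (innerL F (a i)) ∘L (A i)) + (∑ i, c i • linPart (a i) (A i) (B i)) y
      + g • (k • linPart 0 K (0 : E →L[ℝ] E →L[ℝ] F)) y
      + (∑ i, c i • quadPart (A i) (B i) y) + ∑ i, c i • cubPart (B i) y := by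
  have h1 : HasFDerivAt (fun z => polyEnergy c a A B k K z g)
      (∑ i, c i • ((innerL F (a i)) ∘L (A i) + linPart (a i) (A i) (B i) y + quadPart (A i) (B i) y
        + cubPart (B i) y) + (k * g) • ((innerL F 0) ∘L K + linPart 0 K 0 y + quadPart K 0 y
        + cubPart (0 : E →L[ℝ] E →L[ℝ] F) y)) y := by
    refine (HasFDerivAt.fun_sum fun i _ =>
      (hasFDerivAt_halfSq (a i) (A i) (B i) y).const_mul (c i)).add ?_
    have h2 := (hasFDerivAt_halfSq (0 : F) K (0 : E →L[ℝ] E →L[ℝ] F) y).const_mul (k * g)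
    simpa using h2
  rw [h1.fderiv]
  ext z
  simp only [_root_.add_apply, _root_.sum_apply,
    _root_.smul_apply, smul_eq_mul, mul_add, Finset.sum_add_distrib]
  simp [quadPart, cubPart]
  ring

end Poly

/-! ### Coercivity modulo a finite dimensional space -/

/-- If coercivity fails, take unit vectors zₙ with Q(zₙ, zₙ) tending to 0. Along a subsequence l zₙ
converges, the lower bound makes zₙ a Cauchy sequence, and its limit is a unit vector on which Q
vanishes. -/
theorem coercive_of_posDef {E F : Type*} [NormedAddCommGroup E] [NormedSpace ℝ E]
    [CompleteSpace E] [NormedAddCommGroup F] [NormedSpace ℝ F] [FiniteDimensional ℝ F]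
    (Q : E →L[ℝ] E →L[ℝ] ℝ) (hsymm : ∀ x y, Q x y = Q y x) (l : E →L[ℝ] F) {c : ℝ} (hc : 0 < c)
    (hlow : ∀ y, c * ‖y‖ ^ 2 ≤ Q y y + ‖l y‖ ^ 2) (hpos : ∀ y, y ≠ 0 → 0 < Q y y) :
    ∃ c' > 0, ∀ y, c' * ‖y‖ ^ 2 ≤ Q y y := by
  by_contra! hcon
  have hnn : ∀ y, 0 ≤ Q y y := fun y => by
    by_cases h : y = 0
    · simp [h]
    · exact (hpos y h).le
  have hex : ∀ n : ℕ, ∃ z : E, ‖z‖ = 1 ∧ Q z z < 1 / (n + 1 : ℝ) := fun n => by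
    obtain ⟨y, hy⟩ := hcon (1 / (n + 1 : ℝ)) (by positivity)
    have hy0 : y ≠ 0 := by rintro rfl; simp at hy
    have hn : 0 < ‖y‖ := norm_pos_iff.2 hy0
    refine ⟨‖y‖⁻¹ • y, by rw [norm_smul, norm_inv, norm_norm, inv_mul_cancel₀ hn.ne'], ?_⟩
    simp only [map_smul, _root_.smul_apply, smul_eq_mul]
    rw [← mul_assoc, ← mul_inv, ← sq, inv_mul_eq_div, div_lt_iff₀ (by positivity)]
    exact hy
  choose z hz1 hzQ using hex
  have : ProperSpace F := FiniteDimensional.proper ℝ F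
  obtain ⟨x, -, φ, hφ, hlim⟩ := (isCompact_closedBall (0 : F) ‖l‖).tendsto_subseq
    (x := fun n => l (z n)) (fun n => by
      rw [mem_closedBall_zero_iff]
      simpa [hz1 n] using l.le_opNorm (z n))
  have hQlim : Tendsto (fun n => Q (z (φ n)) (z (φ n))) atTop (𝓝 0) := by
    refine squeeze_zero (fun n => hnn _) (fun n => (hzQ (φ n)).le) ?_
    exact tendsto_one_div_add_atTop_nhds_zero_nat.comp hφ.tendsto_atTop
  -- The parallelogram law for Q, with Q(x + y, x + y) ≥ 0 discarded.
  have hest : ∀ m n, c * ‖z (φ m) - z (φ n)‖ ^ 2 ≤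
      2 * Q (z (φ m)) (z (φ m)) + 2 * Q (z (φ n)) (z (φ n)) + ‖l (z (φ m)) - l (z (φ n))‖ ^ 2 := by
    intro m n
    have h1 := hlow (z (φ m) - z (φ n))
    have h2 := hnn (z (φ m) + z (φ n))
    have h3 := hsymm (z (φ m)) (z (φ n))
    simp only [map_sub, map_add, _root_.sub_apply,
      _root_.add_apply] at h1 h2
    linarith
  have hcauchy : CauchySeq fun n => z (φ n) := by
    rw [Metric.cauchySeq_iff]
    intro ε hε
    have hlc := Metric.cauchySeq_iff.1 hlim.cauchySeq (Real.sqrt (c * ε ^ 2 / 2))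
      (Real.sqrt_pos.2 (by positivity))
    obtain ⟨N₁, hN₁⟩ := hlc
    obtain ⟨N₂, hN₂⟩ := (hQlim.eventually_lt_const
      (show (0 : ℝ) < c * ε ^ 2 / 8 by positivity)).exists_forall_of_atTop
    refine ⟨max N₁ N₂, fun m hm n hn => ?_⟩
    have h1 := hN₁ m ((le_max_left _ _).trans hm) n ((le_max_left _ _).trans hn)
    have h2 := hN₂ m ((le_max_right _ _).trans hm)
    have h3 := hN₂ n ((le_max_right _ _).trans hn)
    have h4 := hest m n
    simp only [Function.comp, dist_eq_norm] at h1
    have h5 := (Real.lt_sqrt (norm_nonneg _)).1 h1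
    rw [dist_eq_norm]
    have h6 : c * ‖z (φ m) - z (φ n)‖ ^ 2 < c * ε ^ 2 := by linarith
    exact lt_of_pow_lt_pow_left₀ 2 hε.le (lt_of_mul_lt_mul_left h6 hc.le)
  obtain ⟨y, hy⟩ := cauchySeq_tendsto_of_complete hcauchy
  have hy1 : ‖y‖ = 1 := tendsto_nhds_unique hy.norm (by simp [hz1])
  have hQc : Continuous fun y => Q y y := by fun_prop
  have hy2 : Q y y = 0 := tendsto_nhds_unique ((hQc.tendsto y).comp hy) hQlim
  have hy0 : y ≠ 0 := by rintro rfl; simp at hy1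
  linarith [hpos y hy0]

/-- Lax-Milgram. The product norm on Y₀ is a maximum and comes from no inner product, so the form is
first pulled back to an equivalent Hilbert space V. -/
theorem surjective_of_coercive {V E : Type*} [NormedAddCommGroup V] [InnerProductSpace ℝ V]
    [CompleteSpace V] [NormedAddCommGroup E] [NormedSpace ℝ E] (e : V ≃L[ℝ] E)
    (Q : E →L[ℝ] E →L[ℝ] ℝ) {c : ℝ} (hc : 0 < c) (hQ : ∀ y, c * ‖y‖ ^ 2 ≤ Q y y) :
    Function.Surjective Q := by
  intro k
  set B : V →L[ℝ] V →L[ℝ] ℝ := Q.bilinearComp (e : V →L[ℝ] E) (e : V →L[ℝ] E) with hB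
  have hBa : ∀ v w, B v w = Q (e v) (e w) := fun v w => rfl
  have hcoer : IsCoercive B := by
    refine ⟨c / (‖(e.symm : E →L[ℝ] V)‖ ^ 2 + 1), by positivity, fun v => ?_⟩
    have h1 := (e.symm : E →L[ℝ] V).le_opNorm (e v)
    simp only [ContinuousLinearEquiv.coe_coe, ContinuousLinearEquiv.symm_apply_apply] at h1
    have h2 := hQ (e v)
    rw [hBa, mul_assoc, div_mul_eq_mul_div, div_le_iff₀ (by positivity)]
    have h3 : ‖v‖ ^ 2 ≤ ‖(e.symm : E →L[ℝ] V)‖ ^ 2 * ‖e v‖ ^ 2 := by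
      rw [← mul_pow]; exact pow_le_pow_left₀ (norm_nonneg _) h1 2
    have h4 := hc.le
    nlinarith [mul_le_mul_of_nonneg_left h3 h4, mul_le_mul_of_nonneg_left h2
      (sq_nonneg ‖(e.symm : E →L[ℝ] V)‖), sq_nonneg ‖e v‖, mul_nonneg h4 (sq_nonneg ‖e v‖)]
  set x := (InnerProductSpace.toDual ℝ V).symm (k ∘L (e : V →L[ℝ] E)) with hx
  refine ⟨e (hcoer.continuousLinearEquivOfBilin.symm x), ?_⟩
  ext z
  have h1 := hcoer.continuousLinearEquivOfBilin_apply (hcoer.continuousLinearEquivOfBilin.symm x)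
    (e.symm z)
  rw [ContinuousLinearEquiv.apply_symm_apply, hx, InnerProductSpace.toDual_symm_apply, hBa] at h1
  simpa using h1.symm

theorem deriv_const_add_smul {V : Type*} [NormedAddCommGroup V] [NormedSpace ℝ V] (a b : V)
    (g : ℝ) : deriv (fun g : ℝ => a + g • b) g = b := by
  have : HasDerivAt (fun g : ℝ => a + g • b) ((1 : ℝ) • b) g :=
    ((hasDerivAt_id g).smul_const b).const_add a
  rw [this.deriv, one_smul]

/-! ### The energy as a polynomial on Y₀ -/

/-- The first component of `Y₀`. -/
def projU : SpaceY₀ →L[ℝ] SpaceX := ContinuousLinearMap.fst ℝ SpaceX (SpaceX × SpaceH)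

/-- The second component of `Y₀`. -/
def projV : SpaceY₀ →L[ℝ] SpaceX :=
  (ContinuousLinearMap.fst ℝ SpaceX SpaceH) ∘L ContinuousLinearMap.snd ℝ SpaceX (SpaceX × SpaceH)

/-- The third component of `Y₀`. -/
def projW : SpaceY₀ →L[ℝ] SpaceH :=
  (ContinuousLinearMap.snd ℝ SpaceX SpaceH) ∘L ContinuousLinearMap.snd ℝ SpaceX (SpaceX × SpaceH)

@[simp] theorem projU_apply (y : SpaceY₀) : projU y = y.1 := rfl
@[simp] theorem projV_apply (y : SpaceY₀) : projV y = y.2.1 := rfl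
@[simp] theorem projW_apply (y : SpaceY₀) : projW y = y.2.2 := rfl

namespace CoreODE

scoped instance : NormedAddCommGroup SpaceY₀ := inferInstance
scoped instance : NormedSpace ℝ SpaceY₀ := inferInstance
scoped instance : NormedAddCommGroup (SpaceY₀ →L[ℝ] ℝ) := inferInstance
scoped instance : NormedSpace ℝ (SpaceY₀ →L[ℝ] ℝ) := inferInstance
scoped instance : NormedAddCommGroup (SpaceY₀ →L[ℝ] SpaceY₀ →L[ℝ] ℝ) := inferInstance
scoped instance : NormedSpace ℝ (SpaceY₀ →L[ℝ] SpaceY₀ →L[ℝ] ℝ) := inferInstance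

variable {d : ℤ} {κ : ℝ} {f S : ℝ → ℝ}

theorem memLp_f' (h : CoreODE d κ f S) : MemLp (deriv f) 2 radialMeasure :=
  (memLp_two_iff_integrable_sq (aestronglyMeasurable_radial h.cont_f')).2 h.int_f'

theorem memLp_S' (h : CoreODE d κ f S) : MemLp (fun r => deriv S r / r) 2 radialMeasure :=
  (memLp_two_iff_integrable_sq (aestronglyMeasurable_radial
    (h.cont_S'.div continuousOn_id fun _ hx => ne_of_gt hx))).2 h.int_S'

theorem memLp_T (h : CoreODE d κ f S) : MemLp (fun r => (d - S r) * f r / r) 2 radialMeasure :=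
  (memLp_two_iff_integrable_sq (aestronglyMeasurable_radial
    (((continuousOn_const.sub h.cont_S).mul h.cont_f).div continuousOn_id
      fun _ hx => ne_of_gt hx))).2 h.int_T

theorem memLp_V (h : CoreODE d κ f S) : MemLp (fun r => 1 - f r ^ 2) 2 radialMeasure :=
  (memLp_two_iff_integrable_sq (aestronglyMeasurable_radial
    (continuousOn_const.sub (h.cont_f.pow 2)))).2 h.int_V

/-- Multiplication by `f`. -/
def mulF (h : CoreODE d κ f S) : RadialL2 →L[ℝ] RadialL2 := mulBdd f 1 h.meas_f h.abs_f_le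

/-- Multiplication by `d - S`. -/
def mulT (h : CoreODE d κ f S) : RadialL2 →L[ℝ] RadialL2 :=
  mulBdd (fun r => d - S r) |(d : ℝ)| h.meas_T h.abs_T_le

theorem mulF_ae (h : CoreODE d κ f S) (a : RadialL2) :
    ∀ᵐ r ∂radialMeasure, h.mulF a r = f r * a r := mulBdd_ae _ _ a

theorem mulT_ae (h : CoreODE d κ f S) (a : RadialL2) :
    ∀ᵐ r ∂radialMeasure, h.mulT a r = (d - S r) * a r := mulBdd_ae _ _ a

/-- The element `f'` of `L²_r`. -/
def dF (h : CoreODE d κ f S) : RadialL2 := h.memLp_f'.toLp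

/-- The element `S' / r` of `L²_r`. -/
def dS (h : CoreODE d κ f S) : RadialL2 := h.memLp_S'.toLp

/-- The element `(d - S) f / r` of `L²_r`. -/
def dT (h : CoreODE d κ f S) : RadialL2 := h.memLp_T.toLp

/-- The element `1 - f²` of `L²_r`. -/
def dV (h : CoreODE d κ f S) : RadialL2 := h.memLp_V.toLp

theorem dF_ae (h : CoreODE d κ f S) : ∀ᵐ r ∂radialMeasure, h.dF r = deriv f r :=
  h.memLp_f'.coeFn_toLp

theorem dS_ae (h : CoreODE d κ f S) : ∀ᵐ r ∂radialMeasure, h.dS r = deriv S r / r :=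
  h.memLp_S'.coeFn_toLp

theorem dT_ae (h : CoreODE d κ f S) : ∀ᵐ r ∂radialMeasure, h.dT r = (d - S r) * f r / r :=
  h.memLp_T.coeFn_toLp

theorem dV_ae (h : CoreODE d κ f S) : ∀ᵐ r ∂radialMeasure, h.dV r = 1 - f r ^ 2 :=
  h.memLp_V.coeFn_toLp

/-- The constant parts of the quantities whose squares make up the energy. -/
def cst (h : CoreODE d κ f S) : Fin 5 → RadialL2 :=
  ![h.dF, h.dS, 0, h.dT, h.dV]

/-- The linear parts of the quantities whose squares make up the energy. -/
def lin (h : CoreODE d κ f S) : Fin 5 → SpaceY₀ →L[ℝ] RadialL2 :=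
  ![Xdiff ∘L projU, (Xquot + Xdiff) ∘L projV, Hdiff ∘L projW,
    h.mulT ∘L Xquot ∘L projU - h.mulF ∘L Xval ∘L projV, -((2 : ℝ) • h.mulF ∘L Xval ∘L projU)]

/-- The quadratic parts of the quantities whose squares make up the energy. -/
def bil : Fin 5 → SpaceY₀ →L[ℝ] SpaceY₀ →L[ℝ] RadialL2 :=
  ![0, 0, 0, -prodX.bilinearComp projU projV,
    -(prodX.bilinearComp projU projU + prodH.bilinearComp projW projW)]

/-- The weights of the terms of the energy. -/
def wt (κ : ℝ) : Fin 5 → ℝ := ![1, 1, 1, 1, κ ^ 2 / 2]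

/-- These are the five quantities whose squares form the energy density; in the first one the two
copies of u cancel, leaving f' + u'. The factor 2 in `lin` and the pure squares in `bil` come from
expanding 1 - (f + u)² - w². -/
theorem ae_terms (h : CoreODE d κ f S) (y : SpaceY₀) : ∀ᵐ r ∂radialMeasure,
    (h.cst 0 + h.lin 0 y + bil 0 y y) r = deriv f r + Xfn y.1 r
      - Xfn y.1 r + Xder y.1 r ∧
    (h.cst 1 + h.lin 1 y + bil 1 y y) r = (deriv S r + Xfn y.2.1 r + r * Xder y.2.1 r) / r ∧
    (h.cst 2 + h.lin 2 y + bil 2 y y) r = Hder y.2.2 r ∧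
    (h.cst 3 + h.lin 3 y + bil 3 y y) r =
      (d - (S r + r * Xfn y.2.1 r)) * (f r + Xfn y.1 r) / r ∧
    (h.cst 4 + h.lin 4 y + bil 4 y y) r = 1 - (f r + Xfn y.1 r) ^ 2 - Hfn y.2.2 r ^ 2 := by
  simp only [cst, lin, bil, Matrix.cons_val, ContinuousLinearMap.comp_apply, projU_apply,
    projV_apply, projW_apply, _root_.zero_apply, add_zero, zero_add,
    _root_.add_apply, _root_.sub_apply, _root_.neg_apply, _root_.smul_apply,
    ContinuousLinearMap.bilinearComp_apply]
  filter_upwards [ae_radial_pos, h.dF_ae, h.dS_ae,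
    h.dT_ae, h.dV_ae,
    Lp.coeFn_add h.dF (Xdiff y.1),
    Lp.coeFn_add h.dS (Xquot y.2.1 + Xdiff y.2.1),
    Lp.coeFn_add (Xquot y.2.1) (Xdiff y.2.1), Xquot_ae y.2.1, Xquot_ae y.1,
    Lp.coeFn_add (h.dT + (h.mulT (Xquot y.1) - h.mulF (Xval y.2.1)))
      (-prodX y.1 y.2.1), Lp.coeFn_add h.dT (h.mulT (Xquot y.1) - h.mulF (Xval y.2.1)),
    Lp.coeFn_sub (h.mulT (Xquot y.1)) (h.mulF (Xval y.2.1)), Lp.coeFn_neg (prodX y.1 y.2.1),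
    h.mulT_ae (Xquot y.1), h.mulF_ae (Xval y.2.1), prodX_ae y.1 y.2.1,
    Lp.coeFn_add (h.dV + -((2 : ℝ) • h.mulF (Xval y.1)))
      (-(prodX y.1 y.1 + prodH y.2.2 y.2.2)),
    Lp.coeFn_add h.dV (-((2 : ℝ) • h.mulF (Xval y.1))),
    Lp.coeFn_neg ((2 : ℝ) • h.mulF (Xval y.1)), Lp.coeFn_smul (2 : ℝ) (h.mulF (Xval y.1)),
    h.mulF_ae (Xval y.1), Lp.coeFn_neg (prodX y.1 y.1 + prodH y.2.2 y.2.2),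
    Lp.coeFn_add (prodX y.1 y.1) (prodH y.2.2 y.2.2), prodX_ae y.1 y.1, prodH_ae y.2.2 y.2.2]
    with r h0 e1 e2 e3 e4 e5 e6 e7 e8 e9 e10 e11 e12 e13 e14 e15 e16 e17 e18 e19 e20 e21 e22 e23
      e24 e25
  refine ⟨?_, ?_, rfl, ?_, ?_⟩
  · rw [e5, Pi.add_apply, e1, ← Xdiff_eq]; ring
  · rw [e6, Pi.add_apply, e2, e7, Pi.add_apply, e8, ← Xdiff_eq, ← Xval_eq]
    field_simp
    ring
  · rw [e10, Pi.add_apply, e11, Pi.add_apply, e3, e12, Pi.sub_apply, e14, e15, e13, Pi.neg_apply,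
      e16, e9, ← Xval_eq, ← Xval_eq]
    field_simp
    ring
  · rw [e17, Pi.add_apply, e18, Pi.add_apply, e4, e19, Pi.neg_apply, e20, Pi.smul_apply, e21, e22,
      Pi.neg_apply, e23, Pi.add_apply, e24, e25, ← Xval_eq, ← Hval_eq, smul_eq_mul]
    ring

theorem densityAt_ae (h : CoreODE d κ f S) (y : SpaceY₀) (g : ℝ) : ∀ᵐ r ∂radialMeasure,
    densityAt d κ f S y g r =
      ∑ i, wt κ i * (1 / 2 * (h.cst i + h.lin i y + bil i y y) r ^ 2)
        + κ ^ 2 * g * (1 / 2 * Hval y.2.2 r ^ 2) := by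
  filter_upwards [h.ae_terms y, ae_radial_pos] with r ⟨h0, h1, h2, h3, h4⟩ hr
  simp only [Fin.sum_univ_five, h0, h1, h2, h3, h4, wt, Matrix.cons_val, densityAt, energyDensity,
    Hval_eq]
  ring

theorem integrable_densityAt (h : CoreODE d κ f S) (y : SpaceY₀) (g : ℝ) :
    Integrable (densityAt d κ f S y g) radialMeasure := by
  refine Integrable.congr ?_ (EventuallyEq.symm (h.densityAt_ae y g))
  refine Integrable.add (integrable_finsetSum _ fun i _ => ?_) ?_
  · exact ((integrable_sq _).const_mul _).const_mul _
  · exact ((integrable_sq _).const_mul _).const_mul _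

theorem energy_eq (h : CoreODE d κ f S) (y : SpaceY₀) (g : ℝ) :
    energy d κ f S y g = polyEnergy (wt κ) h.cst h.lin bil (κ ^ 2) (Hval ∘L projW) y g := by
  rw [energy, integral_congr_ae (h.densityAt_ae y g), integral_add, integral_finsetSum]
  · simp only [integral_const_mul, ← norm_sq_eq_integral]
    rfl
  · exact fun i _ => ((integrable_sq _).const_mul _).const_mul _
  · exact integrable_finsetSum _ fun i _ => ((integrable_sq _).const_mul _).const_mul _
  · exact ((integrable_sq _).const_mul _).const_mul _

theorem contDiff_energy (h : CoreODE d κ f S) :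
    ContDiff ℝ ∞ (fun p : SpaceY₀ × ℝ => energy d κ f S p.1 p.2) := by
  simp_rw [h.energy_eq]
  exact contDiff_polyEnergy _ _ _ _ _ _

/-- The part of the Hessian at the core that does not depend on `g`. -/
def hess₀ (h : CoreODE d κ f S) : SpaceY₀ →L[ℝ] SpaceY₀ →L[ℝ] ℝ :=
  ∑ i, wt κ i • linPart (h.cst i) (h.lin i) (bil i)

/-- The derivative with respect to `g` of the Hessian at the core. -/
def hess₁ (κ : ℝ) : SpaceY₀ →L[ℝ] SpaceY₀ →L[ℝ] ℝ :=
  κ ^ 2 • linPart 0 (Hval ∘L projW) (0 : SpaceY₀ →L[ℝ] SpaceY₀ →L[ℝ] RadialL2)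

/-- The part of degree two of the derivative of the energy. -/
def rem₂ (h : CoreODE d κ f S) (y : SpaceY₀) : SpaceY₀ →L[ℝ] ℝ :=
  ∑ i, wt κ i • quadPart (h.lin i) (bil i) y

/-- The part of degree three of the derivative of the energy. -/
def rem₃ (κ : ℝ) (y : SpaceY₀) : SpaceY₀ →L[ℝ] ℝ := ∑ i, wt κ i • cubPart (bil i) y

theorem mapF_eq_add (h : CoreODE d κ f S) (y : SpaceY₀) (g : ℝ) :
    mapF d κ f S y g = (∑ i, wt κ i • (innerL RadialL2 (h.cst i)) ∘L (h.lin i))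
      + h.hess₀ y + g • hess₁ κ y + h.rem₂ y + rem₃ κ y := by
  rw [mapF]
  simp_rw [h.energy_eq]
  rw [fderiv_polyEnergy]
  rfl

theorem contDiff_rem₂ (h : CoreODE d κ f S) : ContDiff ℝ ∞ h.rem₂ :=
  ContDiff.sum fun i _ => (contDiff_quadPart _ _).const_smul (wt κ i)

theorem contDiff_rem₃ : ContDiff ℝ ∞ (rem₃ κ) :=
  ContDiff.sum fun i _ => (contDiff_cubPart _).const_smul (wt κ i)

theorem rem₂_smul (h : CoreODE d κ f S) (s : ℝ) (y : SpaceY₀) :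
    h.rem₂ (s • y) = s ^ 2 • h.rem₂ y := by
  simp only [rem₂, quadPart_smul, Finset.smul_sum, smul_comm (s ^ 2)]

theorem rem₃_smul (s : ℝ) (y : SpaceY₀) : rem₃ κ (s • y) = s ^ 3 • rem₃ κ y := by
  simp only [rem₃, cubPart_smul, Finset.smul_sum, smul_comm (s ^ 3)]

/-- The remainders of degree two and three have zero derivative at the origin, and the constant term
does not contribute. -/
theorem linF_eq (h : CoreODE d κ f S) (g : ℝ) : linF d κ f S g = h.hess₀ + g • hess₁ κ := by
  rw [linF]
  simp_rw [h.mapF_eq_add]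
  have h2 := hasFDerivAt_zero_of_homogeneous h.contDiff_rem₂ 2 le_rfl h.rem₂_smul
  have h3 := hasFDerivAt_zero_of_homogeneous (contDiff_rem₃ (κ := κ)) 3 (by norm_num) rem₃_smul
  have h4 := ((((h.hess₀.hasFDerivAt (x := 0)).const_add
    (∑ i, wt κ i • (innerL RadialL2 (h.cst i)) ∘L (h.lin i))).add
    ((hess₁ κ).hasFDerivAt (x := 0) |>.const_smul g)).add h2).add h3
  rw [add_zero, add_zero] at h4
  exact h4.fderiv

theorem deriv_linF (h : CoreODE d κ f S) (g : ℝ) :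
    deriv (fun g : ℝ => linF d κ f S g) g = hess₁ κ := by
  simp_rw [h.linF_eq]
  exact deriv_const_add_smul (V := SpaceY₀ →L[ℝ] SpaceY₀ →L[ℝ] ℝ) h.hess₀ (hess₁ κ) g

theorem hess₁_apply (y z : SpaceY₀) :
    hess₁ κ y z = κ ^ 2 * inner ℝ (Hval y.2.2) (Hval z.2.2) := by
  simp [hess₁, linPart_apply]

theorem hess₀_symm (h : CoreODE d κ f S) (y z : SpaceY₀) : h.hess₀ y z = h.hess₀ z y := by
  simp only [hess₀, _root_.sum_apply, _root_.smul_apply, linPart_apply]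
  refine Finset.sum_congr rfl fun i _ => ?_
  rw [real_inner_comm, add_comm (bil i y z)]

theorem hess₁_symm (y z : SpaceY₀) : hess₁ κ y z = hess₁ κ z y := by
  rw [hess₁_apply, hess₁_apply, real_inner_comm]

end CoreODE

/-! ### The core is a critical point -/

theorem hasPrim_id : HasPrim (fun r : ℝ => r) (fun _ => 1) :=
  HasPrim.of_hasDerivAt (fun x _ => hasDerivAt_id x) continuousOn_const

/-- `HasPrim.integral_eq_zero` in terms of r dr: if G' = q r and G = b r², then G/r = b r, so both
hypotheses become integrability against r dr. -/
theorem HasPrim.integral_radial_eq_zero {G p q : ℝ → ℝ} (hG : HasPrim G p)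
    (hq : ∀ᵐ r ∂radialMeasure, p r = q r * r) (hqi : Integrable q radialMeasure)
    {b : ℝ → ℝ} (hb : ∀ᵐ r ∂radialMeasure, G r = b r * r * r) (hbi : Integrable b radialMeasure) :
    ∫ r, q r ∂radialMeasure = 0 := by
  have hq' := ae_of_ae_radial hq
  rw [integral_radial, ← integral_congr_ae hq']
  refine hG.integral_eq_zero ((integrable_radial_iff.1 hqi).congr (EventuallyEq.symm hq'))
    ((integrable_radial_iff.1 hbi).congr ?_)
  filter_upwards [ae_of_ae_radial hb, ae_restrict_mem measurableSet_Ioi] with r hr h0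
  have : r ≠ 0 := ne_of_gt h0
  rw [hr]
  field_simp

/-- 2(u/r)u' r is the derivative of u², whose boundary terms vanish because u/r is in L²_r. This
removes the cross term between v/r and v' from the Hessian. -/
theorem inner_Xquot_Xdiff (u : SpaceX) : inner ℝ (Xquot u) (Xdiff u) = 0 := by
  rw [inner_eq_integral]
  have h1 : ∫ r, 2 * (Xquot u r * Xdiff u r) ∂radialMeasure = 0 := by
    refine (Hrep_sq_hasPrim (XtoH u)).integral_radial_eq_zero (b := fun r => Xquot u r ^ 2) ?_
      ((integrable_mul _ _).const_mul 2) ?_ (integrable_sq _)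
    · filter_upwards [Xquot_ae u, ae_radial_pos] with r hr h0
      rw [Hval_XtoH, Hdiff_XtoH, hr]
      field_simp
    · filter_upwards [Xquot_ae u, ae_radial_pos, ae_radial_iff.2 (Hrep_ae (XtoH u))] with r hr h0 hu
      rw [← hu, Hval_XtoH, hr]
      field_simp
  rw [integral_const_mul] at h1
  linarith

namespace CoreODE

variable {d : ℤ} {κ : ℝ} {f S : ℝ → ℝ}

/-- The f-equation tested with u: the boundary term is r f' u, and f'(u/r) is integrable against r
dr. -/
theorem weak_f (h : CoreODE d κ f S) (u : SpaceX) :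
    inner ℝ h.dF (Xdiff u) + inner ℝ h.dT (h.mulT (Xquot u))
      - κ ^ 2 * inner ℝ h.dV (h.mulF (Xval u)) = 0 := by
  have hsplit : inner ℝ h.dF (Xdiff u) + inner ℝ h.dT (h.mulT (Xquot u))
      - κ ^ 2 * inner ℝ h.dV (h.mulF (Xval u)) = ∫ r, (h.dF r * Xdiff u r +
        h.dT r * h.mulT (Xquot u) r - κ ^ 2 * (h.dV r * h.mulF (Xval u) r)) ∂radialMeasure := by
    rw [integral_sub (by exact (integrable_mul _ _).add (integrable_mul _ _))
      (by exact (integrable_mul _ _).const_mul _), integral_add (integrable_mul _ _)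
      (integrable_mul _ _), integral_const_mul]
    simp only [inner_eq_integral]
  rw [hsplit]
  have hrf : HasPrim (fun r => r * deriv f r)
      (fun r => r * ((d - S r) ^ 2 / r ^ 2 - κ ^ 2 * (1 - f r ^ 2)) * f r) :=
    HasPrim.of_hasDerivAt h.deriv_rf' (h.cont_ode.mul h.cont_f)
  refine (hrf.mul (Hrep_hasPrim (XtoH u))).integral_radial_eq_zero
    (b := fun r => h.dF r * Xquot u r) ?_
    (((integrable_mul _ _).add (integrable_mul _ _)).sub ((integrable_mul _ _).const_mul _)) ?_
    (integrable_mul _ _)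
  · filter_upwards [Xquot_ae u, ae_radial_pos, ae_radial_iff.2 (Hrep_ae (XtoH u)),
      h.dF_ae, h.dT_ae, h.dV_ae, h.mulT_ae (Xquot u),
      h.mulF_ae (Xval u)] with r e1 h0 e2 e3 e4 e5 e6 e7
    simp only [e3, e4, e5, e6, e7, e1, Hdiff_XtoH]
    rw [← e2, Hval_XtoH]
    field_simp
    ring
  · filter_upwards [Xquot_ae u, ae_radial_pos, ae_radial_iff.2 (Hrep_ae (XtoH u)),
      h.dF_ae] with r e1 h0 e2 e3
    rw [← e2, Hval_XtoH, e3, e1]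
    field_simp

/-- The S-equation, in the form (S'/r)' = -(d - S)f²/r, tested with r v. -/
theorem weak_S (h : CoreODE d κ f S) (v : SpaceX) :
    inner ℝ h.dS (Xquot v + Xdiff v) - inner ℝ h.dT (h.mulF (Xval v)) = 0 := by
  simp only [inner_eq_integral]
  rw [← integral_sub (integrable_mul _ _) (integrable_mul _ _)]
  have hS : HasPrim (fun r => deriv S r / r) (fun r => -((d - S r) * f r ^ 2 / r)) :=
    HasPrim.of_hasDerivAt h.deriv_S'r ((((continuousOn_const.sub h.cont_S).mul
      (h.cont_f.pow 2)).div continuousOn_id fun _ hx => ne_of_gt hx).neg)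
  refine (hS.mul (hasPrim_id.mul (Hrep_hasPrim (XtoH v)))).integral_radial_eq_zero
    (b := fun r => h.dS r * Xquot v r) ?_
    ((integrable_mul _ _).sub (integrable_mul _ _)) ?_ (integrable_mul _ _)
  · filter_upwards [Xquot_ae v, ae_radial_pos, ae_radial_iff.2 (Hrep_ae (XtoH v)),
      h.dS_ae, h.dT_ae, Lp.coeFn_add (Xquot v) (Xdiff v),
      h.mulF_ae (Xval v)] with r e1 h0 e2 e3 e4 e5 e6
    rw [e3, e4, e5, e6, Pi.add_apply, e1, Hdiff_XtoH, ← e2, Hval_XtoH]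
    field_simp
    ring
  · filter_upwards [Xquot_ae v, ae_radial_pos, ae_radial_iff.2 (Hrep_ae (XtoH v)),
      h.dS_ae] with r e1 h0 e2 e3
    rw [← e2, Hval_XtoH, e3, e1]
    field_simp

theorem sum_inner_cst_eq_zero (h : CoreODE d κ f S) :
    ∑ i, wt κ i • (innerL RadialL2 (h.cst i)) ∘L (h.lin i) = 0 := by
  refine ContinuousLinearMap.ext fun y => ?_
  have h1 := h.weak_f y.1
  have h2 := h.weak_S y.2.1
  simp only [Fin.sum_univ_five, wt, cst, lin, Matrix.cons_val, _root_.add_apply, _root_.smul_apply,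
    ContinuousLinearMap.comp_apply, innerL_apply, _root_.sub_apply, _root_.neg_apply,
    projU_apply, projV_apply, projW_apply, inner_zero_left, inner_sub_right, inner_neg_right,
    inner_smul_right, smul_eq_mul, _root_.zero_apply]
  linarith

theorem mapF_eq (h : CoreODE d κ f S) (y : SpaceY₀) (g : ℝ) :
    mapF d κ f S y g = h.hess₀ y + g • hess₁ κ y + h.rem₂ y + rem₃ κ y := by
  rw [h.mapF_eq_add, h.sum_inner_cst_eq_zero, zero_add]

theorem mapF_zero (h : CoreODE d κ f S) (g : ℝ) : mapF d κ f S 0 g = 0 := by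
  have h2 : h.rem₂ 0 = 0 := by simpa using h.rem₂_smul 0 0
  have h3 : rem₃ κ 0 = 0 := by simpa using rem₃_smul (κ := κ) 0 0
  rw [h.mapF_eq, h2, h3]
  simp

/-! ### Nonnegativity of the Jacobi form -/

/-- Picone's identity: the displayed density times r equals (u' - u f'/(f + ε))² r plus the
derivative of r f' u²/(f + ε). The shift ε makes u/(f + ε) bounded even if f tends to 0 at the
origin, so the boundary terms vanish. -/
theorem jacobi_aux (h : CoreODE d κ f S) (u : SpaceX) {ε : ℝ} (hε : 0 < ε) :
    0 ≤ ∫ r, (Xdiff u r ^ 2 + f r / (f r + ε) * ((d - S r) ^ 2 * Xquot u r ^ 2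
      - κ ^ 2 * (1 - f r ^ 2) * Xval u r ^ 2)) ∂radialMeasure := by
  obtain ⟨U, hU⟩ : ∃ U, U = Hrep (XtoH u) := ⟨_, rfl⟩
  have hfε : ∀ r, 0 < r → 0 < f r + ε := fun r hr => by linarith [h.f_nonneg r hr]
  have hfεc : ContinuousOn (fun r => f r + ε) (Ioi 0) := h.cont_f.add continuousOn_const
  have hne : ∀ r ∈ Ioi (0 : ℝ), f r + ε ≠ 0 := fun r hr => (hfε r hr).ne'
  have hUc : ContinuousOn U (Ioi 0) := hU ▸ (Hrep_hasPrim (XtoH u)).continuousOn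
  have hq : HasPrim (fun r => r * deriv f r / (f r + ε))
      (fun r => (r * ((d - S r) ^ 2 / r ^ 2 - κ ^ 2 * (1 - f r ^ 2)) * f r * (f r + ε)
        - r * deriv f r * deriv f r) / (f r + ε) ^ 2) := by
    refine HasPrim.of_hasDerivAt (fun r hr => ?_) ?_
    · exact (h.deriv_rf' r hr).fun_div ((h.deriv_f r hr).add_const ε) (hne r hr)
    · exact (((h.cont_ode.mul h.cont_f).mul hfεc).sub ((continuousOn_id.mul h.cont_f').mul
        h.cont_f')).div (hfεc.pow 2) fun r hr => pow_ne_zero 2 (hne r hr)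
  have hU2 : ∀ᵐ r ∂radialMeasure, U r = Xval u r :=
    (ae_radial_iff.2 (Hrep_ae (XtoH u))).mono fun r hr => by rw [hU, ← hr, Hval_XtoH]
  have hUb : ∀ᵐ r ∂radialMeasure, |U r| ≤ ‖u‖ := by
    filter_upwards [hU2, abs_Xval_le u] with r h1 h2
    rwa [h1]
  -- the three pieces of the derivative
  have hI : Integrable (fun r => Xdiff u r ^ 2 + f r / (f r + ε) * ((d - S r) ^ 2 * Xquot u r ^ 2
      - κ ^ 2 * (1 - f r ^ 2) * Xval u r ^ 2)) radialMeasure := by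
    refine (integrable_sq _).add ?_
    have hρ : ∀ᵐ r ∂radialMeasure, ‖f r / (f r + ε)‖ ≤ 1 := by
      filter_upwards [ae_radial_pos] with r hr
      rw [Real.norm_of_nonneg (div_nonneg (h.f_nonneg r hr) (hfε r hr).le), div_le_one (hfε r hr)]
      linarith
    refine Integrable.bdd_mul ?_ (aestronglyMeasurable_radial (h.cont_f.div hfεc hne)) hρ
    refine Integrable.sub ?_ ?_
    · refine Integrable.bdd_mul (c := (d : ℝ) ^ 2) (integrable_sq _)
        (aestronglyMeasurable_radial ((continuousOn_const.sub h.cont_S).pow 2)) ?_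
      filter_upwards [ae_radial_pos] with r hr
      rw [Real.norm_of_nonneg (sq_nonneg _)]
      exact h.sq_T_le hr
    · refine Integrable.bdd_mul (c := κ ^ 2) (integrable_sq _) (aestronglyMeasurable_radial
        (continuousOn_const.mul (continuousOn_const.sub (h.cont_f.pow 2)))) ?_
      filter_upwards [ae_radial_pos] with r hr
      have := h.V_nonneg hr
      rw [Real.norm_of_nonneg (by positivity)]
      exact mul_le_of_le_one_right (sq_nonneg _) (by nlinarith [sq_nonneg (f r)])
  have hinv : ∀ᵐ r ∂radialMeasure, |1 / (f r + ε)| ≤ 1 / ε := by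
    filter_upwards [ae_radial_pos] with r hr
    rw [abs_of_pos (one_div_pos.2 (hfε r hr))]
    exact one_div_le_one_div_of_le hε (by linarith [h.f_nonneg r hr])
  have hm1 : AEStronglyMeasurable (fun r => U r * (1 / (f r + ε))) radialMeasure :=
    aestronglyMeasurable_radial (hUc.mul (continuousOn_const.div hfεc hne))
  have hb1 : ∀ᵐ r ∂radialMeasure, ‖U r * (1 / (f r + ε))‖ ≤ ‖u‖ * (1 / ε) := by
    filter_upwards [hinv, hUb] with r h1 h2
    rw [norm_mul]
    exact mul_le_mul h2 h1 (norm_nonneg _) (norm_nonneg _)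
  have hp2 : Integrable (fun r => (U r * (1 / (f r + ε))) *
      ((U r * (1 / (f r + ε))) * deriv f r ^ 2)) radialMeasure :=
    (h.int_f'.bdd_mul hm1 hb1).bdd_mul hm1 hb1
  have hp3 : Integrable (fun r => (U r * (1 / (f r + ε))) * (2 * (h.dF r * Xdiff u r)))
      radialMeasure := ((integrable_mul _ _).const_mul 2).bdd_mul hm1 hb1
  have hbint : Integrable (fun r => (U r * (1 / (f r + ε))) * (h.dF r * Xquot u r))
      radialMeasure := (integrable_mul _ _).bdd_mul hm1 hb1
  have hsq : Integrable (fun r => Xdiff u r ^ 2 + (U r * (1 / (f r + ε))) *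
      ((U r * (1 / (f r + ε))) * deriv f r ^ 2) -
        (U r * (1 / (f r + ε))) * (2 * (h.dF r * Xdiff u r))) radialMeasure :=
    ((integrable_sq _).add hp2).sub hp3
  have hnn : 0 ≤ ∫ r, (Xdiff u r ^ 2 + (U r * (1 / (f r + ε))) *
      ((U r * (1 / (f r + ε))) * deriv f r ^ 2) -
        (U r * (1 / (f r + ε))) * (2 * (h.dF r * Xdiff u r))) ∂radialMeasure := by
    refine integral_nonneg_of_ae ?_
    filter_upwards [h.dF_ae] with r e1
    rw [e1, Pi.zero_apply]
    have := sq_nonneg (Xdiff u r - U r * (1 / (f r + ε)) * deriv f r)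
    linarith
  have hdiff := hq.mul (Hrep_sq_hasPrim (XtoH u))
  have hzero : ∫ r, ((Xdiff u r ^ 2 + f r / (f r + ε) * ((d - S r) ^ 2 * Xquot u r ^ 2
      - κ ^ 2 * (1 - f r ^ 2) * Xval u r ^ 2)) - (Xdiff u r ^ 2 + (U r * (1 / (f r + ε))) *
      ((U r * (1 / (f r + ε))) * deriv f r ^ 2) -
        (U r * (1 / (f r + ε))) * (2 * (h.dF r * Xdiff u r)))) ∂radialMeasure = 0 := by
    refine hdiff.integral_radial_eq_zero ?_ (by exact hI.sub hsq) ?_ hbint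
    · filter_upwards [Xquot_ae u, ae_radial_pos, hU2, h.dF_ae] with r e1 h0 e2 e3
      have := (hfε r h0).ne'
      rw [e1, e3, Hval_XtoH, Hdiff_XtoH, ← hU, e2]
      field_simp
      ring
    · filter_upwards [Xquot_ae u, ae_radial_pos, hU2, h.dF_ae] with r e1 h0 e2 e3
      have := (hfε r h0).ne'
      rw [e1, e3, ← hU, e2]
      field_simp
  rw [integral_sub hI hsq] at hzero
  linarith

/-- Since `f` is a positive solution of the linear equation `J w = 0`, the form of `J` is
nonnegative. -/
theorem jacobi_nonneg (h : CoreODE d κ f S) (u : SpaceX) :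
    0 ≤ ∫ r, (Xdiff u r ^ 2 + ((d - S r) ^ 2 * Xquot u r ^ 2
      - κ ^ 2 * (1 - f r ^ 2) * Xval u r ^ 2)) ∂radialMeasure := by
  -- Let ε = 1/(n+1) tend to 0: f/(f + ε) is at most 1 and tends to 1 because f > 0, so dominated
  -- convergence applies.
  have hlim : Tendsto (fun n : ℕ => ∫ r, (Xdiff u r ^ 2 + f r / (f r + 1 / (n + 1 : ℝ)) *
      ((d - S r) ^ 2 * Xquot u r ^ 2 - κ ^ 2 * (1 - f r ^ 2) * Xval u r ^ 2)) ∂radialMeasure)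
      atTop (𝓝 (∫ r, (Xdiff u r ^ 2 + 1 * ((d - S r) ^ 2 * Xquot u r ^ 2
      - κ ^ 2 * (1 - f r ^ 2) * Xval u r ^ 2)) ∂radialMeasure)) := by
    refine tendsto_integral_of_dominated_convergence
      (fun r => Xdiff u r ^ 2 + ((d : ℝ) ^ 2 * Xquot u r ^ 2 + κ ^ 2 * Xval u r ^ 2))
      (fun n => ?_) ?_ (fun n => ?_) ?_
    · have hn : (0 : ℝ) < 1 / (n + 1 : ℝ) := by positivity
      have hc : ContinuousOn (fun r => f r / (f r + 1 / (n + 1 : ℝ))) (Ioi 0) :=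
        h.cont_f.div (h.cont_f.add continuousOn_const) fun r hr => by
          have := h.f_nonneg r hr; positivity
      exact ((Lp.aestronglyMeasurable _).pow 2).add ((aestronglyMeasurable_radial hc).mul
        (((h.meas_T.pow 2).mul ((Lp.aestronglyMeasurable _).pow 2)).sub
          ((aestronglyMeasurable_radial (continuousOn_const.mul (continuousOn_const.sub
            (h.cont_f.pow 2)))).mul ((Lp.aestronglyMeasurable _).pow 2))))
    · exact (integrable_sq _).add (((integrable_sq _).const_mul _).add
        ((integrable_sq _).const_mul _))
    · filter_upwards [ae_radial_pos] with r hr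
      have hn : (0 : ℝ) < 1 / (n + 1 : ℝ) := by positivity
      have hf := h.f_nonneg r hr
      have h1 : |f r / (f r + 1 / (n + 1 : ℝ))| ≤ 1 := by
        rw [abs_of_nonneg (by positivity), div_le_one (by positivity)]; linarith
      have h2 := h.sq_T_le hr
      have h3 := h.V_nonneg hr
      have h4 : |(d - S r) ^ 2 * Xquot u r ^ 2 - κ ^ 2 * (1 - f r ^ 2) * Xval u r ^ 2| ≤
          (d : ℝ) ^ 2 * Xquot u r ^ 2 + κ ^ 2 * Xval u r ^ 2 := by
        refine (abs_sub _ _).trans (add_le_add ?_ ?_)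
        · rw [abs_of_nonneg (by positivity)]
          exact mul_le_mul_of_nonneg_right h2 (sq_nonneg _)
        · rw [abs_of_nonneg (by positivity)]
          refine mul_le_mul_of_nonneg_right ?_ (sq_nonneg _)
          exact mul_le_of_le_one_right (sq_nonneg _) (by nlinarith [sq_nonneg (f r)])
      refine (norm_add_le _ _).trans ?_
      rw [Real.norm_of_nonneg (sq_nonneg _), Real.norm_eq_abs, abs_mul]
      have := mul_le_mul h1 h4 (abs_nonneg _) zero_le_one
      linarith
    · filter_upwards [ae_radial_pos] with r hr
      have hf := h.f_pos hr
      have h1 : Tendsto (fun n : ℕ => f r / (f r + 1 / (n + 1 : ℝ))) atTop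
          (𝓝 (f r / (f r + 0))) :=
        tendsto_const_nhds.div (tendsto_one_div_add_atTop_nhds_zero_nat.const_add (f r))
          (by simpa using hf.ne')
      rw [add_zero, div_self hf.ne'] at h1
      exact (h1.mul_const _).const_add _
  simp only [one_mul] at hlim
  exact ge_of_tendsto hlim (Eventually.of_forall fun n => h.jacobi_aux u (by positivity))

end CoreODE

/-! ### The quadratic forms on (u, v) and on w -/

/-- The density of the form of the linearization on the components `(u, v)`, where `a = u / r` and
`b = v / r`. -/
def uvDensity (κ T f u u' a v v' b : ℝ) : ℝ :=
  u' ^ 2 + (T ^ 2 * a ^ 2 - κ ^ 2 * (1 - f ^ 2) * u ^ 2) + 2 * κ ^ 2 * f ^ 2 * u ^ 2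
    + v' ^ 2 + b ^ 2 + f ^ 2 * v ^ 2 - 4 * T * f * u * b

/-- Completing the square in b absorbs the only indefinite cross term at the price of 4T²f²u². The
remaining coefficient 2κ² - 4T² is nonnegative exactly because T² ≤ d² and κ² ≥ 2d². -/
theorem uvDensity_eq (κ T f u u' a v v' b : ℝ) :
    uvDensity κ T f u u' a v v' b = (u' ^ 2 + (T ^ 2 * a ^ 2 - κ ^ 2 * (1 - f ^ 2) * u ^ 2))
      + (v' ^ 2 + f ^ 2 * v ^ 2 + (b - 2 * T * f * u) ^ 2
        + (2 * κ ^ 2 - 4 * T ^ 2) * (f ^ 2 * u ^ 2)) := by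
  unfold uvDensity; ring

theorem abs_cross_le {T f u b D : ℝ} (hT : |T| ≤ D) (hf : 0 ≤ f) (hf1 : f ≤ 1) :
    4 * T * f * u * b ≤ 4 * D * (|u| * |b|) := by
  have h1 : |T * f| ≤ D := by
    rw [abs_mul, abs_of_nonneg hf]
    exact (mul_le_of_le_one_right (abs_nonneg _) hf1).trans hT
  have h2 : T * f * (u * b) ≤ |T * f| * (|u| * |b|) := by
    rw [← abs_mul u b, ← abs_mul]; exact le_abs_self _
  have h3 := mul_le_mul_of_nonneg_right h1 (by positivity : 0 ≤ |u| * |b|)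
  nlinarith

/-- A Gårding inequality. The cross term costs b²/2 + 8D²u². The term a² is controlled by T² ≥ 1/2
when r ≤ δ and by a² ≤ u²/δ² otherwise. -/
theorem uvDensity_inner_le {κ T f u u' a v v' b D δ r : ℝ} (hT : |T| ≤ D) (hf : 0 ≤ f)
    (hf1 : f ≤ 1) (hδ : 0 < δ) (hsmall : r ≤ δ → 1 / 2 ≤ T ^ 2) (hu : u = r * a) :
    1 / 4 * (u ^ 2 + u' ^ 2 + a ^ 2 + (v ^ 2 + v' ^ 2 + b ^ 2))
      ≤ uvDensity κ T f u u' a v v' b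
        + (κ ^ 2 + 8 * D ^ 2 + 1 + 1 / δ ^ 2) * (u ^ 2 + v ^ 2) := by
  have hc := abs_cross_le (u := u) (b := b) hT hf hf1
  have h1 : 4 * D * (|u| * |b|) ≤ 1 / 2 * b ^ 2 + 8 * D ^ 2 * u ^ 2 := by
    have := sq_nonneg (|b| - 4 * D * |u|)
    rw [← sq_abs u, ← sq_abs b]
    nlinarith
  have h2 : 1 / 4 * a ^ 2 ≤ T ^ 2 * a ^ 2 + 1 / δ ^ 2 * u ^ 2 := by
    rcases le_or_gt r δ with h | h
    · have := mul_le_mul_of_nonneg_right (hsmall h) (sq_nonneg a)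
      have : 0 ≤ 1 / δ ^ 2 * u ^ 2 := by positivity
      nlinarith [sq_nonneg a]
    · have : a ^ 2 ≤ 1 / δ ^ 2 * u ^ 2 := by
        rw [hu, mul_pow, ← mul_assoc, one_div_mul_eq_div]
        refine le_mul_of_one_le_left (sq_nonneg a) ?_
        rw [one_le_div (by positivity)]
        exact pow_le_pow_left₀ hδ.le h.le 2
      have : 0 ≤ T ^ 2 * a ^ 2 := by positivity
      nlinarith [sq_nonneg a]
  have h3 : 0 ≤ κ ^ 2 * f ^ 2 * u ^ 2 := by positivity
  have h4 : 0 ≤ f ^ 2 * v ^ 2 := by positivity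
  have h5 : 0 ≤ (κ ^ 2 + 8 * D ^ 2 + 1 / δ ^ 2) * v ^ 2 := by positivity
  unfold uvDensity
  nlinarith [sq_nonneg u, sq_nonneg v, sq_nonneg u', sq_nonneg v', sq_nonneg b]

/-- Far out no correction is needed: f² ≥ 3/4 supplies mass terms in u and v, and r ≥ 8D with b =
v/r makes the cross term at most (u² + v²)/4. -/
theorem uvDensity_outer_le {κ T f u u' a v v' b D r : ℝ} (hκ : 2 ≤ κ ^ 2) (hT : |T| ≤ D)
    (hf : 0 ≤ f) (hf1 : f ≤ 1) (hr : 1 ≤ r) (hrD : 8 * D ≤ r) (hV : 1 - f ^ 2 ≤ 1 / 4)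
    (hu : u = r * a) (hv : v = r * b) :
    1 / 4 * (u ^ 2 + u' ^ 2 + a ^ 2 + (v ^ 2 + v' ^ 2 + b ^ 2))
      ≤ uvDensity κ T f u u' a v v' b := by
  have hc := abs_cross_le (u := u) (b := b) hT hf hf1
  have h1 : 4 * D * (|u| * |b|) ≤ 1 / 4 * (u ^ 2 + v ^ 2) := by
    have e : |v| = r * |b| := by rw [hv, abs_mul, abs_of_nonneg (by linarith)]
    have := mul_le_mul_of_nonneg_right hrD (by positivity : 0 ≤ |u| * |b|)
    have h' := two_mul_le_add_sq |u| |v|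
    rw [e] at h'
    rw [← sq_abs u, ← sq_abs v, e]
    nlinarith
  have h2 : a ^ 2 ≤ u ^ 2 := by
    rw [hu, mul_pow]; exact le_mul_of_one_le_left (sq_nonneg a) (by nlinarith)
  have h3 : κ ^ 2 * (1 - f ^ 2) * u ^ 2 ≤ κ ^ 2 * f ^ 2 * u ^ 2 :=
    mul_le_mul_of_nonneg_right (mul_le_mul_of_nonneg_left (by linarith) (sq_nonneg _))
      (sq_nonneg _)
  have h4 : 3 / 4 * v ^ 2 ≤ f ^ 2 * v ^ 2 :=
    mul_le_mul_of_nonneg_right (by linarith) (sq_nonneg _)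
  have h5 : 3 / 2 * u ^ 2 ≤ κ ^ 2 * f ^ 2 * u ^ 2 :=
    mul_le_mul_of_nonneg_right (by nlinarith) (sq_nonneg _)
  have h6 : 0 ≤ T ^ 2 * a ^ 2 := by positivity
  unfold uvDensity
  nlinarith [sq_nonneg u, sq_nonneg v, sq_nonneg u', sq_nonneg v', sq_nonneg b]

namespace CoreODE

variable {d : ℤ} {κ : ℝ} {f S : ℝ → ℝ}

/-- The form of the linearization on the component `w`. -/
def formW (h : CoreODE d κ f S) (g : ℝ) : SpaceH →L[ℝ] SpaceH →L[ℝ] ℝ :=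
  (innerL RadialL2).bilinearComp Hdiff Hdiff
    - κ ^ 2 • (ContinuousLinearMap.compL ℝ SpaceH RadialL2 ℝ (innerL RadialL2 h.dV)) ∘L prodH
    + (g * κ ^ 2) • (innerL RadialL2).bilinearComp Hval Hval

theorem formW_apply (h : CoreODE d κ f S) (g : ℝ) (w z : SpaceH) :
    h.formW g w z = inner ℝ (Hdiff w) (Hdiff z) - κ ^ 2 * inner ℝ h.dV (prodH w z)
      + g * κ ^ 2 * inner ℝ (Hval w) (Hval z) := rfl

theorem prodH_symm (w z : SpaceH) : prodH w z = prodH z w := by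
  refine Lp.ext ?_
  filter_upwards [prodH_ae w z, prodH_ae z w] with r h1 h2
  rw [h1, h2, mul_comm]

theorem formW_symm (h : CoreODE d κ f S) (g : ℝ) (w z : SpaceH) :
    h.formW g w z = h.formW g z w := by
  rw [formW_apply, formW_apply, prodH_symm, real_inner_comm, real_inner_comm (Hval z)]

theorem integrable_V_mul (h : CoreODE d κ f S) (w z : SpaceH) :
    Integrable (fun r => (1 - f r ^ 2) * Hval w r * Hval z r) radialMeasure := by
  refine (integrable_mul h.dV (prodH w z)).congr ?_
  filter_upwards [h.dV_ae, prodH_ae w z] with r h1 h2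
  rw [h1, h2, mul_assoc]

theorem formW_eq_integral (h : CoreODE d κ f S) (g : ℝ) (w z : SpaceH) :
    h.formW g w z = ∫ r, (Hdiff w r * Hdiff z r - κ ^ 2 * (1 - f r ^ 2) * Hval w r * Hval z r)
      ∂radialMeasure + g * κ ^ 2 * ∫ r, Hval w r * Hval z r ∂radialMeasure := by
  have e : ∫ r, (Hdiff w r * Hdiff z r - κ ^ 2 * (1 - f r ^ 2) * Hval w r * Hval z r)
      ∂radialMeasure = ∫ r, (Hdiff w r * Hdiff z r
        - κ ^ 2 * ((1 - f r ^ 2) * Hval w r * Hval z r)) ∂radialMeasure :=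
    integral_congr_ae (Eventually.of_forall fun r => by ring)
  have e2 : ∫ r, h.dV r * prodH w z r ∂radialMeasure
      = ∫ r, (1 - f r ^ 2) * Hval w r * Hval z r ∂radialMeasure := by
    refine integral_congr_ae ?_
    filter_upwards [h.dV_ae, prodH_ae w z] with r h1 h2
    rw [h1, h2, mul_assoc]
  rw [formW_apply, e, integral_sub (integrable_mul _ _) ((h.integrable_V_mul w z).const_mul _),
    integral_const_mul, inner_eq_integral, inner_eq_integral, inner_eq_integral, e2]

/-- The energy is even in m, so at m = 0 the Hessian has no terms mixing w with (u, v). -/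
theorem linForm_inW (h : CoreODE d κ f S) (g : ℝ) (w : SpaceH) (z : SpaceY₀) :
    (h.hess₀ + g • hess₁ κ) (0, 0, w) z = h.formW g w z.2.2 := by
  rw [_root_.add_apply, _root_.smul_apply, _root_.add_apply, _root_.smul_apply, hess₁_apply,
    formW_apply, hess₀]
  simp only [Fin.sum_univ_five, wt, cst, lin, bil, Matrix.cons_val, _root_.add_apply,
    _root_.smul_apply, linPart_apply, ContinuousLinearMap.comp_apply, _root_.sub_apply,
    _root_.neg_apply, projU_apply, projV_apply, projW_apply, inner_zero_left, inner_zero_right,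
    map_zero, _root_.zero_apply, ContinuousLinearMap.bilinearComp_apply, smul_eq_mul, neg_zero,
    add_zero, zero_add, sub_zero, smul_zero, inner_add_right, inner_neg_right,
    prodH_symm z.2.2 w]
  ring

theorem ae_lin_bil (h : CoreODE d κ f S) (y : SpaceY₀) : ∀ᵐ r ∂radialMeasure,
    ∑ i, wt κ i * (h.lin i y r ^ 2 + 2 * (h.cst i r * bil i y y r)) =
      uvDensity κ (d - S r) (f r) (Xval y.1 r) (Xdiff y.1 r) (Xquot y.1 r) (Xval y.2.1 r)
        (Xdiff y.2.1 r) (Xquot y.2.1 r) + 2 * (Xquot y.2.1 r * Xdiff y.2.1 r)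
      + (Hdiff y.2.2 r * Hdiff y.2.2 r - κ ^ 2 * (1 - f r ^ 2) * Hval y.2.2 r * Hval y.2.2 r) := by
  simp only [Fin.sum_univ_five, wt, cst, lin, bil, Matrix.cons_val, ContinuousLinearMap.comp_apply,
    projU_apply, projV_apply, projW_apply, _root_.zero_apply, _root_.add_apply, _root_.sub_apply,
    _root_.neg_apply, _root_.smul_apply, ContinuousLinearMap.bilinearComp_apply]
  filter_upwards [ae_radial_pos, h.dT_ae, h.dV_ae, Lp.coeFn_zero ℝ 2 radialMeasure,
    Lp.coeFn_add (Xquot y.2.1) (Xdiff y.2.1), Xquot_ae y.2.1, Xquot_ae y.1,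
    Lp.coeFn_sub (h.mulT (Xquot y.1)) (h.mulF (Xval y.2.1)), Lp.coeFn_neg (prodX y.1 y.2.1),
    h.mulT_ae (Xquot y.1), h.mulF_ae (Xval y.2.1), prodX_ae y.1 y.2.1,
    Lp.coeFn_neg ((2 : ℝ) • h.mulF (Xval y.1)), Lp.coeFn_smul (2 : ℝ) (h.mulF (Xval y.1)),
    h.mulF_ae (Xval y.1), Lp.coeFn_neg (prodX y.1 y.1 + prodH y.2.2 y.2.2),
    Lp.coeFn_add (prodX y.1 y.1) (prodH y.2.2 y.2.2), prodX_ae y.1 y.1, prodH_ae y.2.2 y.2.2]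
    with r h0 e1 e2 e3 e4 e5 e6 e7 e8 e9 e10 e11 e12 e13 e14 e15 e16 e17 e18
  rw [e1, e2, e3, e4, e7, e8, e12, e15, Pi.add_apply, Pi.sub_apply, Pi.neg_apply, Pi.neg_apply,
    Pi.neg_apply, e9, e10, e11, e13, e16, Pi.add_apply, Pi.smul_apply, e14, e17, e18, Pi.zero_apply,
    e5, e6, uvDensity, smul_eq_mul]
  field_simp
  ring

theorem integrable_sq_bdd_mul {ρ : ℝ → ℝ} (hρ : ContinuousOn ρ (Ioi 0)) {C : ℝ}
    (hC : ∀ r, 0 < r → |ρ r| ≤ C) (a b : RadialL2) :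
    Integrable (fun r => ρ r * (a r * b r)) radialMeasure := by
  refine Integrable.bdd_mul (c := C) (integrable_mul a b) (aestronglyMeasurable_radial hρ) ?_
  filter_upwards [ae_radial_pos] with r hr using hC r hr

theorem integrable_jacobi (h : CoreODE d κ f S) (u : SpaceX) :
    Integrable (fun r => Xdiff u r ^ 2 + ((d - S r) ^ 2 * Xquot u r ^ 2
      - κ ^ 2 * (1 - f r ^ 2) * Xval u r ^ 2)) radialMeasure := by
  have h1 := integrable_sq_bdd_mul (ρ := fun r => (d - S r) ^ 2) (C := (d : ℝ) ^ 2)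
    ((continuousOn_const.sub h.cont_S).pow 2)
    (fun r hr => by rw [abs_of_nonneg (sq_nonneg _)]; exact h.sq_T_le hr) (Xquot u) (Xquot u)
  have h2 := integrable_sq_bdd_mul (ρ := fun r => κ ^ 2 * (1 - f r ^ 2)) (C := κ ^ 2)
    (continuousOn_const.mul (continuousOn_const.sub (h.cont_f.pow 2)))
    (fun r hr => by
      have := h.V_nonneg hr
      rw [abs_of_nonneg (by positivity)]
      exact mul_le_of_le_one_right (sq_nonneg _) (by nlinarith [sq_nonneg (f r)]))
    (Xval u) (Xval u)
  simp only [← sq] at h1 h2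
  exact (integrable_sq _).add (h1.sub h2)

theorem integrable_uvDensity (h : CoreODE d κ f S) (u v : SpaceX) :
    Integrable (fun r => uvDensity κ (d - S r) (f r) (Xval u r) (Xdiff u r) (Xquot u r) (Xval v r)
        (Xdiff v r) (Xquot v r)) radialMeasure := by
  have hi := h.integrable_jacobi u
  have h2 : Integrable (fun r => 2 * κ ^ 2 * h.mulF (Xval u) r ^ 2) radialMeasure :=
    (integrable_sq _).const_mul _
  have h3 : Integrable (fun r => h.mulF (Xval v) r ^ 2) radialMeasure := integrable_sq _
  have h4 : Integrable (fun r => 4 * (h.mulF (Xval u) r * h.mulT (Xquot v) r)) radialMeasure :=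
    (integrable_mul _ _).const_mul _
  have h5 := ((((hi.add h2).add (integrable_sq (Xdiff v))).add (integrable_sq (Xquot v))).add
    h3).sub h4
  refine h5.congr ?_
  filter_upwards [h.mulF_ae (Xval u), h.mulF_ae (Xval v), h.mulT_ae (Xquot v)] with r e1 e2 e3
  simp only [Pi.add_apply, Pi.sub_apply, e1, e2, e3, uvDensity]
  ring

/-- The pointwise density contains the extra term 2(v/r)v', which integrates to zero by
`inner_Xquot_Xdiff`. -/
theorem linForm_self (h : CoreODE d κ f S) (g : ℝ) (y : SpaceY₀) :
    (h.hess₀ + g • hess₁ κ) y y = ∫ r, uvDensity κ (d - S r) (f r) (Xval y.1 r) (Xdiff y.1 r)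
      (Xquot y.1 r) (Xval y.2.1 r) (Xdiff y.2.1 r) (Xquot y.2.1 r) ∂radialMeasure
      + h.formW g y.2.2 y.2.2 := by
  have h1 : h.hess₀ y y
      = ∫ r, ∑ i, wt κ i * (h.lin i y r ^ 2 + 2 * (h.cst i r * bil i y y r)) ∂radialMeasure := by
    rw [integral_finsetSum]
    · simp only [hess₀, _root_.sum_apply, _root_.smul_apply, linPart_apply]
      refine Finset.sum_congr rfl fun i _ => ?_
      rw [integral_const_mul, integral_add (integrable_sq _) ((integrable_mul _ _).const_mul _),
        integral_const_mul, ← norm_sq_eq_integral, ← inner_eq_integral, real_inner_self_eq_norm_sq,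
        inner_add_right, smul_eq_mul]
      ring
    · exact fun i _ => ((integrable_sq _).add ((integrable_mul _ _).const_mul _)).const_mul _
  have hw : Integrable (fun r => Hdiff y.2.2 r * Hdiff y.2.2 r
      - κ ^ 2 * (1 - f r ^ 2) * Hval y.2.2 r * Hval y.2.2 r) radialMeasure := by
    refine ((integrable_mul (Hdiff y.2.2) (Hdiff y.2.2)).sub
      ((h.integrable_V_mul y.2.2 y.2.2).const_mul (κ ^ 2))).congr (Eventually.of_forall fun r => ?_)
    simp only [Pi.sub_apply]; ring
  have huv := h.integrable_uvDensity y.1 y.2.1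
  have hx : Integrable (fun r => 2 * (Xquot y.2.1 r * Xdiff y.2.1 r)) radialMeasure :=
    (integrable_mul _ _).const_mul _
  rw [_root_.add_apply, _root_.smul_apply, _root_.add_apply, _root_.smul_apply, hess₁_apply, h1,
    integral_congr_ae (h.ae_lin_bil y), integral_add (by exact huv.add hx) hw,
    integral_add huv hx, integral_const_mul, ← inner_eq_integral, inner_Xquot_Xdiff,
    formW_eq_integral, inner_eq_integral, smul_eq_mul]
  ring

/-- The Jacobi form is nonnegative and the rest P is a sum of nonnegative terms, so it suffices that
P = 0 forces u = v = 0. -/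
theorem uvForm_pos (h : CoreODE d κ f S) {u v : SpaceX} (huv : ¬ (u = 0 ∧ v = 0)) :
    0 < ∫ r, uvDensity κ (d - S r) (f r) (Xval u r) (Xdiff u r)
      (Xquot u r) (Xval v r) (Xdiff v r) (Xquot v r) ∂radialMeasure := by
  set P : ℝ → ℝ := fun r => Xdiff v r ^ 2 + f r ^ 2 * Xval v r ^ 2
    + (Xquot v r - 2 * (d - S r) * f r * Xval u r) ^ 2
    + (2 * κ ^ 2 - 4 * (d - S r) ^ 2) * (f r ^ 2 * Xval u r ^ 2) with hP
  have hD := h.integrable_uvDensity u v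
  have hJ := h.integrable_jacobi u
  have hPi : Integrable P radialMeasure := by
    refine (hD.sub hJ).congr (Eventually.of_forall fun r => ?_)
    simp only [Pi.sub_apply, uvDensity_eq, hP]
    ring
  have hsplit : ∫ r, uvDensity κ (d - S r) (f r) (Xval u r) (Xdiff u r)
      (Xquot u r) (Xval v r) (Xdiff v r) (Xquot v r) ∂radialMeasure
      = ∫ r, (Xdiff u r ^ 2 + ((d - S r) ^ 2 * Xquot u r ^ 2
      - κ ^ 2 * (1 - f r ^ 2) * Xval u r ^ 2)) ∂radialMeasure + ∫ r, P r ∂radialMeasure := by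
    rw [← integral_add hJ hPi]
    exact integral_congr_ae (Eventually.of_forall fun r => uvDensity_eq _ _ _ _ _ _ _ _ _)
  have hcoef : ∀ r, 0 < r → 0 ≤ 2 * κ ^ 2 - 4 * (d - S r) ^ 2 := fun r hr => by
    linarith [h.sq_T_le hr, h.hκ]
  have hP0 : 0 ≤ᵐ[radialMeasure] P := by
    filter_upwards [ae_radial_pos] with r hr
    have := hcoef r hr
    simp only [hP, Pi.zero_apply]
    positivity
  have hJ0 := h.jacobi_nonneg u
  have hPp : 0 < ∫ r, P r ∂radialMeasure := by
    refine (integral_nonneg_of_ae hP0).lt_of_ne' fun h0 => huv ?_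
    have hz := (integral_eq_zero_iff_of_nonneg_ae hP0 hPi).1 h0
    have hzero : ∀ᵐ r ∂radialMeasure, Xval u r = 0 ∧ Xval v r = 0 := by
      filter_upwards [hz, ae_radial_pos, Xquot_ae v] with r hr h0 hq
      have hf := h.f_pos h0
      simp only [hP, Pi.zero_apply] at hr
      have h1 : 0 ≤ Xdiff v r ^ 2 := sq_nonneg _
      have h2 : 0 ≤ f r ^ 2 * Xval v r ^ 2 := by positivity
      have h3 : 0 ≤ (Xquot v r - 2 * (d - S r) * f r * Xval u r) ^ 2 := sq_nonneg _
      have h4 : 0 ≤ (2 * κ ^ 2 - 4 * (d - S r) ^ 2) * (f r ^ 2 * Xval u r ^ 2) :=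
        mul_nonneg (hcoef r h0) (by positivity)
      have e2 : f r ^ 2 * Xval v r ^ 2 = 0 := by linarith
      have e3 : (Xquot v r - 2 * (d - S r) * f r * Xval u r) ^ 2 = 0 := by linarith
      have e4 : (2 * κ ^ 2 - 4 * (d - S r) ^ 2) * (f r ^ 2 * Xval u r ^ 2) = 0 := by linarith
      have hv : Xval v r = 0 := by
        rcases mul_eq_zero.1 e2 with e | e
        · exact absurd e (by positivity)
        · exact pow_eq_zero_iff two_ne_zero |>.1 e
      rw [hq, hv, zero_div, zero_sub] at e3
      -- The coefficient 2κ² - 4T² may vanish when κ² = 2d². Once v = 0, the square (v/r - 2Tfu)²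
      -- equals 4T²f²u² and restores the full 2κ²f²u².
      have e5 : κ ^ 2 * (f r ^ 2 * Xval u r ^ 2) = 0 := by linear_combination e4 / 2 + e3 / 2
      have hκ := h.two_le_κ_sq
      rcases mul_eq_zero.1 e5 with e | e
      · linarith
      · rcases mul_eq_zero.1 e with e | e
        · exact absurd e (by positivity)
        · exact ⟨pow_eq_zero_iff two_ne_zero |>.1 e, hv⟩
    have hz := Lp.coeFn_zero ℝ 2 radialMeasure
    refine ⟨X_eq_zero_of_Xval (Lp.ext ?_), X_eq_zero_of_Xval (Lp.ext ?_)⟩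
    · filter_upwards [hzero, hz] with r h1 h2 using by rw [h1.1, h2, Pi.zero_apply]
    · filter_upwards [hzero, hz] with r h1 h2 using by rw [h1.2, h2, Pi.zero_apply]
  rw [hsplit]
  linarith

theorem uvForm_lower (h : CoreODE d κ f S) : ∃ R > 0, ∃ C > 0, ∀ u v : SpaceX,
    1 / 4 * (‖u‖ ^ 2 + ‖v‖ ^ 2) ≤ ∫ r, uvDensity κ (d - S r) (f r) (Xval u r) (Xdiff u r)
      (Xquot u r) (Xval v r) (Xdiff v r) (Xquot v r) ∂radialMeasure
      + C * (∫ r in Iic R, Xval u r ^ 2 ∂radialMeasure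
        + ∫ r in Iic R, Xval v r ^ 2 ∂radialMeasure) := by
  obtain ⟨δ, hδ, hT⟩ := h.exists_delta
  -- R is chosen to meet the hypotheses of `uvDensity_outer_le`: 1 - f² < 1/4, r ≥ 1 and r ≥ 8|d|.
  obtain ⟨R, hR⟩ := ((h.tendsto_f.eventually (gt_mem_nhds (show (0 : ℝ) < 1 / 4 by norm_num))).and
    (eventually_ge_atTop (max 1 (8 * |(d : ℝ)|)))).exists_forall_of_atTop
  have hR1 : max 1 (8 * |(d : ℝ)|) ≤ R := (hR R le_rfl).2
  refine ⟨R, by linarith [le_max_left 1 (8 * |(d : ℝ)|)], κ ^ 2 + 8 * |(d : ℝ)| ^ 2 + 1 + 1 / δ ^ 2,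
    by positivity, fun u v => ?_⟩
  set C := κ ^ 2 + 8 * |(d : ℝ)| ^ 2 + 1 + 1 / δ ^ 2 with hC
  have hC0 : 0 < C := by positivity
  have hi : ∀ u : SpaceX, Integrable ((Iic R).indicator fun r => Xval u r ^ 2) radialMeasure :=
    fun u => (integrable_sq _).indicator measurableSet_Iic
  have hn : 1 / 4 * (‖u‖ ^ 2 + ‖v‖ ^ 2) = ∫ r, 1 / 4 * (Xval u r ^ 2 + Xdiff u r ^ 2 + Xquot u r ^ 2
      + (Xval v r ^ 2 + Xdiff v r ^ 2 + Xquot v r ^ 2)) ∂radialMeasure := by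
    have hs : ∀ u : SpaceX, Integrable (fun r => Xval u r ^ 2 + Xdiff u r ^ 2 + Xquot u r ^ 2)
      radialMeasure := fun u => ((integrable_sq _).add (integrable_sq _)).add (integrable_sq _)
    have hs' : ∀ u : SpaceX, ‖u‖ ^ 2 = ∫ r, (Xval u r ^ 2 + Xdiff u r ^ 2 + Xquot u r ^ 2)
        ∂radialMeasure := fun u => by
      rw [integral_add (by exact (integrable_sq _).add (integrable_sq _)) (integrable_sq _),
        integral_add (integrable_sq _) (integrable_sq _), norm_sq_X, norm_sq_eq_integral,
        norm_sq_eq_integral, norm_sq_eq_integral]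
    rw [integral_const_mul, integral_add (hs u) (hs v), hs', hs']
  rw [hn, ← integral_indicator measurableSet_Iic, ← integral_indicator measurableSet_Iic,
    ← integral_add (hi u) (hi v), ← integral_const_mul, ← integral_add (h.integrable_uvDensity u v)
      (by exact ((hi u).add (hi v)).const_mul C)]
  refine integral_mono_ae ?_ ((h.integrable_uvDensity u v).add
    (((hi u).add (hi v)).const_mul C)) ?_
  · exact ((((integrable_sq _).add (integrable_sq _)).add (integrable_sq _)).add
      (((integrable_sq _).add (integrable_sq _)).add (integrable_sq _))).const_mul _
  · filter_upwards [ae_radial_pos, Xquot_ae u, Xquot_ae v] with r h0 hu hv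
    have hu' : Xval u r = r * Xquot u r := by rw [hu]; field_simp
    have hv' : Xval v r = r * Xquot v r := by rw [hv]; field_simp
    have hTd : |d - S r| ≤ |(d : ℝ)| := sq_le_sq.1 (h.sq_T_le h0)
    have hf0 := h.f_nonneg r h0
    have hf1 := h.f_le_one h0
    by_cases hr : r ≤ R
    · rw [indicator_of_mem (show r ∈ Iic R from hr), indicator_of_mem (show r ∈ Iic R from hr)]
      exact uvDensity_inner_le hTd hf0 hf1 hδ (hT r h0) hu'
    · rw [indicator_of_notMem (show r ∉ Iic R from hr), indicator_of_notMem (show r ∉ Iic R from hr),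
        add_zero, mul_zero, add_zero]
      have hRr : R ≤ r := (not_le.1 hr).le
      exact uvDensity_outer_le h.two_le_κ_sq hTd hf0 hf1 ((le_max_left _ _).trans (hR1.trans hRr))
        ((le_max_right _ _).trans (hR1.trans hRr)) (hR r hRr).1.le hu' hv'

/-- Beyond R the potential 1 - f² is below g/2, so half of the mass term gκ²w² survives there;
inside, 1 - f² ≤ 1 costs at most κ² times the local L² norm. -/
theorem formW_lower (h : CoreODE d κ f S) {g : ℝ} (hg : 0 < g) : ∃ R > 0, ∃ c > 0, ∀ w : SpaceH,
    c * ‖w‖ ^ 2 ≤ h.formW g w w + κ ^ 2 * ∫ r in Iic R, Hval w r ^ 2 ∂radialMeasure := by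
  obtain ⟨R, hR⟩ := ((h.tendsto_f.eventually (gt_mem_nhds (show (0 : ℝ) < g / 2 by linarith))).and
    (eventually_ge_atTop 1)).exists_forall_of_atTop
  have hκ := h.two_le_κ_sq
  refine ⟨R, by linarith [(hR R le_rfl).2], min 1 (g / 2), by positivity, fun w => ?_⟩
  have hi : Integrable ((Iic R).indicator fun r => Hval w r ^ 2) radialMeasure :=
    (integrable_sq _).indicator measurableSet_Iic
  have hV : Integrable (fun r => κ ^ 2 * ((1 - f r ^ 2) * Hval w r * Hval w r)) radialMeasure :=
    (h.integrable_V_mul w w).const_mul _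
  have h1 : κ ^ 2 * ∫ r, (1 - f r ^ 2) * Hval w r * Hval w r ∂radialMeasure
      ≤ κ ^ 2 * (∫ r in Iic R, Hval w r ^ 2 ∂radialMeasure + g / 2 * ‖Hval w‖ ^ 2) := by
    refine mul_le_mul_of_nonneg_left ?_ (sq_nonneg κ)
    rw [norm_sq_eq_integral, ← integral_const_mul, ← integral_indicator measurableSet_Iic,
      ← integral_add hi ((integrable_sq _).const_mul _)]
    refine integral_mono_ae (h.integrable_V_mul w w) (hi.add ((integrable_sq _).const_mul _)) ?_
    filter_upwards [ae_radial_pos] with r h0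
    by_cases hr : r ≤ R
    · rw [indicator_of_mem (show r ∈ Iic R from hr)]
      nlinarith [sq_nonneg (f r * Hval w r), sq_nonneg (Hval w r)]
    · rw [indicator_of_notMem (show r ∉ Iic R from hr), zero_add]
      have := (hR r (not_le.1 hr).le).1
      nlinarith [sq_nonneg (Hval w r)]
  have h2 : ∫ r, h.dV r * prodH w w r ∂radialMeasure
      = ∫ r, (1 - f r ^ 2) * Hval w r * Hval w r ∂radialMeasure := by
    refine integral_congr_ae ?_
    filter_upwards [h.dV_ae, prodH_ae w w] with r h1 h2
    rw [h1, h2, mul_assoc]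
  rw [formW_apply, inner_eq_integral h.dV, h2, real_inner_self_eq_norm_sq,
    real_inner_self_eq_norm_sq, norm_sq_H]
  have h3 := mul_le_mul_of_nonneg_right (min_le_left 1 (g / 2)) (sq_nonneg ‖Hdiff w‖)
  have h4 := mul_le_mul_of_nonneg_right (min_le_right 1 (g / 2)) (sq_nonneg ‖Hval w‖)
  have h5 : g * ‖Hval w‖ ^ 2 ≤ κ ^ 2 / 2 * (g * ‖Hval w‖ ^ 2) :=
    le_mul_of_one_le_left (by positivity) (by linarith)
  nlinarith [mul_nonneg hg.le (sq_nonneg ‖Hval w‖)]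

end CoreODE

/-! ### Point evaluations in place of compactness -/

/-- An element of `H` from a locally absolutely continuous function. -/
theorem HasPrim.exists_H {U p : ℝ → ℝ} (h : HasPrim U p) (hU : MemLp U 2 radialMeasure)
    (hp : MemLp p 2 radialMeasure) : ∃ w : SpaceH, (∀ᵐ r ∂radialMeasure, Hval w r = U r) ∧
      (∀ᵐ r ∂radialMeasure, Hdiff w r = p r) ∧ ∀ x, 0 < x → Hrep w x = U x := by
  obtain ⟨A, hA⟩ : ∃ A : RadialL2, ∀ᵐ r ∂radialMeasure, A r = U r := ⟨hU.toLp, hU.coeFn_toLp⟩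
  obtain ⟨B, hB⟩ : ∃ B : RadialL2, ∀ᵐ r ∂radialMeasure, B r = p r := ⟨hp.toLp, hp.coeFn_toLp⟩
  have hw : HasWeakDeriv A B := by
    intro φ hφ hc hs
    have e1 : ∫ r in Ioi (0 : ℝ), A r * deriv φ r = ∫ r in Ioi (0 : ℝ), U r * deriv φ r :=
      integral_congr_ae (by filter_upwards [ae_of_ae_radial hA] with r hr; rw [hr])
    have e2 : ∫ r in Ioi (0 : ℝ), B r * φ r = ∫ r in Ioi (0 : ℝ), p r * φ r :=
      integral_congr_ae (by filter_upwards [ae_of_ae_radial hB] with r hr; rw [hr])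
    rw [e1, e2]
    exact h.hasWeakDeriv φ hφ hc hs
  refine ⟨mkH A B hw, hA, hB, (Hrep_hasPrim _).eq_of_ae_eq h ?_⟩
  filter_upwards [Hrep_ae (mkH A B hw), ae_radial_iff.1 hA] with r hr hr' h0
  rw [← hr h0, Hval_mkH, hr' h0]

theorem Hrep_add (w z : SpaceH) {x : ℝ} (hx : 0 < x) : Hrep (w + z) x = Hrep w x + Hrep z x := by
  refine (Hrep_hasPrim (w + z)).eq_of_ae_eq ((Hrep_hasPrim w).add (Hrep_hasPrim z)) ?_ x hx
  filter_upwards [Hrep_ae (w + z), Hrep_ae w, Hrep_ae z,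
    ae_radial_iff.1 (Lp.coeFn_add (Hval w) (Hval z))] with r h1 h2 h3 h4 h0
  rw [← h1 h0, ← h2 h0, ← h3 h0, map_add, h4 h0, Pi.add_apply]

theorem Hrep_smul (c : ℝ) (w : SpaceH) {x : ℝ} (hx : 0 < x) : Hrep (c • w) x = c * Hrep w x := by
  refine (Hrep_hasPrim (c • w)).eq_of_ae_eq ((Hrep_hasPrim w).const_mul c) ?_ x hx
  filter_upwards [Hrep_ae (c • w), Hrep_ae w,
    ae_radial_iff.1 (Lp.coeFn_smul c (Hval w))] with r h1 h2 h3 h0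
  rw [← h1 h0, ← h2 h0, map_smul, h3 h0, Pi.smul_apply, smul_eq_mul]

/-- Evaluation of elements of `H` at a positive radius. -/
def evalH (x : ℝ) (hx : 0 < x) : SpaceH →L[ℝ] ℝ :=
  LinearMap.mkContinuous
    { toFun := fun w => Hrep w x
      map_add' := fun w z => Hrep_add w z hx
      map_smul' := fun c w => Hrep_smul c w hx } (1 / √x) (by
    intro w
    have h1 := mul_Hrep_sq_le w hx
    have hs := Real.sqrt_pos.2 hx
    rw [LinearMap.coe_mk, AddHom.coe_mk, one_div_mul_eq_div, le_div_iff₀ hs, Real.norm_eq_abs]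
    refine abs_le_of_sq_le_sq' ?_ (norm_nonneg _) |>.2
    rw [mul_pow, sq_abs, Real.sq_sqrt hx.le]
    linarith)

theorem evalH_apply (x : ℝ) (hx : 0 < x) (w : SpaceH) : evalH x hx w = Hrep w x := rfl

/-- Cauchy-Schwarz, obtained by expanding ∫ (w' - c)² ≥ 0 with c the mean slope; the weight is at
least δ on [x, y]. -/
theorem sq_Hrep_sub_le (w : SpaceH) {δ x y : ℝ} (hδ : 0 < δ) (hx : δ ≤ x) (hxy : x ≤ y) :
    (Hrep w y - Hrep w x) ^ 2 ≤ (y - x) / δ * ‖w‖ ^ 2 := by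
  rcases hxy.eq_or_lt with rfl | hxy
  · simp
  have hx0 := hδ.trans_le hx
  have hy0 := hx0.trans hxy
  have hp := (Hrep_hasPrim w).locInt x y hx0 hy0
  have hsub := (Hrep_hasPrim w).sub_eq x y hx0 hy0
  have hon : IntegrableOn (fun r => Hdiff w r ^ 2) (Ioi (δ / 2)) :=
    IntegrableOn.of_mul_self (integrableOn_sq_mul _) (by linarith)
  have hIoc : Ioc x y ⊆ Ioi (δ / 2) := fun t ht => by
    have := ht.1; simp only [mem_Ioi]; linarith
  have hp2 : IntervalIntegrable (fun r => Hdiff w r ^ 2) volume x y :=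
    (intervalIntegrable_iff_integrableOn_Ioc_of_le hxy.le).2 (hon.mono_set hIoc)
  have h1 : ∫ t in x..y, Hdiff w t ^ 2 ≤ 1 / δ * ‖w‖ ^ 2 := by
    have hi : IntegrableOn (fun t => 1 / δ * (Hdiff w t ^ 2 * t)) (Ioi 0) :=
      (integrableOn_sq_mul (Hdiff w)).const_mul (1 / δ)
    have hsub' : Ioc x y ⊆ Ioi 0 := fun t ht => hx0.trans ht.1
    calc ∫ t in x..y, Hdiff w t ^ 2 ≤ ∫ t in Ioc x y, 1 / δ * (Hdiff w t ^ 2 * t) := by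
          rw [intervalIntegral.integral_of_le hxy.le]
          refine setIntegral_mono_on (hon.mono_set hIoc) (hi.mono_set hsub')
            measurableSet_Ioc fun t ht => ?_
          have ht' : δ ≤ t := hx.trans ht.1.le
          rw [one_div_mul_eq_div, le_div_iff₀ hδ]
          exact mul_le_mul_of_nonneg_left ht' (sq_nonneg _)
      _ ≤ ∫ t in Ioi 0, 1 / δ * (Hdiff w t ^ 2 * t) := by
          refine setIntegral_mono_set hi ?_ (Eventually.of_forall hsub')
          filter_upwards [ae_restrict_mem measurableSet_Ioi] with t ht
          have ht' : (0 : ℝ) < t := ht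
          simp only [Pi.zero_apply]
          positivity
      _ = 1 / δ * ‖Hdiff w‖ ^ 2 := by
          rw [integral_const_mul, norm_sq_eq_integral, integral_radial]
      _ ≤ 1 / δ * ‖w‖ ^ 2 := by
          rw [norm_sq_H]
          exact mul_le_mul_of_nonneg_left (by linarith [sq_nonneg ‖Hval w‖]) (by positivity)
  set Δ := Hrep w y - Hrep w x with hΔ
  set c := Δ / (y - x) with hc
  have hyx : 0 < y - x := by linarith
  have h2 : 0 ≤ ∫ t in x..y, (Hdiff w t - c) ^ 2 :=
    intervalIntegral.integral_nonneg hxy.le fun t _ => sq_nonneg _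
  have h3 : ∫ t in x..y, (Hdiff w t - c) ^ 2
      = (∫ t in x..y, Hdiff w t ^ 2) - 2 * c * Δ + c ^ 2 * (y - x) := by
    have e : ∀ t, (Hdiff w t - c) ^ 2 = Hdiff w t ^ 2 - 2 * c * Hdiff w t + c ^ 2 := fun t => by ring
    simp_rw [e]
    rw [intervalIntegral.integral_add (hp2.sub (hp.const_mul _)) intervalIntegrable_const,
      intervalIntegral.integral_sub hp2 (hp.const_mul _), intervalIntegral.integral_const_mul,
      ← hsub, intervalIntegral.integral_const, smul_eq_mul]
    ring
  have h4 : Δ ^ 2 / (y - x) ≤ ∫ t in x..y, Hdiff w t ^ 2 := by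
    have : (∫ t in x..y, Hdiff w t ^ 2) - 2 * c * Δ + c ^ 2 * (y - x)
        = (∫ t in x..y, Hdiff w t ^ 2) - Δ ^ 2 / (y - x) := by
      rw [hc]; field_simp; ring
    linarith
  have h5 := h4.trans h1
  rw [div_le_iff₀ hyx] at h5
  calc Δ ^ 2 ≤ 1 / δ * ‖w‖ ^ 2 * (y - x) := h5
    _ = (y - x) / δ * ‖w‖ ^ 2 := by ring

/-- On bounded sets of radii, the `L²_r` norm is controlled by finitely many evaluations up to a
small multiple of the norm of `H`. -/
theorem exists_finite_functionals {R ε : ℝ} (hR : 0 < R) (hε : 0 < ε) :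
    ∃ (N : ℕ) (l : SpaceH →L[ℝ] (Fin N → ℝ)) (K : ℝ), 0 ≤ K ∧ ∀ w : SpaceH,
      ∫ r in Iic R, Hval w r ^ 2 ∂radialMeasure ≤ ε * ‖w‖ ^ 2 + K * ‖l w‖ ^ 2 := by
  -- Half of ε pays for (0, δ], where rW² ≤ ‖w‖². The mesh η is set so that the Hölder error
  -- 2R²(η/δ)‖w‖² on (δ, R] is the other half.
  set δ := ε / 2 with hδ
  have hδ0 : 0 < δ := by positivity
  set η := ε * δ / (4 * R ^ 2) with hη
  have hη0 : 0 < η := by positivity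
  obtain ⟨N, hN⟩ := exists_nat_gt (R / η)
  have hx : ∀ i : Fin N, 0 < δ + i * η := fun i => by positivity
  refine ⟨N, ContinuousLinearMap.pi fun i => evalH _ (hx i), 2 * R ^ 2, by positivity, fun w => ?_⟩
  set l := ‖ContinuousLinearMap.pi (fun i => evalH _ (hx i)) w‖ with hl
  -- Compare W(r) with its value at the nearest grid point to the left.
  have hgrid : ∀ r, δ < r → r ≤ R → Hrep w r ^ 2 ≤ 2 * l ^ 2 + 2 * (η / δ * ‖w‖ ^ 2) := by
    intro r hr hrR
    set i := ⌊(r - δ) / η⌋₊ with hi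
    have h0 : 0 ≤ (r - δ) / η := div_nonneg (by linarith) hη0.le
    have h1 : (i : ℝ) * η ≤ r - δ := (le_div_iff₀ hη0).1 (Nat.floor_le h0)
    have h2 : r - δ < (i + 1) * η := (div_lt_iff₀ hη0).1 (Nat.lt_floor_add_one _)
    have hiN : i < N := by
      have h3 : (i : ℝ) ≤ R / η := by rw [le_div_iff₀ hη0]; linarith
      exact_mod_cast h3.trans_lt hN
    have h3 := sq_Hrep_sub_le w hδ0 (x := δ + i * η) (y := r)
      (le_add_of_nonneg_right (by positivity)) (by linarith)
    have h4 : (r - (δ + i * η)) / δ * ‖w‖ ^ 2 ≤ η / δ * ‖w‖ ^ 2 := by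
      gcongr
      linarith
    have h5 : Hrep w (δ + i * η) ^ 2 ≤ l ^ 2 := by
      have := norm_le_pi_norm (ContinuousLinearMap.pi (fun i => evalH _ (hx i)) w) ⟨i, hiN⟩
      rw [ContinuousLinearMap.pi_apply, evalH_apply, Real.norm_eq_abs] at this
      rw [← sq_abs]
      exact pow_le_pow_left₀ (abs_nonneg _) this 2
    nlinarith [sq_nonneg (Hrep w r - 2 * Hrep w (δ + i * η))]
  set M := R * (2 * l ^ 2 + 2 * (η / δ * ‖w‖ ^ 2)) with hM
  have hM0 : 0 ≤ M := by positivity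
  have e1 : ∫ r in Iic R, Hval w r ^ 2 ∂radialMeasure
      = ∫ r in Ioc 0 R, Hval w r ^ 2 * r := by
    rw [← integral_indicator measurableSet_Iic, integral_radial,
      ← integral_indicator measurableSet_Ioi, ← integral_indicator measurableSet_Ioc]
    congr 1
    ext r
    by_cases h1 : 0 < r <;> by_cases h2 : r ≤ R <;> simp [indicator, h1, h2]
  rw [e1]
  have hint := (integrableOn_sq_mul (Hval w)).mono_set (Ioc_subset_Ioi_self : Ioc 0 R ⊆ Ioi 0)
  have hconst : IntegrableOn (fun _ => M) (Ioc 0 R) := by simp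
  have hind : IntegrableOn ((Ioc 0 δ).indicator fun _ => ‖w‖ ^ 2) (Ioc 0 R) := by
    refine (Integrable.indicator ?_ measurableSet_Ioc)
    exact integrableOn_const (by simp)
  calc ∫ r in Ioc 0 R, Hval w r ^ 2 * r
      ≤ ∫ r in Ioc 0 R, ((Ioc 0 δ).indicator (fun _ => ‖w‖ ^ 2) r + M) := by
        refine integral_mono_ae hint (hind.add hconst) ?_
        filter_upwards [ae_restrict_mem measurableSet_Ioc, ae_restrict_of_ae (Hrep_ae w)]
          with r hr hW
        rw [hW hr.1]
        by_cases hrd : r ≤ δ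
        · rw [indicator_of_mem (show r ∈ Ioc 0 δ from ⟨hr.1, hrd⟩)]
          linarith [mul_Hrep_sq_le w hr.1]
        · rw [indicator_of_notMem (fun h => hrd h.2), zero_add, hM, mul_comm]
          exact mul_le_mul hr.2 (hgrid r (not_le.1 hrd) hr.2) (sq_nonneg _) hR.le
    _ ≤ δ * ‖w‖ ^ 2 + R * M := by
        rw [integral_add hind hconst]
        refine add_le_add ?_ (le_of_eq ?_)
        · calc ∫ r in Ioc 0 R, (Ioc 0 δ).indicator (fun _ => ‖w‖ ^ 2) r
              ≤ ∫ r, (Ioc 0 δ).indicator (fun _ => ‖w‖ ^ 2) r := by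
                refine setIntegral_le_integral ?_ (Eventually.of_forall fun r => ?_)
                · rw [integrable_indicator_iff measurableSet_Ioc]
                  exact integrableOn_const (by simp)
                · exact indicator_nonneg (fun _ _ => sq_nonneg _) r
            _ = δ * ‖w‖ ^ 2 := by
                rw [integral_indicator measurableSet_Ioc]
                simp [hδ0.le]
        · simp [hR.le]
    _ = ε * ‖w‖ ^ 2 + 2 * R ^ 2 * l ^ 2 := by
        rw [hM, hη, hδ]
        field_simp
        ring

/-! ### The threshold g*: positivity and attainment -/

theorem apply_eq_zero_of_nonneg {E : Type*} [NormedAddCommGroup E] [NormedSpace ℝ E]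
    (Q : E →L[ℝ] E →L[ℝ] ℝ) (hsymm : ∀ x y, Q x y = Q y x) (hQ : ∀ x, 0 ≤ Q x x) {x : E}
    (hx : Q x x = 0) (y : E) : Q x y = 0 := by
  have key : ∀ t : ℝ, 0 ≤ 2 * t * Q x y + t ^ 2 * Q y y := fun t => by
    have h1 := hQ (x + t • y)
    simp only [map_add, map_smul, _root_.add_apply, _root_.smul_apply, smul_eq_mul, hx,
      hsymm y x] at h1
    linarith
  by_contra hne
  -- Nearly the minimizer of the quadratic in t; the added 1 keeps the denominator positive when Q y
  -- y = 0.
  have h1 := key (-(Q x y / (Q y y + 1)))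
  have h0 := hQ y
  have h2 : 0 < Q y y + 1 := by linarith
  have h3 : 2 * -(Q x y / (Q y y + 1)) * Q x y + (-(Q x y / (Q y y + 1))) ^ 2 * Q y y
      = -(Q x y ^ 2 * (Q y y + 2)) / (Q y y + 1) ^ 2 := by
    field_simp
    ring
  rw [h3] at h1
  have h4 : 0 < Q x y ^ 2 * (Q y y + 2) / (Q y y + 1) ^ 2 := by positivity
  rw [neg_div] at h1
  linarith

theorem norm_Hval_pos {w : SpaceH} (hw : w ≠ 0) : 0 < ‖Hval w‖ :=
  norm_pos_iff.2 fun h => hw (H_eq_zero_of_Hval h)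

theorem norm_Hval_le (w : SpaceH) : ‖Hval w‖ ^ 2 ≤ ‖w‖ ^ 2 := by
  rw [norm_sq_H]; linarith [sq_nonneg ‖Hdiff w‖]

/-- The function `exp (-r ^ ε)`. -/
def expFn (ε r : ℝ) : ℝ := Real.exp (-r ^ ε)

theorem hasDerivAt_expFn {ε r : ℝ} (hr : 0 < r) :
    HasDerivAt (expFn ε) (-(ε * r ^ (ε - 1) * Real.exp (-r ^ ε))) r := by
  refine ((Real.hasDerivAt_rpow_const (p := ε) (Or.inl hr.ne')).fun_neg.exp).congr_deriv ?_
  ring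

theorem expFn_hasPrim (ε : ℝ) :
    HasPrim (expFn ε) (fun r => -(ε * r ^ (ε - 1) * Real.exp (-r ^ ε))) := by
  refine HasPrim.of_hasDerivAt (fun r hr => hasDerivAt_expFn hr) ?_
  have h1 : ∀ p : ℝ, ContinuousOn (fun r : ℝ => r ^ p) (Ioi 0) := fun p =>
    continuousOn_id.rpow_const fun r hr => Or.inl (ne_of_gt hr)
  exact ((continuousOn_const.mul (h1 _)).mul (Real.continuous_exp.comp_continuousOn (h1 ε).neg)).neg

/-- The integrand is ε² r^{2ε-1} exp(-2r^ε), and the Gamma integral gives ε² · ε⁻¹ · 2⁻² Γ(2). The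
Dirichlet energy thus tends to 0 with ε while the functions tend to a positive constant: the
two-dimensional mechanism behind binding by weak potentials. -/
theorem integral_expFn_deriv {ε : ℝ} (hε : 0 < ε) :
    IntegrableOn (fun r => (-(ε * r ^ (ε - 1) * Real.exp (-r ^ ε))) ^ 2 * r) (Ioi 0) ∧
    ∫ r in Ioi 0, (-(ε * r ^ (ε - 1) * Real.exp (-r ^ ε))) ^ 2 * r = ε / 4 := by
  have e : ∀ r ∈ Ioi (0 : ℝ), (-(ε * r ^ (ε - 1) * Real.exp (-r ^ ε))) ^ 2 * r
      = ε ^ 2 * (r ^ (2 * ε - 1) * Real.exp (-2 * r ^ ε)) := fun r hr => by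
    have hr' : (0 : ℝ) < r := hr
    have h1 : r ^ (2 * ε - 1) = (r ^ (ε - 1)) ^ 2 * r := by
      rw [← Real.rpow_natCast, ← Real.rpow_mul hr'.le]
      nth_rw 3 [← Real.rpow_one r]
      rw [← Real.rpow_add hr']
      congr 1; push_cast; ring
    have h2 : Real.exp (-2 * r ^ ε) = Real.exp (-r ^ ε) ^ 2 := by
      rw [← Real.exp_nat_mul]; congr 1; push_cast; ring
    rw [h1, h2]; ring
  have hi : IntegrableOn (fun r : ℝ => r ^ (2 * ε - 1) * Real.exp (-2 * r ^ ε)) (Ioi 0) :=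
    integrableOn_rpow_mul_exp_neg_mul_rpow (by linarith) hε (by norm_num)
  refine ⟨IntegrableOn.congr_fun (hi.const_mul (ε ^ 2)) (fun r hr => (e r hr).symm)
    measurableSet_Ioi, ?_⟩
  rw [setIntegral_congr_fun measurableSet_Ioi e, integral_const_mul,
    integral_rpow_mul_exp_neg_mul_rpow hε (by linarith) (by norm_num)]
  have h1 : (2 * ε - 1 + 1) / ε = 2 := by field_simp; ring
  have h2 : -(2 * ε - 1 + 1) / ε = -2 := by field_simp; ring
  rw [h1, h2, Real.Gamma_two, Real.rpow_neg (by norm_num)]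
  norm_num
  field_simp

theorem integrableOn_expFn {ε : ℝ} (hε : 0 < ε) :
    IntegrableOn (fun r => expFn ε r ^ 2 * r) (Ioi 0) := by
  have hi : IntegrableOn (fun r : ℝ => r ^ (1 : ℝ) * Real.exp (-2 * r ^ ε)) (Ioi 0) :=
    integrableOn_rpow_mul_exp_neg_mul_rpow (by norm_num) hε (by norm_num)
  refine hi.congr_fun (fun r hr => ?_) measurableSet_Ioi
  have h2 : Real.exp (-2 * r ^ ε) = Real.exp (-r ^ ε) ^ 2 := by
    rw [← Real.exp_nat_mul]; congr 1; push_cast; ring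
  simp only [expFn, Real.rpow_one, h2]
  ring

theorem exists_H_expFn {ε : ℝ} (hε : 0 < ε) : ∃ w : SpaceH,
    (∀ᵐ r ∂radialMeasure, Hval w r = expFn ε r) ∧ ‖Hdiff w‖ ^ 2 = ε / 4 := by
  have hp := expFn_hasPrim ε
  have hm : AEStronglyMeasurable (fun r => -(ε * r ^ (ε - 1) * Real.exp (-r ^ ε))) radialMeasure :=
    (by fun_prop : Measurable fun r : ℝ => -(ε * r ^ (ε - 1) * Real.exp (-r ^ ε))).aestronglyMeasurable
  obtain ⟨w, h1, h2, -⟩ := hp.exists_H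
    ((memLp_two_iff_integrable_sq (aestronglyMeasurable_radial hp.continuousOn)).2
      (integrable_radial_iff.2 (integrableOn_expFn hε)))
    ((memLp_two_iff_integrable_sq hm).2 (integrable_radial_iff.2 (integral_expFn_deriv hε).1))
  refine ⟨w, h1, ?_⟩
  rw [norm_sq_eq_integral, ← (integral_expFn_deriv hε).2, ← integral_radial]
  refine integral_congr_ae ?_
  filter_upwards [h2] with r hr
  rw [hr]

namespace CoreODE

variable {d : ℤ} {κ : ℝ} {f S : ℝ → ℝ}

theorem κ_ne_zero (h : CoreODE d κ f S) : κ ≠ 0 := by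
  rintro rfl
  have := h.two_le_κ_sq
  norm_num at this

theorem rayleigh_eq (h : CoreODE d κ f S) (g : ℝ) (w : SpaceH) :
    κ ^ 2 * ∫ r, (1 / κ ^ 2 * Hder w r ^ 2 - (1 - f r ^ 2) * Hfn w r ^ 2) ∂radialMeasure
      = h.formW g w w - g * κ ^ 2 * ‖Hval w‖ ^ 2 := by
  have hκ := h.κ_ne_zero
  rw [formW_eq_integral, norm_sq_eq_integral, ← integral_const_mul]
  simp only [← sq]
  rw [add_sub_cancel_right]
  refine integral_congr_ae (Eventually.of_forall fun r => ?_)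
  simp only [Hval_eq, Hdiff_eq]
  field_simp

/-- For fixed w ≠ 0 the form is affine in g with slope κ²‖w‖² in L²_r norm, so the quotient q is
determined by the vanishing of the form at g = -q. -/
theorem mem_rayleighSet_iff (h : CoreODE d κ f S) {q : ℝ} :
    q ∈ rayleighSet κ f ↔ ∃ w : SpaceH, w ≠ 0 ∧ h.formW (-q) w w = 0 := by
  have hκ : 0 < κ ^ 2 := by linarith [h.two_le_κ_sq]
  refine exists_congr fun w => and_congr_right fun hw => ?_
  have hn := norm_Hval_pos hw
  have h1 := h.rayleigh_eq (-q) w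
  rw [show ∫ r, Hfn w r ^ 2 ∂radialMeasure = ‖Hval w‖ ^ 2 from (norm_sq_eq_integral _).symm,
    eq_div_iff (by positivity),
    ← mul_right_inj' hκ.ne', h1]
  constructor
  · intro h; linarith
  · intro h; linarith

theorem formW_add (h : CoreODE d κ f S) (g t : ℝ) (w : SpaceH) :
    h.formW (g + t) w w = h.formW g w w + t * κ ^ 2 * ‖Hval w‖ ^ 2 := by
  rw [formW_apply, formW_apply, real_inner_self_eq_norm_sq (Hval w)]; ring

/-- At g = 1 the density is w'² + κ²f²w². This bounds the Rayleigh quotient below by -1. -/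
theorem formW_one_nonneg (h : CoreODE d κ f S) (w : SpaceH) : 0 ≤ h.formW 1 w w := by
  rw [formW_eq_integral, ← integral_const_mul, ← integral_add]
  · refine integral_nonneg_of_ae (Eventually.of_forall fun r => ?_)
    simp only [Pi.zero_apply]
    nlinarith [sq_nonneg (κ * f r * Hval w r), sq_nonneg (Hdiff w r)]
  · refine ((integrable_mul (Hdiff w) (Hdiff w)).sub
      ((h.integrable_V_mul w w).const_mul (κ ^ 2))).congr (Eventually.of_forall fun r => ?_)
    simp only [Pi.sub_apply]; ring
  · exact (integrable_mul _ _).const_mul _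

theorem exists_formW_eq_zero (h : CoreODE d κ f S) {w : SpaceH} (hw : w ≠ 0) :
    ∃ t, h.formW t w w = 0 := by
  have hκ := h.κ_ne_zero
  have hn := norm_Hval_pos hw
  refine ⟨0 + -(h.formW 0 w w / (κ ^ 2 * ‖Hval w‖ ^ 2)), ?_⟩
  rw [formW_add]
  field_simp
  ring

theorem bddBelow_rayleighSet (h : CoreODE d κ f S) : BddBelow (rayleighSet κ f) := by
  have hκ : 0 < κ ^ 2 := by linarith [h.two_le_κ_sq]
  refine ⟨-1, fun q hq => ?_⟩
  obtain ⟨w, hw, h0⟩ := h.mem_rayleighSet_iff.1 hq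
  have h1 := h.formW_one_nonneg w
  have h2 := h.formW_add (-q) (1 + q) w
  rw [show -q + (1 + q) = 1 by ring, h0] at h2
  have hn := norm_Hval_pos hw
  have hp : 0 < κ ^ 2 * ‖Hval w‖ ^ 2 := by positivity
  by_contra hc
  nlinarith

theorem formW_gStar_nonneg (h : CoreODE d κ f S) (w : SpaceH) : 0 ≤ h.formW (gStar κ f) w w := by
  have hκ : 0 < κ ^ 2 := by linarith [h.two_le_κ_sq]
  by_cases hw : w = 0
  · simp [hw]
  obtain ⟨t, ht⟩ := h.exists_formW_eq_zero hw
  have hmem : -t ∈ rayleighSet κ f := h.mem_rayleighSet_iff.2 ⟨w, hw, by rwa [neg_neg]⟩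
  have h1 : -gStar κ f ≤ -t := by
    rw [gStar, neg_neg]; exact csInf_le h.bddBelow_rayleighSet hmem
  have h2 := h.formW_add t (gStar κ f - t) w
  rw [add_sub_cancel, ht, zero_add] at h2
  rw [h2]
  have : 0 ≤ gStar κ f - t := by linarith
  positivity

/-- The weight exp(-2(1 + r)) lies below exp(-2r^ε) for every ε in (0, 1], so it bounds the
potential energies of all these test functions below by one constant. -/
theorem integral_V_exp_pos (h : CoreODE d κ f S) :
    IntegrableOn (fun r => (1 - f r ^ 2) * Real.exp (-(2 * (1 + r))) * r) (Ioi 0) ∧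
    0 < ∫ r in Ioi 0, (1 - f r ^ 2) * Real.exp (-(2 * (1 + r))) * r := by
  have hc : ContinuousOn (fun r => (1 - f r ^ 2) * Real.exp (-(2 * (1 + r))) * r) (Ioi 0) :=
    ((continuousOn_const.sub (h.cont_f.pow 2)).mul (by fun_prop)).mul continuousOn_id
  have hi : IntegrableOn (fun r => (1 - f r ^ 2) * Real.exp (-(2 * (1 + r))) * r) (Ioi 0) := by
    refine (integrableOn_expFn one_pos).mono' (hc.aestronglyMeasurable measurableSet_Ioi) ?_
    filter_upwards [ae_restrict_mem measurableSet_Ioi] with r hr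
    have hr' : 0 < r := hr
    have hV := h.V_nonneg hr'
    have hV1 : 1 - f r ^ 2 ≤ 1 := by nlinarith [sq_nonneg (f r)]
    have he : Real.exp (-(2 * (1 + r))) ≤ expFn 1 r ^ 2 := by
      rw [expFn, Real.rpow_one, ← Real.exp_nat_mul]
      refine Real.exp_le_exp.2 ?_
      push_cast; linarith
    rw [Real.norm_of_nonneg (by positivity)]
    refine mul_le_mul_of_nonneg_right ?_ hr'.le
    exact (mul_le_of_le_one_left (Real.exp_pos _).le hV1).trans he
  refine ⟨hi, ?_⟩
  have hnn : 0 ≤ᵐ[volume.restrict (Ioi 0)]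
      fun r => (1 - f r ^ 2) * Real.exp (-(2 * (1 + r))) * r := by
    filter_upwards [ae_restrict_mem measurableSet_Ioi] with r hr
    have hr' : 0 < r := hr
    have := h.V_nonneg hr'
    simp only [Pi.zero_apply]
    positivity
  refine (integral_nonneg_of_ae hnn).lt_of_ne' fun h0 => ?_
  have hz := (integral_eq_zero_iff_of_nonneg_ae hnn hi).1 h0
  obtain ⟨r, hr, hfr⟩ := h.exists_f_lt_one
  have := Measure.eqOn_open_of_ae_eq hz isOpen_Ioi hc continuousOn_const hr
  simp only [Pi.zero_apply, mul_eq_zero, (Real.exp_pos _).ne', hr.ne', or_false] at this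
  nlinarith [h.f_nonneg r hr]

/-- With the test function exp(-r^ε), the form at g = 0 is at most ε/4 - κ²c < 0, whereas the form
at g* is nonnegative. -/
theorem gStar_pos (h : CoreODE d κ f S) : 0 < gStar κ f := by
  have hκ : 2 ≤ κ ^ 2 := h.two_le_κ_sq
  obtain ⟨hi, hpos⟩ := h.integral_V_exp_pos
  set c := ∫ r in Ioi 0, (1 - f r ^ 2) * Real.exp (-(2 * (1 + r))) * r with hc
  -- ε ≤ 1 gives r^ε ≤ 1 + r, and ε ≤ c gives ε/4 < κ²c.
  set ε := min 1 c with hε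
  have hε0 : 0 < ε := by positivity
  obtain ⟨w, hw, hd⟩ := exists_H_expFn hε0
  have h1 : c ≤ ∫ r, (1 - f r ^ 2) * Hval w r * Hval w r ∂radialMeasure := by
    rw [hc, ← integral_radial fun r => (1 - f r ^ 2) * Real.exp (-(2 * (1 + r)))]
    refine integral_mono_ae (integrable_radial_iff.2 hi) (h.integrable_V_mul w w) ?_
    filter_upwards [ae_radial_pos, hw] with r hr e
    rw [e, mul_assoc]
    refine mul_le_mul_of_nonneg_left ?_ (h.V_nonneg hr)
    rw [expFn, ← Real.exp_add]
    refine Real.exp_le_exp.2 ?_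
    have : r ^ ε ≤ 1 + r := by
      rcases le_or_gt r 1 with h1 | h1
      · linarith [Real.rpow_le_one hr.le h1 hε0.le]
      · have := Real.rpow_le_rpow_of_exponent_le h1.le (min_le_left 1 c)
        rw [Real.rpow_one] at this
        linarith
    linarith
  have h2 : h.formW 0 w w < 0 := by
    have e : h.formW 0 w w = ‖Hdiff w‖ ^ 2
        - κ ^ 2 * ∫ r, (1 - f r ^ 2) * Hval w r * Hval w r ∂radialMeasure := by
      rw [formW_apply, real_inner_self_eq_norm_sq, zero_mul, zero_mul, add_zero, inner_eq_integral]
      congr 2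
      refine integral_congr_ae ?_
      filter_upwards [h.dV_ae, prodH_ae w w] with r h1 h2
      rw [h1, h2, mul_assoc]
    rw [e, hd]
    have : ε ≤ c := min_le_right _ _
    nlinarith
  have h3 := h.formW_gStar_nonneg w
  have h4 := h.formW_add 0 (gStar κ f) w
  rw [zero_add] at h4
  by_contra hneg
  have : gStar κ f * κ ^ 2 * ‖Hval w‖ ^ 2 ≤ 0 :=
    mul_nonpos_of_nonpos_of_nonneg (mul_nonpos_of_nonpos_of_nonneg (not_lt.1 hneg) (sq_nonneg _))
      (sq_nonneg _)
  linarith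

theorem formW_lower_functionals (h : CoreODE d κ f S) {g : ℝ} (hg : 0 < g) :
    ∃ (N : ℕ) (l : SpaceH →L[ℝ] (Fin N → ℝ)) (c : ℝ), 0 < c ∧
      ∀ w : SpaceH, c * ‖w‖ ^ 2 ≤ h.formW g w w + ‖l w‖ ^ 2 := by
  have hκ : 0 < κ ^ 2 := by linarith [h.two_le_κ_sq]
  obtain ⟨R, hR, c, hc, hlow⟩ := h.formW_lower hg
  obtain ⟨N, l, K, hK, hl⟩ := exists_finite_functionals hR (ε := c / (2 * κ ^ 2)) (by positivity)
  refine ⟨N, (κ ^ 2 * K + 1) • l, c / 2, by positivity, fun w => ?_⟩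
  have h1 := hlow w
  have h2 := mul_le_mul_of_nonneg_left (hl w) hκ.le
  have h3 : κ ^ 2 * (c / (2 * κ ^ 2) * ‖w‖ ^ 2 + K * ‖l w‖ ^ 2)
      = c / 2 * ‖w‖ ^ 2 + κ ^ 2 * K * ‖l w‖ ^ 2 := by
    have := h.κ_ne_zero
    field_simp
  rw [_root_.smul_apply, norm_smul, Real.norm_of_nonneg (by positivity), mul_pow]
  have h4 : κ ^ 2 * K * ‖l w‖ ^ 2 ≤ (κ ^ 2 * K + 1) ^ 2 * ‖l w‖ ^ 2 := by
    refine mul_le_mul_of_nonneg_right ?_ (sq_nonneg _)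
    have : 0 ≤ κ ^ 2 * K := by positivity
    nlinarith
  linarith

/-- Without a minimizer the form at g* would be positive definite, hence coercive because g* > 0. -/
theorem exists_minimizer (h : CoreODE d κ f S) :
    ∃ w : SpaceH, w ≠ 0 ∧ h.formW (gStar κ f) w w = 0 := by
  by_contra! hcon
  have hκ : 0 < κ ^ 2 := by linarith [h.two_le_κ_sq]
  obtain ⟨N, l, c, hc, hlow⟩ := h.formW_lower_functionals h.gStar_pos
  obtain ⟨c', hc', hcoer⟩ := coercive_of_posDef (h.formW (gStar κ f)) (h.formW_symm _) l hc hlow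
    fun w hw => (h.formW_gStar_nonneg w).lt_of_ne' (hcon w hw)
  have hne : (rayleighSet κ f).Nonempty := by
    obtain ⟨w, -, hw⟩ := exists_H_expFn one_pos
    have hw0 : w ≠ 0 := by
      rintro rfl
      norm_num at hw
    obtain ⟨t, ht⟩ := h.exists_formW_eq_zero hw0
    exact ⟨-t, h.mem_rayleighSet_iff.2 ⟨w, hw0, by rwa [neg_neg]⟩⟩
  -- The coercivity constant would raise the infimum of the Rayleigh quotients by c'/κ².
  have hlb : -gStar κ f + c' / κ ^ 2 ≤ sInf (rayleighSet κ f) := by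
    refine le_csInf hne fun q hq => ?_
    obtain ⟨w, hw, h0⟩ := h.mem_rayleighSet_iff.1 hq
    have h1 := hcoer w
    have h2 := h.formW_add (-q) (gStar κ f + q) w
    rw [show -q + (gStar κ f + q) = gStar κ f by ring, h0, zero_add] at h2
    rw [h2] at h1
    have hn := norm_Hval_pos hw
    have h3 := mul_le_mul_of_nonneg_left (norm_Hval_le w) hc'.le
    have h4 : c' * ‖Hval w‖ ^ 2 ≤ (gStar κ f + q) * κ ^ 2 * ‖Hval w‖ ^ 2 := h3.trans h1
    have h5 := le_of_mul_le_mul_right h4 (by positivity)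
    have h6 : c' / κ ^ 2 ≤ gStar κ f + q := (div_le_iff₀ hκ).2 h5
    linarith
  have : -gStar κ f = sInf (rayleighSet κ f) := by rw [gStar, neg_neg]
  have : 0 < c' / κ ^ 2 := by positivity
  linarith

theorem isLeast_rayleighSet (h : CoreODE d κ f S) : IsLeast (rayleighSet κ f) (-gStar κ f) := by
  refine ⟨h.mem_rayleighSet_iff.2 ?_, fun q hq => ?_⟩
  · rw [neg_neg]; exact h.exists_minimizer
  · rw [gStar, neg_neg]; exact csInf_le h.bddBelow_rayleighSet hq

theorem isEigenfunction_iff (h : CoreODE d κ f S) (g : ℝ) (w : SpaceH) :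
    IsEigenfunction (fun r => κ ^ 2 * (1 - f r ^ 2)) (-(κ ^ 2 * g)) w ↔
      w ≠ 0 ∧ h.formW g w = 0 := by
  refine and_congr_right fun _ => ?_
  rw [ContinuousLinearMap.ext_iff]
  refine forall_congr' fun φ => ?_
  rw [formW_eq_integral, _root_.zero_apply]
  simp only [← Hval_eq, ← Hdiff_eq]
  constructor
  · intro h; linarith
  · intro h; linarith

theorem formW_gStar_eq_zero (h : CoreODE d κ f S) {w : SpaceH}
    (hw : h.formW (gStar κ f) w w = 0) : h.formW (gStar κ f) w = 0 :=
  ContinuousLinearMap.ext fun z =>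
    apply_eq_zero_of_nonneg _ (h.formW_symm _) h.formW_gStar_nonneg hw z

theorem le_of_isEigenfunction (h : CoreODE d κ f S) {lam : ℝ} {φ : SpaceH}
    (hφ : IsEigenfunction (fun r => κ ^ 2 * (1 - f r ^ 2)) lam φ) :
    -(κ ^ 2 * gStar κ f) ≤ lam := by
  have hκ : 0 < κ ^ 2 := by linarith [h.two_le_κ_sq]
  have e : lam = -(κ ^ 2 * (-lam / κ ^ 2)) := by have := h.κ_ne_zero; field_simp
  rw [e] at hφ
  obtain ⟨h0, h1⟩ := (h.isEigenfunction_iff _ _).1 hφ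
  have h2 := h.formW_add (-lam / κ ^ 2) (gStar κ f - -lam / κ ^ 2) φ
  rw [add_sub_cancel, h1, _root_.zero_apply, zero_add] at h2
  have h3 := h.formW_gStar_nonneg φ
  rw [h2] at h3
  have hn := norm_Hval_pos h0
  have h4 : 0 ≤ gStar κ f - -lam / κ ^ 2 := by
    by_contra hc
    have := mul_neg_of_neg_of_pos (mul_neg_of_neg_of_pos (not_le.1 hc) hκ)
      (by positivity : 0 < ‖Hval φ‖ ^ 2)
    linarith
  rw [e]
  have := mul_nonneg hκ.le h4
  nlinarith

end CoreODE

/-! ### The ground state: regularity, positivity, simplicity -/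

theorem exists_H_test {φ : ℝ → ℝ} (hφ : ContDiff ℝ ∞ φ) (hc : HasCompactSupport φ)
    (hs : tsupport φ ⊆ Ioi 0) : ∃ z : SpaceH, (∀ᵐ r ∂radialMeasure, Hval z r = φ r) ∧
      ∀ᵐ r ∂radialMeasure, Hdiff z r = deriv φ r := by
  have hmem : ∀ ψ : ℝ → ℝ, Continuous ψ → HasCompactSupport ψ → tsupport ψ ⊆ Ioi 0 →
      MemLp ψ 2 radialMeasure := fun ψ h1 h2 h3 => by
    refine (memLp_test_div (φ := fun r => r * ψ r) (continuous_id.mul h1) h2.mul_left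
      ((tsupport_mul_subset_right).trans h3)).ae_eq ?_
    filter_upwards [ae_radial_pos] with r hr
    field_simp
  have hd : Continuous (deriv φ) := hφ.continuous_deriv (by simp)
  have hp : HasPrim φ (deriv φ) := HasPrim.of_hasDerivAt
    (fun x _ => (hφ.differentiable (by simp) x).hasDerivAt) hd.continuousOn
  obtain ⟨z, h1, h2, -⟩ := hp.exists_H (hmem φ hφ.continuous hc hs)
    (hmem _ hd hc.deriv (tsupport_deriv_subset.trans hs))
  exact ⟨z, h1, h2⟩

theorem HasPrim.comp_min {U p : ℝ → ℝ} (h : HasPrim U p) {x₀ : ℝ} (hx₀ : 0 < x₀) :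
    HasPrim (fun x => U (min x x₀)) ((Iic x₀).indicator p) := by
  have hl : LocInt ((Iic x₀).indicator p) := fun a b ha hb =>
    ⟨(h.locInt a b ha hb).1.indicator measurableSet_Iic,
      (h.locInt a b ha hb).2.indicator measurableSet_Iic⟩
  have key : ∀ x, 0 < x → ∫ t in x₀..x, (Iic x₀).indicator p t = U (min x x₀) - U x₀ := by
    intro x hx
    rcases le_or_gt x x₀ with hle | hlt
    · rw [min_eq_left hle, h.sub_eq x₀ x hx₀ hx]
      refine intervalIntegral.integral_congr fun t ht => ?_
      rw [uIcc_of_ge hle] at ht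
      exact indicator_of_mem (show t ∈ Iic x₀ from ht.2) _
    · rw [min_eq_right hlt.le, sub_self, intervalIntegral.integral_of_le hlt.le]
      refine setIntegral_eq_zero_of_forall_eq_zero fun t ht => ?_
      exact indicator_of_notMem (fun h : t ∈ Iic x₀ => absurd ht.1 (not_lt.2 h)) _
  refine ⟨hl, fun a b ha hb => ?_⟩
  rw [← intervalIntegral.integral_interval_sub_left (hl x₀ b hx₀ hb) (hl x₀ a hx₀ ha), key a ha,
    key b hb]
  ring

/-- Because w vanishes at x₀, its restriction to (0, x₀] extended by zero is still locally
absolutely continuous, being w frozen at its value at x₀. -/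
theorem exists_truncation (w : SpaceH) {x₀ : ℝ} (hx₀ : 0 < x₀) (h0 : Hrep w x₀ = 0) :
    ∃ z : SpaceH, (∀ᵐ r ∂radialMeasure, Hval z r = (Iic x₀).indicator (Hval w) r) ∧
      (∀ᵐ r ∂radialMeasure, Hdiff z r = (Iic x₀).indicator (Hdiff w) r) ∧
      ∀ x, 0 < x → Hrep z x = Hrep w (min x x₀) := by
  have hae : ∀ᵐ r ∂radialMeasure, (Iic x₀).indicator (Hval w) r = Hrep w (min r x₀) := by
    filter_upwards [ae_radial_iff.2 (Hrep_ae w)] with r hr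
    rcases le_or_gt r x₀ with hle | hlt
    · rw [indicator_of_mem (show r ∈ Iic x₀ from hle), min_eq_left hle, hr]
    · rw [indicator_of_notMem (show r ∉ Iic x₀ from not_le.2 hlt), min_eq_right hlt.le, h0]
  obtain ⟨z, h1, h2, h3⟩ := ((Hrep_hasPrim w).comp_min hx₀).exists_H
    (((Lp.memLp (Hval w)).indicator measurableSet_Iic).ae_eq hae)
    ((Lp.memLp (Hdiff w)).indicator measurableSet_Iic)
  refine ⟨z, ?_, h2, h3⟩
  filter_upwards [h1, hae] with r e1 e2
  rw [e1, e2]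

namespace CoreODE

variable {d : ℤ} {κ : ℝ} {f S : ℝ → ℝ}

theorem hasWeakDeriv_of_formW_eq_zero (h : CoreODE d κ f S) {g : ℝ} {w : SpaceH}
    (hw : h.formW g w = 0) : HasWeakDeriv (fun r => r * Hdiff w r)
      (fun r => r * (κ ^ 2 * (g - (1 - f r ^ 2))) * Hval w r) := by
  intro φ hφ hc hs
  obtain ⟨z, hz, hz'⟩ := exists_H_test hφ hc hs
  have h1 : h.formW g w z = 0 := by rw [hw, _root_.zero_apply]
  have e1 : ∫ r in Ioi (0 : ℝ), r * Hdiff w r * deriv φ r = inner ℝ (Hdiff w) (Hdiff z) := by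
    rw [inner_eq_integral, integral_radial]
    refine integral_congr_ae ?_
    filter_upwards [ae_of_ae_radial hz'] with r hr
    rw [hr]; ring
  have e2 : ∫ r in Ioi (0 : ℝ), r * (κ ^ 2 * (g - (1 - f r ^ 2))) * Hval w r * φ r
      = g * κ ^ 2 * inner ℝ (Hval w) (Hval z) - κ ^ 2 * inner ℝ h.dV (prodH w z) := by
    rw [inner_eq_integral, inner_eq_integral, ← integral_const_mul, ← integral_const_mul,
      ← integral_sub ((integrable_mul _ _).const_mul _) ((integrable_mul _ _).const_mul _),
      integral_radial]
    refine integral_congr_ae ?_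
    filter_upwards [ae_of_ae_radial hz, ae_of_ae_radial h.dV_ae,
      ae_of_ae_radial (prodH_ae w z)] with r h1 h2 h3
    rw [h3, h2, h1]; ring
  rw [formW_apply] at h1
  rw [e1, e2]
  linarith

/-- The du Bois-Reymond lemma applied to r w' gives a continuous flux P. Then w' = P/r is
continuous, and so is P', so the eigenvalue equation holds classically as a first order system. -/
theorem exists_ode_of_formW_eq_zero (h : CoreODE d κ f S) {g : ℝ} {w : SpaceH}
    (hw : h.formW g w = 0) : ∃ P : ℝ → ℝ,
      (∀ x, 0 < x → HasDerivAt (Hrep w) (x⁻¹ * P x) x) ∧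
      ∀ x, 0 < x → HasDerivAt P (x * (κ ^ 2 * (g - (1 - f x ^ 2))) * Hrep w x) x := by
  have hc : ContinuousOn (fun r => r * (κ ^ 2 * (g - (1 - f r ^ 2)))) (Ioi 0) :=
    continuousOn_id.mul (continuousOn_const.mul (continuousOn_const.sub
      (continuousOn_const.sub (h.cont_f.pow 2))))
  obtain ⟨P, hP, he⟩ := (h.hasWeakDeriv_of_formW_eq_zero hw).exists_hasPrim
    (LocInt.continuousOn_mul continuousOn_id (locInt_radialL2 _))
    (LocInt.continuousOn_mul hc (locInt_radialL2 _))
  have hWc := (Hrep_hasPrim w).continuousOn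
  refine ⟨P, fun x hx => ?_, fun x hx => ?_⟩
  · refine HasPrim.hasDerivAt_of_continuousOn (p := fun x => x⁻¹ * P x)
      ((Hrep_hasPrim w).congr (fun _ _ => rfl) ?_)
      ((continuousOn_id.inv₀ fun x hx => ne_of_gt hx).mul hP.continuousOn) hx
    filter_upwards [he] with r hr h0
    rw [← hr h0, inv_mul_cancel_left₀ h0.ne']
  · refine HasPrim.hasDerivAt_of_continuousOn
      (p := fun x => x * (κ ^ 2 * (g - (1 - f x ^ 2))) * Hrep w x)
      (hP.congr (fun _ _ => rfl) ?_) (hc.mul hWc) hx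
    filter_upwards [Hrep_ae w] with r hr h0
    rw [hr h0]

theorem eq_zero_of_eventually (h : CoreODE d κ f S) {g : ℝ} {w : SpaceH}
    (hw : h.formW g w = 0) {x₀ : ℝ} (hx₀ : 0 < x₀) (h0 : ∀ᶠ x in 𝓝 x₀, Hrep w x = 0) : w = 0 := by
  obtain ⟨P, h1, h2⟩ := h.exists_ode_of_formW_eq_zero hw
  have h3 : HasDerivAt (Hrep w) 0 x₀ := (hasDerivAt_const x₀ (0 : ℝ)).congr_of_eventuallyEq h0
  have h4 : P x₀ = 0 := by
    rcases mul_eq_zero.1 ((h1 x₀ hx₀).unique h3) with e | e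
    · exact absurd e (inv_ne_zero hx₀.ne')
    · exact e
  refine H_eq_zero_of_Hrep fun x hx => linear_ode_eq_zero
    (continuousOn_id.inv₀ fun x hx => ne_of_gt hx)
    (continuousOn_id.mul (continuousOn_const.mul (continuousOn_const.sub
      (continuousOn_const.sub (h.cont_f.pow 2))))) h1 h2 hx₀ h0.self_of_nhds h4 hx

/-- A ground state that vanishes somewhere vanishes identically. -/
theorem eq_zero_of_Hrep_eq_zero (h : CoreODE d κ f S) {w : SpaceH}
    (hw : h.formW (gStar κ f) w = 0) {x₀ : ℝ} (hx₀ : 0 < x₀) (h0 : Hrep w x₀ = 0) : w = 0 := by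
  obtain ⟨z, hz, hz', hzr⟩ := exists_truncation w hx₀ h0
  -- Pointwise z is either w or 0, so pairing z with itself or with w gives the same value, and the
  -- latter is 0. Thus z is again a ground state; it vanishes beyond x₀, so z = 0 and w vanishes on
  -- (0, x₀).
  have e : h.formW (gStar κ f) z z = h.formW (gStar κ f) w z := by
    rw [formW_eq_integral, formW_eq_integral]
    congr 1
    · refine integral_congr_ae ?_
      filter_upwards [hz, hz'] with r e1 e2
      rw [e1, e2]
      by_cases hr : r ∈ Iic x₀ <;> simp [hr]
    · congr 1
      refine integral_congr_ae ?_
      filter_upwards [hz] with r e1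
      rw [e1]
      by_cases hr : r ∈ Iic x₀ <;> simp [hr]
  have hz0 : z = 0 := by
    refine h.eq_zero_of_eventually (h.formW_gStar_eq_zero (e.trans (by rw [hw, _root_.zero_apply])))
      (x₀ := x₀ + 1) (by linarith) ?_
    filter_upwards [Ioi_mem_nhds (show x₀ < x₀ + 1 by linarith)] with x hx
    have hx' : x₀ < x := hx
    rw [hzr x (hx₀.trans hx'), min_eq_right hx'.le, h0]
  refine h.eq_zero_of_eventually hw (x₀ := x₀ / 2) (by linarith) ?_
  filter_upwards [Ioo_mem_nhds (show 0 < x₀ / 2 by linarith) (show x₀ / 2 < x₀ by linarith)]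
    with x hx
  have h1 := hzr x hx.1
  rw [min_eq_left hx.2.le, hz0] at h1
  rw [← h1, ← zero_smul ℝ (0 : SpaceH), Hrep_smul _ _ hx.1, zero_mul]

/-- A minimizer has no zero, so by continuity it has constant sign, and a factor -1 makes it
positive. -/
theorem exists_ground_state (h : CoreODE d κ f S) :
    ∃ w : SpaceH, w ≠ 0 ∧ h.formW (gStar κ f) w = 0 ∧ ∀ x, 0 < x → 0 < Hrep w x := by
  have key : ∀ w : SpaceH, w ≠ 0 → h.formW (gStar κ f) w = 0 → 0 < Hrep w 1 →
      ∀ x, 0 < x → 0 < Hrep w x := by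
    intro w hw0 hw h1 x hx
    by_contra hneg
    obtain ⟨y, hy, hy0⟩ := intermediate_value_uIcc
      ((Hrep_hasPrim w).continuousOn.mono (uIcc_subset_Ioi one_pos hx))
      (show (0 : ℝ) ∈ uIcc (Hrep w 1) (Hrep w x) from
        mem_uIcc.2 (Or.inr ⟨not_lt.1 hneg, h1.le⟩))
    exact hw0 (h.eq_zero_of_Hrep_eq_zero hw (uIcc_subset_Ioi one_pos hx hy) hy0)
  obtain ⟨w, hw0, hw⟩ := h.exists_minimizer
  have hw' := h.formW_gStar_eq_zero hw
  rcases lt_trichotomy (Hrep w 1) 0 with h1 | h1 | h1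
  · have h2 : (-1 : ℝ) • w ≠ 0 := smul_ne_zero (by norm_num) hw0
    have h3 : h.formW (gStar κ f) ((-1 : ℝ) • w) = 0 := by rw [map_smul, hw', smul_zero]
    refine ⟨(-1 : ℝ) • w, h2, h3, key _ h2 h3 ?_⟩
    rw [Hrep_smul _ _ one_pos]
    linarith
  · exact absurd (h.eq_zero_of_Hrep_eq_zero hw' one_pos h1) hw0
  · exact ⟨w, hw0, hw', key w hw0 hw' h1⟩

/-- The combination of two ground states that vanishes at r = 1 is a ground state with a zero, hence
zero. -/
theorem eq_smul_of_formW_eq_zero (h : CoreODE d κ f S) {w φ : SpaceH}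
    (hw : h.formW (gStar κ f) w = 0) (hpos : 0 < Hrep w 1) (hφ : h.formW (gStar κ f) φ = 0) :
    ∃ c : ℝ, φ = c • w := by
  refine ⟨Hrep φ 1 / Hrep w 1, ?_⟩
  have h1 : φ + (-(Hrep φ 1 / Hrep w 1)) • w = 0 := by
    refine h.eq_zero_of_Hrep_eq_zero ?_ one_pos ?_
    · rw [map_add, map_smul, hw, hφ, smul_zero, add_zero]
    · rw [Hrep_add _ _ one_pos, Hrep_smul _ _ one_pos]
      field_simp
      ring
  rw [neg_smul, ← sub_eq_add_neg, sub_eq_zero] at h1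
  exact h1

end CoreODE

/-! ### The linearization at g*: kernel and range -/

theorem norm_XtoH_le (u : SpaceX) : ‖XtoH u‖ ^ 2 ≤ ‖u‖ ^ 2 := by
  rw [norm_sq_H, norm_sq_X, Hval_XtoH, Hdiff_XtoH]
  linarith [sq_nonneg ‖Xquot u‖]

/-- `Y₀`, renormed as a Hilbert space. -/
def hilbertEquivY₀ : WithLp 2 (SpaceX × WithLp 2 (SpaceX × SpaceH)) ≃L[ℝ] SpaceY₀ :=
  (WithLp.prodContinuousLinearEquiv 2 ℝ SpaceX (WithLp 2 (SpaceX × SpaceH))).trans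
    ((ContinuousLinearEquiv.refl ℝ SpaceX).prodCongr
      (WithLp.prodContinuousLinearEquiv 2 ℝ SpaceX SpaceH))

theorem norm_sq_Y₀_le (y : SpaceY₀) : ‖y‖ ^ 2 ≤ ‖y.1‖ ^ 2 + ‖y.2.1‖ ^ 2 + ‖y.2.2‖ ^ 2 := by
  have h1 := sq_nonneg ‖y.1‖
  have h2 := sq_nonneg ‖y.2.1‖
  have h3 := sq_nonneg ‖y.2.2‖
  rw [Prod.norm_def, Prod.norm_def]
  rcases max_choice ‖y.1‖ (max ‖y.2.1‖ ‖y.2.2‖) with e | e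
  · rw [e]; linarith
  · rw [e]
    rcases max_choice ‖y.2.1‖ ‖y.2.2‖ with e | e <;> rw [e] <;> linarith

namespace CoreODE

variable {d : ℤ} {κ : ℝ} {f S : ℝ → ℝ}

theorem uvForm_lower_functionals (h : CoreODE d κ f S) :
    ∃ (N : ℕ) (l : SpaceH →L[ℝ] (Fin N → ℝ)), ∀ u v : SpaceX,
      1 / 8 * (‖u‖ ^ 2 + ‖v‖ ^ 2) ≤ ∫ r, uvDensity κ (d - S r) (f r) (Xval u r) (Xdiff u r)
        (Xquot u r) (Xval v r) (Xdiff v r) (Xquot v r) ∂radialMeasure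
        + (‖l (XtoH u)‖ ^ 2 + ‖l (XtoH v)‖ ^ 2) := by
  obtain ⟨R, hR, C, hC, hlow⟩ := h.uvForm_lower
  obtain ⟨N, l, K, hK, hl⟩ := exists_finite_functionals hR (ε := 1 / (8 * C)) (by positivity)
  have hl' : ∀ u : SpaceX, C * ∫ r in Iic R, Xval u r ^ 2 ∂radialMeasure
      ≤ 1 / 8 * ‖u‖ ^ 2 + ‖((C * K + 1) • l) (XtoH u)‖ ^ 2 := fun u => by
    have h1 := mul_le_mul_of_nonneg_left (hl (XtoH u)) hC.le
    have h2 : C * (1 / (8 * C) * ‖XtoH u‖ ^ 2 + K * ‖l (XtoH u)‖ ^ 2)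
        = 1 / 8 * ‖XtoH u‖ ^ 2 + C * K * ‖l (XtoH u)‖ ^ 2 := by
      field_simp
    rw [_root_.smul_apply, norm_smul, Real.norm_of_nonneg (by positivity), mul_pow]
    have h4 : C * K * ‖l (XtoH u)‖ ^ 2 ≤ (C * K + 1) ^ 2 * ‖l (XtoH u)‖ ^ 2 := by
      refine mul_le_mul_of_nonneg_right ?_ (sq_nonneg _)
      have : 0 ≤ C * K := by positivity
      nlinarith
    have h5 := norm_XtoH_le u
    rw [Hval_XtoH] at h1
    linarith
  refine ⟨N, (C * K + 1) • l, fun u v => ?_⟩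
  have h1 := hlow u v
  have h2 := hl' u
  have h3 := hl' v
  linarith

/-- The linearization at `g*`. -/
def linStar (h : CoreODE d κ f S) : SpaceY₀ →L[ℝ] SpaceY₀ →L[ℝ] ℝ :=
  h.hess₀ + gStar κ f • hess₁ κ

theorem linStar_symm (h : CoreODE d κ f S) (y z : SpaceY₀) : h.linStar y z = h.linStar z y := by
  simp only [linStar, _root_.add_apply, _root_.smul_apply, h.hess₀_symm y z, hess₁_symm y z]

theorem uvForm_nonneg (h : CoreODE d κ f S) (u v : SpaceX) :
    0 ≤ ∫ r, uvDensity κ (d - S r) (f r) (Xval u r) (Xdiff u r)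
      (Xquot u r) (Xval v r) (Xdiff v r) (Xquot v r) ∂radialMeasure := by
  by_cases huv : u = 0 ∧ v = 0
  · obtain ⟨rfl, rfl⟩ := huv
    refine ge_of_eq (integral_eq_zero_of_ae ?_)
    filter_upwards [Lp.coeFn_zero ℝ 2 radialMeasure] with r hr
    simp only [map_zero, hr, Pi.zero_apply, uvDensity]
    ring
  · exact (h.uvForm_pos huv).le

theorem linStar_inW (h : CoreODE d κ f S) {w : SpaceH} (hw : h.formW (gStar κ f) w = 0) :
    h.linStar (0, 0, w) = 0 :=
  ContinuousLinearMap.ext fun z => by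
    rw [linStar, h.linForm_inW, hw, _root_.zero_apply, _root_.zero_apply]

/-- Both diagonal forms are nonnegative, so each vanishes; the first is definite, and a null vector
of the nonnegative second form lies in its kernel. -/
theorem eq_of_linStar_self_eq_zero (h : CoreODE d κ f S) {y : SpaceY₀}
    (hy : h.linStar y y = 0) : y.1 = 0 ∧ y.2.1 = 0 ∧ h.formW (gStar κ f) y.2.2 = 0 := by
  rw [linStar, h.linForm_self] at hy
  have h1 := h.uvForm_nonneg y.1 y.2.1
  have h2 := h.formW_gStar_nonneg y.2.2
  have h3 : y.1 = 0 ∧ y.2.1 = 0 := by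
    by_contra hne
    linarith [h.uvForm_pos hne]
  exact ⟨h3.1, h3.2, h.formW_gStar_eq_zero (by linarith)⟩

theorem ker_linStar (h : CoreODE d κ f S) {w : SpaceH} (hw : h.formW (gStar κ f) w = 0)
    (hpos : 0 < Hrep w 1) : h.linStar.ker = Submodule.span ℝ {((0, 0, w) : SpaceY₀)} := by
  refine le_antisymm (fun y hy => ?_) ?_
  · have hy' : h.linStar y = 0 := hy
    obtain ⟨h1, h2, h3⟩ := h.eq_of_linStar_self_eq_zero (by rw [hy', _root_.zero_apply])
    obtain ⟨c, hc⟩ := h.eq_smul_of_formW_eq_zero hw hpos h3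
    refine Submodule.mem_span_singleton.2 ⟨c, ?_⟩
    refine Prod.ext ?_ (Prod.ext ?_ ?_)
    · simp [h1]
    · simp [h2]
    · simp [hc]
  · rw [Submodule.span_singleton_le_iff_mem]
    exact h.linStar_inW hw

theorem hess₁_inW (w : SpaceH) :
    hess₁ κ (0, 0, w) = κ ^ 2 • ((innerL RadialL2 (Hval w)) ∘L Hval ∘L projW) :=
  ContinuousLinearMap.ext fun z => by
    rw [hess₁_apply]; rfl

theorem exists_lower_functionals (h : CoreODE d κ f S) :
    ∃ (N M : ℕ) (l : SpaceY₀ →L[ℝ] (Fin N → ℝ) × (Fin N → ℝ) × (Fin M → ℝ)) (c : ℝ), 0 < c ∧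
      ∀ y, c * ‖y‖ ^ 2 ≤ h.linStar y y + ‖l y‖ ^ 2 := by
  obtain ⟨N, l₁, h₁⟩ := h.uvForm_lower_functionals
  obtain ⟨M, l₂, c, hc, h₂⟩ := h.formW_lower_functionals h.gStar_pos
  -- The target carries the maximum norm m; the factor 2 gives 4m², which dominates the sum of the
  -- three squared norms.
  refine ⟨N, M, (2 : ℝ) • ((l₁ ∘L XtoH ∘L projU).prod
    ((l₁ ∘L XtoH ∘L projV).prod (l₂ ∘L projW))), min (1 / 8) c, by positivity, fun y => ?_⟩
  have h1 := h₁ y.1 y.2.1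
  have h2 := h₂ y.2.2
  have h3 := mul_le_mul_of_nonneg_right (min_le_left (1 / 8) c)
    (add_nonneg (sq_nonneg ‖y.1‖) (sq_nonneg ‖y.2.1‖))
  have h4 := mul_le_mul_of_nonneg_right (min_le_right (1 / 8) c) (sq_nonneg ‖y.2.2‖)
  have h5 := mul_le_mul_of_nonneg_left (norm_sq_Y₀_le y)
    (by positivity : (0 : ℝ) ≤ min (1 / 8) c)
  set m := ‖((l₁ ∘L XtoH ∘L projU).prod ((l₁ ∘L XtoH ∘L projV).prod (l₂ ∘L projW))) y‖ with hm
  have e : ‖((2 : ℝ) • ((l₁ ∘L XtoH ∘L projU).prod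
      ((l₁ ∘L XtoH ∘L projV).prod (l₂ ∘L projW)))) y‖ ^ 2 = 4 * m ^ 2 := by
    rw [_root_.smul_apply, norm_smul, mul_pow, hm]
    norm_num
  have hm' : m = max ‖l₁ (XtoH y.1)‖ (max ‖l₁ (XtoH y.2.1)‖ ‖l₂ y.2.2‖) := rfl
  have a1 : ‖l₁ (XtoH y.1)‖ ^ 2 ≤ m ^ 2 :=
    pow_le_pow_left₀ (norm_nonneg _) (hm' ▸ le_max_left _ _) 2
  have a2 : ‖l₁ (XtoH y.2.1)‖ ^ 2 ≤ m ^ 2 :=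
    pow_le_pow_left₀ (norm_nonneg _) (hm' ▸ (le_max_left _ _).trans (le_max_right _ _)) 2
  have a3 : ‖l₂ y.2.2‖ ^ 2 ≤ m ^ 2 :=
    pow_le_pow_left₀ (norm_nonneg _) (hm' ▸ (le_max_right _ _).trans (le_max_right _ _)) 2
  rw [e, linStar, h.linForm_self]
  linarith [sq_nonneg m]

/-- The sum of the form of the linearization and of a square that is positive on its kernel is
coercive, so that the range of the linearization is a complement of the line through `∂_g 𝓕'`. -/
theorem exists_eq_smul_add (h : CoreODE d κ f S) {w : SpaceH} (hw0 : w ≠ 0)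
    (hw : h.formW (gStar κ f) w = 0) (hpos : 0 < Hrep w 1) (k : SpaceY₀ →L[ℝ] ℝ) :
    ∃ (t : ℝ) (y : SpaceY₀), k = t • hess₁ κ (0, 0, w) + h.linStar y := by
  obtain ⟨ℓ, hℓ⟩ : ∃ ℓ : SpaceY₀ →L[ℝ] ℝ, ℓ = (innerL RadialL2 (Hval w)) ∘L Hval ∘L projW :=
    ⟨_, rfl⟩
  -- The rank-one square is positive on the kernel line, so Q is positive definite, and the lower
  -- bound modulo finitely many functionals makes it coercive.
  set Q : SpaceY₀ →L[ℝ] SpaceY₀ →L[ℝ] ℝ := h.linStar + ℓ.smulRight ℓ with hQ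
  have hQa : ∀ y z, Q y z = h.linStar y z + ℓ y * ℓ z := fun y z => rfl
  have hnn : ∀ y, 0 ≤ h.linStar y y := fun y => by
    rw [linStar, h.linForm_self]
    exact add_nonneg (h.uvForm_nonneg _ _) (h.formW_gStar_nonneg _)
  obtain ⟨N, M, l, c, hc, hlow⟩ := h.exists_lower_functionals
  obtain ⟨c', hc', hcoer⟩ := coercive_of_posDef Q
    (fun y z => by rw [hQa, hQa, h.linStar_symm, mul_comm]) l hc
    (fun y => by
      have := hlow y
      rw [hQa]
      linarith [mul_self_nonneg (ℓ y)])
    (fun y hy => by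
      rw [hQa]
      refine (add_nonneg (hnn y) (mul_self_nonneg _)).lt_of_ne' fun h0 => hy ?_
      have h1 := hnn y
      have h2 := mul_self_nonneg (ℓ y)
      have h3 : h.linStar y y = 0 := by linarith
      have h4 : ℓ y = 0 := mul_self_eq_zero.1 (by linarith)
      obtain ⟨e1, e2, e3⟩ := h.eq_of_linStar_self_eq_zero h3
      obtain ⟨a, ha⟩ := h.eq_smul_of_formW_eq_zero hw hpos e3
      have h5 : a * ‖Hval w‖ ^ 2 = 0 := by
        rw [← h4, hℓ]
        simp only [ContinuousLinearMap.comp_apply, projW_apply, innerL_apply, ha, map_smul,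
          smul_eq_mul, real_inner_self_eq_norm_sq]
      have h6 := norm_Hval_pos hw0
      have h7 : a = 0 := (mul_eq_zero.1 h5).resolve_right (by positivity)
      refine Prod.ext e1 (Prod.ext e2 ?_)
      rw [ha, h7, zero_smul]
      rfl)
  obtain ⟨y, hy⟩ := surjective_of_coercive hilbertEquivY₀ Q hc' hcoer k
  -- The functional `hess₁ κ (0, 0, w)` is κ² ℓ, and Q y = L y + (ℓ y) ℓ.
  refine ⟨ℓ y / κ ^ 2, y, ?_⟩
  have hκ := h.κ_ne_zero
  rw [hess₁_inW, ← hℓ, smul_smul, div_mul_cancel₀ _ (pow_ne_zero 2 hκ), ← hy, add_comm]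
  rfl

/-- By symmetry every element of the range vanishes on the kernel vector (0, 0, w), where this
functional takes the value κ²‖w‖² in L²_r norm, which is positive. -/
theorem hess₁_notMem_range (h : CoreODE d κ f S) {w : SpaceH} (hw0 : w ≠ 0)
    (hw : h.formW (gStar κ f) w = 0) : hess₁ κ (0, 0, w) ∉ h.linStar.range := by
  rintro ⟨x, hx⟩
  have hx' : h.linStar x = hess₁ κ (0, 0, w) := hx
  have h1 : h.linStar x (0, 0, w) = 0 := by
    rw [h.linStar_symm, h.linStar_inW hw, _root_.zero_apply]
  rw [hx', hess₁_apply, real_inner_self_eq_norm_sq] at h1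
  have h2 := norm_Hval_pos hw0
  have h3 : 0 < κ ^ 2 := by linarith [h.two_le_κ_sq]
  have : 0 < κ ^ 2 * ‖Hval w‖ ^ 2 := by positivity
  exact this.ne' h1

theorem finrank_quotient_range (h : CoreODE d κ f S) {w : SpaceH} (hw0 : w ≠ 0)
    (hw : h.formW (gStar κ f) w = 0) (hpos : 0 < Hrep w 1) :
    Module.finrank ℝ ((SpaceY₀ →L[ℝ] ℝ) ⧸ h.linStar.range) = 1 := by
  refine finrank_eq_one (Submodule.Quotient.mk (hess₁ κ (0, 0, w))) ?_ fun q => ?_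
  · rw [Ne, Submodule.Quotient.mk_eq_zero]
    exact h.hess₁_notMem_range hw0 hw
  · obtain ⟨k, rfl⟩ := Submodule.Quotient.mk_surjective _ q
    obtain ⟨t, y, hk⟩ := h.exists_eq_smul_add hw0 hw hpos k
    refine ⟨t, ?_⟩
    rw [← Submodule.Quotient.mk_smul, Submodule.Quotient.eq, hk, sub_add_cancel_left]
    exact neg_mem ⟨y, rfl⟩

end CoreODE

end

/-! ### The bifurcating curve -/

namespace CoreODE

variable {d : ℤ} {κ : ℝ} {f S : ℝ → ℝ}

theorem linF_gStar (h : CoreODE d κ f S) : linF d κ f S (gStar κ f) = h.linStar := h.linF_eq _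

theorem inW_ne_zero {w : SpaceH} (hw0 : w ≠ 0) : ((0, 0, w) : SpaceY₀) ≠ 0 :=
  fun h0 => hw0 (congrArg (fun y : SpaceY₀ => y.2.2) h0)

theorem exists_curve (h : CoreODE d κ f S) {w : SpaceH} (hw0 : w ≠ 0)
    (hw : h.formW (gStar κ f) w = 0) (hpos : 0 < Hrep w 1) {Z : Submodule ℝ SpaceY₀}
    (hZ : IsClosed (Z : Set SpaceY₀)) (hcompl : IsCompl h.linStar.ker Z) :
    ∃ (U : Set (SpaceY₀ × ℝ)) (a : ℝ) (γ : ℝ → ℝ) (ψ : ℝ → SpaceY₀),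
      IsOpen U ∧ ((0 : SpaceY₀), gStar κ f) ∈ U ∧ 0 < a ∧
      ContDiffOn ℝ 1 γ (Ioo (-a) a) ∧ ContDiffOn ℝ 1 ψ (Ioo (-a) a) ∧
      γ 0 = gStar κ f ∧ ψ 0 = 0 ∧ (∀ s ∈ Ioo (-a) a, ψ s ∈ Z) ∧
      (∀ s ∈ Ioo (-a) a, w + (ψ s).2.2 ≠ 0) ∧
      {p : SpaceY₀ × ℝ | p ∈ U ∧ p.1 ≠ 0 ∧ mapF d κ f S p.1 p.2 = 0} =
        (fun s : ℝ => (s • (((0, 0, w) : SpaceY₀) + ψ s), γ s)) '' (Ioo (-a) a \ {0}) := by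
  -- An open condition that holds at 0 because w ≠ 0. Imposed on ψ, it keeps the third component s(w
  -- + ψ₃) nonzero for s ≠ 0.
  have hN : {y : SpaceY₀ | w + y.2.2 ≠ 0} ∈ 𝓝 (0 : SpaceY₀) := by
    refine IsOpen.mem_nhds (isOpen_ne_fun (by fun_prop) continuous_const) ?_
    simpa using hw0
  simp only [h.mapF_eq]
  exact exists_bifurcation_curve h.hess₀ (hess₁ κ) h.contDiff_rem₂ contDiff_rem₃ h.rem₂_smul
    rem₃_smul (gStar κ f) (inW_ne_zero hw0) (h.ker_linStar hw hpos) (h.hess₁_notMem_range hw0 hw)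
    (h.exists_eq_smul_add hw0 hw hpos) hN hZ hcompl

theorem finrank_ker_linStar (h : CoreODE d κ f S) {w : SpaceH} (hw0 : w ≠ 0)
    (hw : h.formW (gStar κ f) w = 0) (hpos : 0 < Hrep w 1) :
    Module.finrank ℝ h.linStar.ker = 1 := by
  rw [h.ker_linStar hw hpos]
  exact finrank_span_singleton (inW_ne_zero hw0)

end CoreODE

end SO5Vortex

theorem mainTheorem5 (d : ℤ) (hd : d ≠ 0) (κ : ℝ) (hκ : 2 * (d : ℝ) ^ 2 ≤ κ ^ 2)
    (f S : ℝ → ℝ) (hcore : IsNormalCore d κ f S) :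
    -- the energy is finite on `Y` and smooth, and the normal core is a zero for every `g`
    (∀ (y : SpaceY₀) (g : ℝ), Integrable (densityAt d κ f S y g) radialMeasure) ∧
    ContDiff ℝ ∞ (fun p : SpaceY₀ × ℝ => energy d κ f S p.1 p.2) ∧
    (∀ g : ℝ, mapF d κ f S 0 g = 0) ∧
    -- `-g*_κ < 0` is a ground state energy
    0 < gStar κ f ∧
    IsLeast (rayleighSet κ f) (-gStar κ f) ∧
    ∃ w : SpaceH,
      (∀ᵐ r ∂radialMeasure, 0 < Hfn w r) ∧
      -- `-κ² g*_κ` is the ground state eigenvalue of `-Δ_r - κ² (1 - f²)`, and it is simple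
      IsEigenfunction (fun r => κ ^ 2 * (1 - f r ^ 2)) (-(κ ^ 2 * gStar κ f)) w ∧
      (∀ φ : SpaceH, IsEigenfunction (fun r => κ ^ 2 * (1 - f r ^ 2)) (-(κ ^ 2 * gStar κ f)) φ →
        ∃ c : ℝ, φ = c • w) ∧
      (∀ (lam : ℝ) (φ : SpaceH),
        IsEigenfunction (fun r => κ ^ 2 * (1 - f r ^ 2)) lam φ → -(κ ^ 2 * gStar κ f) ≤ lam) ∧
      -- the linearization at `g*_κ`: kernel, codimension of the range, transversality
      (linF d κ f S (gStar κ f)).ker = Submodule.span ℝ {((0, 0, w) : SpaceY₀)} ∧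
      Module.finrank ℝ (linF d κ f S (gStar κ f)).ker = 1 ∧
      Module.finrank ℝ ((SpaceY₀ →L[ℝ] ℝ) ⧸ (linF d κ f S (gStar κ f)).range) = 1 ∧
      deriv (fun g : ℝ => linF d κ f S g) (gStar κ f) ((0, 0, w) : SpaceY₀)
        ∉ (linF d κ f S (gStar κ f)).range ∧
      -- the bifurcating curve, for every closed complement `Z` of the kernel
      ∀ Z : Submodule ℝ SpaceY₀, IsClosed (Z : Set SpaceY₀) →
        IsCompl (linF d κ f S (gStar κ f)).ker Z →
        ∃ (U : Set (SpaceY₀ × ℝ)) (a : ℝ) (γ : ℝ → ℝ) (ψ : ℝ → SpaceY₀),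
          IsOpen U ∧ ((0 : SpaceY₀), gStar κ f) ∈ U ∧ 0 < a ∧
          ContDiffOn ℝ 1 γ (Ioo (-a) a) ∧ ContDiffOn ℝ 1 ψ (Ioo (-a) a) ∧
          γ 0 = gStar κ f ∧ ψ 0 = 0 ∧
          (∀ s ∈ Ioo (-a) a, ψ s ∈ Z) ∧
          -- the antiferromagnetic order parameter does not vanish along the curve
          (∀ s ∈ Ioo (-a) a, w + (ψ s).2.2 ≠ 0) ∧
          {p : SpaceY₀ × ℝ | p ∈ U ∧ p.1 ≠ 0 ∧ mapF d κ f S p.1 p.2 = 0} =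
            (fun s : ℝ => (s • (((0, 0, w) : SpaceY₀) + ψ s), γ s)) '' (Ioo (-a) a \ {0}) := by
  have h : CoreODE d κ f S := hcore.coreODE hd hκ
  obtain ⟨w, hw0, hw, hpos⟩ := h.exists_ground_state
  have hpos1 := hpos 1 one_pos
  refine ⟨h.integrable_densityAt, h.contDiff_energy, h.mapF_zero, h.gStar_pos,
    h.isLeast_rayleighSet, w, ?_, (h.isEigenfunction_iff _ _).2 ⟨hw0, hw⟩, fun φ hφ => ?_,
    fun lam φ hφ => h.le_of_isEigenfunction hφ, ?_⟩
  · filter_upwards [ae_radial_pos, ae_radial_iff.2 (Hrep_ae w)] with r hr e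
    rw [← Hval_eq, e]
    exact hpos r hr
  · exact h.eq_smul_of_formW_eq_zero hw hpos1 ((h.isEigenfunction_iff _ _).1 hφ).2
  rw [h.linF_gStar, h.deriv_linF]
  exact ⟨h.ker_linStar hw hpos1, h.finrank_ker_linStar hw0 hw hpos1,
    h.finrank_quotient_range hw0 hw hpos1, h.hess₁_notMem_range hw0 hw,
    fun Z hZ hcompl => h.exists_curve hw0 hw hpos1 hZ hcompl⟩
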